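/- **Setting.** A *lattice* is a finite box $\Lambda=\prod_{i=1}^d\{0,\dots,N_i-1\}$, each coordinate direction having either open or periodic boundary conditions; $|n-m|$ is the maximum over the directions of the coordinate distances (cyclic in periodic directions), and $B(n,r)=\{m\in\Lambda:|n-m|\le r\}$. *Fermions.* Put $k$ fermionic modes with annihilation operators $a_{n,i}$ ($n\in\Lambda$, $1\le i\le k$) on each site and let $\mathcal F$ be their Fock space. An operator is localized on $R\subseteq\Lambda$ if it is a polynomial in the $a_{n,i},a_{n,i}^\dagger$ with $n\in R$; an observable localized on $R$ is a self-adjoint linear combination of products of even numbers of such operators. A *causal fermionic evolution of range $L$* is a unitary $U$ on $\mathcal F$ such that every $U^\dagger a_{n,i}U$ is localized on $B(n,L)$, and such that, when a further fermionic mode with annihilation operator $b$ is added to the system, $U$ commutes with $b$. *Qubits.* Put $q$ qubits on each site. A qubit operator is localized on $R$ if it acts as the identity on all qubits outside $R$. A *causal qubit evolution of range $L$* is a unitary $V$ such that for every $n$ and every operator $X$ localized on $\{n\}$, $V^\dagger XV$ is localized on $B(n,L)$. **Theorem.** For every $d$ there are a constant $c$ and a function $f:\mathbb N\to\mathbb N$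 (depending only on $d$) such that for every $k$ and every $d$-dimensional lattice $\Lambda$ (any side lengths, any open/periodic boundary conditions) the following holds for the system of $2k+c$ qubits per site of $\Lambda$, with state space $\mathcal Q$ (one qubit for each fermionic mode, one for its copy, and $c$ further ones). There is an isometry $J:\mathcal F\otimes\mathcal F\to\mathcal Q$ (the two factors being the original fermions and an identical copy) such that: 1. For all $n\in\Lambda$, $r\ge 0$, and every fermionic observable $X$ localized on $B(n,r)$ there is a self-adjoint qubit operator $Y$ localized on $B(n,r)$ with $YJ=J(X\otimes 1)$. 2. For every $L$ and every causal fermionic evolution $U$ of range $L$ there are a causal qubit evolution $V$ of range $f(L)$, a number $z\in\mathbb C$ with $|z|=1$, and a unit vector $\varphi\in\mathcal F$ with $$VJ=J\,(U\otimes zU^\dagger)\qquad\text{and}\qquad V\,J(\psi\otimes\varphi)=J(U\psi\otimes\varphi)\quad\text{for all }\psi\in\mathcal F .$$ Thus the range of $J$ is a sector invariant under the causal qubit evolution $V$ on which the original fermions evolve by $U$ (and the copy by $U^{-1}$, up to a phase); restricting the copy to $\varphi$ gives an invariant sector on which $V$ acts exactly as $U$ does on $\mathcal F$; and local fermionic observables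 are represented by local qubit observables. -/

import Mathlib

open scoped Matrix Kronecker

noncomputable section

namespace CausalFermions

/-! ### Finite lattices -/

/-- Sites of a finite `d`-dimensional rectangular lattice with side lengths `N i`.
The lexicographic order only fixes a sign convention for the Fock basis below. -/
abbrev Site {d : ℕ} (N : Fin d → ℕ) : Type := Πₗ i, Fin (N i)

/-- Distance between two points on a line with `m` points, with open (`per = false`) or
periodic (`per = true`) boundary conditions. -/
def coordDist {m : ℕ} (per : Bool) (a b : Fin m) : ℕ :=
  if per then min (Nat.dist a b) (m - Nat.dist a b) else Nat.dist a b

/-- The distance `|n - m|` (largest coordinate distance); direction `i` has periodic boundary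
conditions iff `per i = true`. -/
def siteDist {d : ℕ} {N : Fin d → ℕ} (per : Fin d → Bool) (n m : Site N) : ℕ :=
  Finset.univ.sup fun i => coordDist (per i) (ofLex n i) (ofLex m i)

/-- All sites at distance at most `r` from `n`. -/
def siteBall {d : ℕ} {N : Fin d → ℕ} (per : Fin d → Bool) (n : Site N) (r : ℕ) : Set (Site N) :=
  {m | siteDist per n m ≤ r}

/-! ### Fermions -/

/-- Operators on the fermionic Fock space over the modes `M`, in the occupation number basis:
`s : M → Bool` is the basis state in which exactly the modes `j` with `s j = true` are occupied,
i.e. the increasingly ordered product of the creation operators of the occupied modes, applied to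
the empty state. -/
abbrev FockOp (M : Type) : Type := Matrix (M → Bool) (M → Bool) ℂ

/-- The annihilation operator of mode `j`: it maps a state `t` with `t j = false` to zero, and
otherwise empties mode `j`, with the sign given by the parity of the number of occupied modes
below `j`. -/
def ann {M : Type} [Fintype M] [LinearOrder M] (j : M) : FockOp M :=
  fun s t => if t j = true ∧ s = Function.update t j false
    then (-1) ^ (Finset.univ.filter fun i => i < j ∧ t i = true).card else 0

/-- The same operator after one additional mode `⊤` has been added as the last one:
the operator obtained by reading every `ann j` as `ann (j : WithTop M)`. -/
def addMode {M : Type} (U : FockOp M) : FockOp (WithTop M) :=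
  fun s t => if s ⊤ = t ⊤ then U (fun j => s j) (fun j => t j) else 0

/-- An additional fermionic mode is left invariant by `U`:
`U` commutes with its annihilation operator. -/
def LeavesAddedModeInvariant {M : Type} [Fintype M] [LinearOrder M] (U : FockOp M) : Prop :=
  addMode U * ann (⊤ : WithTop M) = ann (⊤ : WithTop M) * addMode U

/-- Fermionic modes on a lattice: `k` modes at each site. -/
abbrev Mode {d : ℕ} (N : Fin d → ℕ) (k : ℕ) : Type := Site N ×ₗ Fin k

/-- Basis of the Fock space of fermions with `k` modes at each lattice site. -/
abbrev FConf {d : ℕ} (N : Fin d → ℕ) (k : ℕ) : Type := Mode N k → Bool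

/-- The creation and annihilation operators on the sites of the region `R`. -/
def ladderOps {d : ℕ} {N : Fin d → ℕ} {k : ℕ} (R : Set (Site N)) : Set (FockOp (Mode N k)) :=
  {x | ∃ n ∈ R, ∃ i : Fin k, x = ann (toLex (n, i)) ∨ x = (ann (toLex (n, i)))ᴴ}

/-- `X` can be written in terms of creation and annihilation operators on sites of `R`. -/
def FermionLocalized {d : ℕ} {N : Fin d → ℕ} {k : ℕ} (R : Set (Site N))
    (X : FockOp (Mode N k)) : Prop :=
  X ∈ Algebra.adjoin ℂ (ladderOps (k := k) R)

/-- `X` is a linear combination of products of even numbers of creation and annihilation operators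
on sites of `R`. -/
def FermionEvenLocalized {d : ℕ} {N : Fin d → ℕ} {k : ℕ} (R : Set (Site N))
    (X : FockOp (Mode N k)) : Prop :=
  X ∈ Algebra.adjoin ℂ
    {z : FockOp (Mode N k) | ∃ x ∈ ladderOps (k := k) R, ∃ y ∈ ladderOps (k := k) R, z = x * y}

/-- A causal fermionic evolution operator with range `L`: a unitary that leaves added modes
invariant and (Heisenberg picture) takes annihilation operators at any site `n` to operators
localized on the sites at distance at most `L` from `n`. -/
structure IsCausalFermionic {d : ℕ} {N : Fin d → ℕ} {k : ℕ} (per : Fin d → Bool) (L : ℕ)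
    (U : FockOp (Mode N k)) : Prop where
  unitary : U ∈ Matrix.unitaryGroup (FConf N k) ℂ
  added : LeavesAddedModeInvariant U
  causal : ∀ (n : Site N) (i : Fin k),
    FermionLocalized (siteBall per n L) (Uᴴ * ann (toLex (n, i)) * U)

/-! ### Qubits -/

/-- Computational basis of a system with `q` qubits at each lattice site. -/
abbrev QConf {d : ℕ} (N : Fin d → ℕ) (q : ℕ) : Type := Site N × Fin q → Bool

/-- Operators on the state space of a system with `q` qubits at each lattice site. -/
abbrev QubitOp {d : ℕ} (N : Fin d → ℕ) (q : ℕ) : Type := Matrix (QConf N q) (QConf N q) ℂ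

open Classical in
/-- `X` acts like the identity on all qubits outside the region `R`, i.e. `X = Y ⊗ 1` with `Y` an
operator on the qubits in `R`. -/
def QubitLocalized {d : ℕ} {N : Fin d → ℕ} {q : ℕ} (R : Set (Site N)) (X : QubitOp N q) : Prop :=
  ∃ Y : Matrix ({p : Site N × Fin q // p.1 ∈ R} → Bool) ({p : Site N × Fin q // p.1 ∈ R} → Bool) ℂ,
    ∀ s t : QConf N q,
      X s t = if ∀ p, p.1 ∉ R → s p = t p then Y (fun p => s p) (fun p => t p) else 0

/-- A causal evolution operator of a lattice of qubits, with range `L`. -/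
structure IsCausalQubit {d : ℕ} {N : Fin d → ℕ} {q : ℕ} (per : Fin d → Bool) (L : ℕ)
    (V : QubitOp N q) : Prop where
  unitary : V ∈ Matrix.unitaryGroup (QConf N q) ℂ
  causal : ∀ (n : Site N) (X : QubitOp N q), QubitLocalized {n} X →
    QubitLocalized (siteBall per n L) (Vᴴ * X * V)

/-- The map `ψ ↦ J (ψ ⊗ φ)`. -/
def sector {A B C : Type} [Fintype C] (J : Matrix A (B × C) ℂ) (φ : C → ℂ) : Matrix A B ℂ :=
  fun s t => ∑ u, J s (t, u) * φ u

end CausalFermions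

end

set_option linter.unusedSectionVars false

noncomputable section

namespace CausalFermions

/-! ### Signed maps between configurations -/

/-! A Jordan–Wigner transformation along the lexicographic order of the sites turns modes into
qubits, but a product of ladder operators on two sites then carries a string of signs through the
sites between them. The cure is one auxiliary mode per site and direction. These are put into a
common `+1` eigenstate `χ` of the couplings `I • (majX b * majY c)`, where `b` and `c` are auxiliary
modes of neighbouring sites `n` and `m`. On the range of `J`, a product `x * y` of ladder operators
on `n` and `m` acts like `x * y * coupling b c`, which up to a scalar is `(x * majX b) * (y * majY
c)`. Each bracket lives on one site, where the two strings cancel because the modes of a site are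
consecutive (`IsEncoding.linked_of_link`). Inserting squares of Majorana operators along a path
links any two sites of a ball within that ball (`IsEncoding.linked_siteBall`), so every even
polynomial on a ball is represented on the same ball.

For the evolution, let `T` exchange the two copies. Since `U` is even, `(Uᴴ ⊗ 1) * T = T * (1 ⊗
Uᴴ)`, hence `U ⊗ Uᴴ = Tᴴ * ((U ⊗ 1)ᴴ * T * (U ⊗ 1))`. Take for `T` the product of the single-mode
exchanges `modeSwap j`. Conjugated with `U ⊗ 1`, each of them becomes `1 - qᴴ * q`, where `q` is the
difference of the evolved annihilation operator and that of the copy. This `q` is odd and lives on a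
ball of radius `L`, so `qᴴ * q` is represented there.

The representative agrees with the exchange only on the range of `J` and need not be unitary. But
half of `qᴴ * q` is a projection with a local Hermitian representative `Y`, and the reflection in
the eigenspace of `Y` for the eigenvalue `1` is a local unitary with the right action on that range
(`exists_reflection`, `exists_modeSwap_gate`).

The gates are arranged in layers of equal colour, so that gates of one layer have disjoint supports.
Each layer enlarges supports by `2 * L`, and the number of colours depends only on `d` and `L`
(`IsLoc.conj_layers`). Finally, an eigenvector `φ` of `U` with eigenvalue `z` is fixed by `z • Uᴴ`,
which gives the sector where the copy stands still. -/

/-- The matrix sending the basis vector `t` to `c t` times the basis vector `f t`. -/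
def sgnMap {α β : Type*} [DecidableEq β] (f : α → β) (c : α → ℂ) : Matrix β α ℂ :=
  fun s t => if s = f t then c t else 0

theorem sgnMap_mul {α β γ : Type*} [DecidableEq β] [DecidableEq γ] [Fintype β]
    (f : β → γ) (c : β → ℂ) (g : α → β) (e : α → ℂ) :
    sgnMap f c * sgnMap g e = sgnMap (fun t => f (g t)) (fun t => c (g t) * e t) := by
  ext s t
  simp only [sgnMap, Matrix.mul_apply, mul_ite, mul_zero, Finset.sum_ite_eq',
    Finset.mem_univ, if_true, ite_mul, zero_mul]

theorem sgnMap_ext {α β : Type*} [DecidableEq β] {f g : α → β} {c e : α → ℂ}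
    (h : ∀ t, c t = e t ∧ (c t ≠ 0 → f t = g t)) : sgnMap f c = sgnMap g e := by
  ext s t
  obtain ⟨h1, h2⟩ := h t
  simp only [sgnMap]
  by_cases hc : c t = 0
  · simp [← h1, hc]
  · rw [h2 hc, h1]

theorem sgnMap_neg {α β : Type*} [DecidableEq β] (f : α → β) (c : α → ℂ) :
    -sgnMap f c = sgnMap f (fun t => -c t) := by
  ext s t
  simp only [sgnMap, Matrix.neg_apply]
  split_ifs <;> simp

theorem sgnMap_add {α β : Type*} [DecidableEq β] (f : α → β) (c e : α → ℂ) :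
    sgnMap f c + sgnMap f e = sgnMap f (fun t => c t + e t) := by
  ext s t
  simp only [sgnMap, Matrix.add_apply]
  split_ifs <;> simp

theorem sgnMap_one {α : Type*} [DecidableEq α] :
    sgnMap (fun t : α => t) (fun _ => 1) = 1 := by
  ext s t
  simp [sgnMap, Matrix.one_apply]

/-! ### Jordan–Wigner form of the ladder operators and the canonical anticommutation relations. -/

section Fock

variable {M : Type} [Fintype M] [LinearOrder M]

/-- The parity of the number of occupied modes below `j`, as a sign. -/
def str (j : M) (t : M → Bool) : ℂ := ∏ i, if i < j ∧ t i = true then (-1 : ℂ) else 1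

theorem str_update (j p : M) (b : Bool) (t : M → Bool) :
    str j (Function.update t p b) = (if p < j ∧ t p ≠ b then -1 else 1) * str j t := by
  have : (if p < j ∧ t p ≠ b then (-1 : ℂ) else 1)
      = ∏ i, if i = p then (if p < j ∧ t p ≠ b then (-1 : ℂ) else 1) else 1 := by
    rw [Finset.prod_ite_eq' Finset.univ p]
    simp
  rw [this, str, str, ← Finset.prod_mul_distrib]
  refine Finset.prod_congr rfl fun i _ => ?_
  by_cases hi : i = p
  · subst hi
    rw [Function.update_self]
    rcases hb : b <;> rcases ht : t i <;> by_cases hj : i < j <;> simp [hj]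
  · simp [hi]

theorem str_mul_self (j : M) (t : M → Bool) : str j t * str j t = 1 := by
  rw [str, ← Finset.prod_mul_distrib]
  refine Finset.prod_eq_one fun i _ => ?_
  split_ifs <;> norm_num

theorem star_str (j : M) (t : M → Bool) : star (str j t) = str j t := by
  rw [str, star_prod]
  refine Finset.prod_congr rfl fun i _ => ?_
  split_ifs <;> simp

theorem ann_eq (j : M) :
    ann j = sgnMap (fun t => Function.update t j false) (fun t => if t j then str j t else 0) := by
  ext s t
  have h : str j t = (-1) ^ (Finset.univ.filter fun i => i < j ∧ t i = true).card := by
    rw [str, Finset.prod_ite]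
    simp
  simp only [ann, sgnMap, h]
  by_cases h1 : t j = true <;> by_cases h2 : s = Function.update t j false <;> simp [h1, h2]

theorem annH_eq (j : M) :
    (ann j)ᴴ =
      sgnMap (fun t => Function.update t j true) (fun t => if t j then 0 else str j t) := by
  rw [ann_eq]
  ext s t
  simp only [Matrix.conjTranspose_apply, sgnMap]
  have key : (t = Function.update s j false ∧ s j = true) ↔
      (s = Function.update t j true ∧ t j = false) := by
    constructor
    · rintro ⟨h1, h2⟩
      refine ⟨?_, by rw [h1]; simp⟩
      rw [h1, Function.update_idem, ← h2, Function.update_eq_self]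
    · rintro ⟨h1, h2⟩
      refine ⟨?_, by rw [h1]; simp⟩
      rw [h1, Function.update_idem, ← h2, Function.update_eq_self]
  by_cases h : t = Function.update s j false ∧ s j = true
  · obtain ⟨h3, h4⟩ := key.1 h
    have hs : str j s = str j t := by
      rw [h3, str_update]
      simp
    rw [if_pos h.1, if_pos h3, h.2, h4, hs]
    simp [star_str]
  · have h' := mt key.2 h
    have e1 : (if t = Function.update s j false then (if s j = true then str j s else 0) else 0)
        = 0 := by
      split_ifs with h1 h2
      · exact absurd ⟨h1, h2⟩ h
      · rfl
      · rfl
    have e2 : (if s = Function.update t j true then (if t j = true then 0 else str j t) else 0)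
        = 0 := by
      split_ifs with h1 h2
      · rfl
      · exact absurd ⟨h1, by simpa using h2⟩ h'
      · rfl
    rw [e1, e2, star_zero]

theorem ann_mul_ann (i j : M) : ann i * ann j = -(ann j * ann i) := by
  rw [ann_eq, ann_eq, sgnMap_mul, sgnMap_mul, sgnMap_neg]
  refine sgnMap_ext fun t => ?_
  rcases lt_trichotomy i j with h | h | h
  · refine ⟨?_, fun _ => Function.update_comm h.ne' _ _ t⟩
    simp only [str_update, Function.update_of_ne h.ne, Function.update_of_ne h.ne', h, h.not_gt]
    cases hi : t i <;> cases hj : t j <;> simp [mul_comm]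
  · subst h
    simp
  · refine ⟨?_, fun _ => Function.update_comm h.ne _ _ t⟩
    simp only [str_update, Function.update_of_ne h.ne, Function.update_of_ne h.ne', h, h.not_gt]
    cases hi : t i <;> cases hj : t j <;> simp [mul_comm]

theorem ann_mul_annH_of_ne {i j : M} (hij : i ≠ j) :
    ann i * (ann j)ᴴ = -((ann j)ᴴ * ann i) := by
  rw [ann_eq, annH_eq, sgnMap_mul, sgnMap_mul, sgnMap_neg]
  refine sgnMap_ext fun t => ?_
  refine ⟨?_, fun _ => Function.update_comm hij.symm _ _ t⟩
  rcases lt_or_gt_of_ne hij with h | h <;>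
  · simp only [str_update, Function.update_of_ne h.ne, Function.update_of_ne h.ne', h, h.not_gt]
    cases hi : t i <;> cases hj : t j <;> simp [mul_comm]

theorem annH_mul_ann_self (j : M) :
    (ann j)ᴴ * ann j = sgnMap (fun t => t) (fun t => if t j then 1 else 0) := by
  rw [annH_eq, ann_eq, sgnMap_mul]
  refine sgnMap_ext fun t => ?_
  cases h : t j
  · simp [h]
  · simp only [Function.update_self, Function.update_idem, str_update, h]
    refine ⟨?_, fun _ => ?_⟩
    · simp [str_mul_self]
    · rw [← h, Function.update_eq_self]

theorem ann_mul_annH_self (j : M) :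
    ann j * (ann j)ᴴ = sgnMap (fun t => t) (fun t => if t j then 0 else 1) := by
  rw [annH_eq, ann_eq, sgnMap_mul]
  refine sgnMap_ext fun t => ?_
  cases h : t j
  · simp only [Function.update_self, Function.update_idem, str_update, h]
    refine ⟨?_, fun _ => ?_⟩
    · simp [str_mul_self]
    · rw [← h, Function.update_eq_self]
  · simp [h]

theorem ann_mul_annH_add (i j : M) :
    ann i * (ann j)ᴴ + (ann j)ᴴ * ann i = if i = j then 1 else 0 := by
  split_ifs with h
  · subst h
    rw [ann_mul_annH_self, annH_mul_ann_self, sgnMap_add, ← sgnMap_one]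
    refine sgnMap_ext fun t => ⟨?_, fun _ => rfl⟩
    cases t i <;> simp
  · rw [ann_mul_annH_of_ne h, neg_add_cancel]

/-- The fermion parity operator. -/
def par (M : Type) [Fintype M] [LinearOrder M] : FockOp M :=
  sgnMap (fun t => t) (fun t => ∏ i, if t i = true then (-1 : ℂ) else 1)

theorem par_sign_update {M : Type} [Fintype M] [DecidableEq M] (t : M → Bool) (p : M) (b : Bool) :
    (∏ i, if Function.update t p b i = true then (-1 : ℂ) else 1)
      = (if t p ≠ b then -1 else 1) * ∏ i, if t i = true then (-1 : ℂ) else 1 := by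
  have : (if t p ≠ b then (-1 : ℂ) else 1)
      = ∏ i, if i = p then (if t p ≠ b then (-1 : ℂ) else 1) else 1 := by
    rw [Finset.prod_ite_eq' Finset.univ p]
    simp
  rw [this, ← Finset.prod_mul_distrib]
  refine Finset.prod_congr rfl fun i _ => ?_
  by_cases hi : i = p
  · subst hi
    rw [Function.update_self]
    rcases b <;> rcases t i <;> simp
  · simp [hi]

theorem par_mul_ann (j : M) : par M * ann j = -(ann j * par M) := by
  rw [ann_eq, par, sgnMap_mul, sgnMap_mul, sgnMap_neg]
  refine sgnMap_ext fun t => ⟨?_, fun _ => rfl⟩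
  rw [par_sign_update]
  cases h : t j <;> simp [mul_comm]

theorem par_sign_mul_self {M : Type} [Fintype M] (t : M → Bool) :
    (∏ i, if t i = true then (-1 : ℂ) else 1) * (∏ i, if t i = true then (-1 : ℂ) else 1) = 1 := by
  rw [← Finset.prod_mul_distrib]
  refine Finset.prod_eq_one fun i _ => ?_
  split_ifs <;> norm_num

theorem par_mul_self : par M * par M = 1 := by
  rw [par, sgnMap_mul, ← sgnMap_one]
  exact sgnMap_ext fun t => ⟨par_sign_mul_self t, fun _ => rfl⟩

theorem par_conjTranspose : (par M)ᴴ = par M := by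
  ext s t
  simp only [par, sgnMap, Matrix.conjTranspose_apply]
  by_cases h : s = t
  · subst h
    simp only [if_true, star_prod]
    refine Finset.prod_congr rfl fun i _ => ?_
    split_ifs <;> simp
  · simp [h, Ne.symm h]

theorem par_mul_annH (j : M) : par M * (ann j)ᴴ = -((ann j)ᴴ * par M) := by
  have h := congrArg Matrix.conjTranspose (par_mul_ann j)
  rw [Matrix.conjTranspose_neg, Matrix.conjTranspose_mul, Matrix.conjTranspose_mul,
    par_conjTranspose] at h
  rw [h, neg_neg]

/-! ### Operators commuting with everything outside a set of modes -/

/-- The sign operator of a single mode. -/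
def zOp {M : Type} [Fintype M] [DecidableEq M] (p : M) : FockOp M :=
  sgnMap (fun t => t) (fun t => if t p then -1 else 1)

/-- The flip of a single mode. -/
def flipOp {M : Type} [Fintype M] [DecidableEq M] (p : M) : FockOp M :=
  sgnMap (fun t => Function.update t p (!t p)) (fun _ => 1)

theorem ann_mul_zOp {j p : M} (h : j ≠ p) : Commute (ann j) (zOp p) := by
  rw [Commute, SemiconjBy, ann_eq, zOp, sgnMap_mul, sgnMap_mul]
  refine sgnMap_ext fun t => ⟨?_, fun _ => rfl⟩
  rw [Function.update_of_ne h.symm, mul_comm]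

theorem ann_mul_flipOp {j p : M} (h : j ≠ p) :
    ann j * flipOp p = (if p < j then -1 else 1 : ℂ) • (flipOp p * ann j) := by
  have hs : ∀ (a : ℂ) (f : (M → Bool) → (M → Bool)) (c : (M → Bool) → ℂ),
      a • sgnMap f c = sgnMap f (fun t => a * c t) := by
    intro a f c
    ext s t
    simp [sgnMap]
  rw [ann_eq, flipOp, sgnMap_mul, sgnMap_mul, hs]
  refine sgnMap_ext fun t => ⟨?_, fun _ => ?_⟩
  · rw [Function.update_of_ne h, str_update]
    cases t j <;> simp
  · rw [Function.update_of_ne h.symm, Function.update_comm h]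

theorem zOp_conjTranspose {M : Type} [Fintype M] [DecidableEq M] (p : M) : (zOp p)ᴴ = zOp p := by
  ext s t
  simp only [zOp, sgnMap, Matrix.conjTranspose_apply]
  by_cases h : s = t
  · subst h
    split_ifs <;> simp
  · simp [h, Ne.symm h]

theorem flipOp_conjTranspose {M : Type} [Fintype M] [DecidableEq M] (p : M) : (flipOp p)ᴴ = flipOp p := by
  ext s t
  simp only [flipOp, sgnMap, Matrix.conjTranspose_apply]
  have : (t = Function.update s p (!s p)) ↔ (s = Function.update t p (!t p)) := by
    constructor <;> rintro h <;> rw [h] <;> simp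
  by_cases h : s = Function.update t p (!t p)
  · rw [if_pos h, if_pos (this.2 h), star_one]
  · rw [if_neg h, if_neg (mt this.1 h), star_zero]

end Fock

/-! ### Locality as a commutation property, and its propagation under conjugation by gates. -/

section Locality

variable {M : Type} [Fintype M] [DecidableEq M] {S : Type}

/-- `X` acts trivially on all modes whose site is outside `R`, expressed by commutation with the
operators that generate all operators on these modes. -/
def IsLoc (site : M → S) (R : Set S) (X : FockOp M) : Prop :=
  ∀ p, site p ∉ R → Commute X (zOp p) ∧ Commute X (flipOp p)

namespace IsLoc

variable {site : M → S} {R R' : Set S} {X Y : FockOp M}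

theorem mono (h : IsLoc site R X) (hR : R ⊆ R') : IsLoc site R' X :=
  fun p hp => h p fun h' => hp (hR h')

theorem mul (h : IsLoc site R X) (h' : IsLoc site R Y) : IsLoc site R (X * Y) :=
  fun p hp => ⟨(h p hp).1.mul_left (h' p hp).1, (h p hp).2.mul_left (h' p hp).2⟩

theorem add (h : IsLoc site R X) (h' : IsLoc site R Y) : IsLoc site R (X + Y) :=
  fun p hp => ⟨(h p hp).1.add_left (h' p hp).1, (h p hp).2.add_left (h' p hp).2⟩

theorem smul (a : ℂ) (h : IsLoc site R X) : IsLoc site R (a • X) :=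
  fun p hp => ⟨(h p hp).1.smul_left a, (h p hp).2.smul_left a⟩

theorem one : IsLoc site R (1 : FockOp M) :=
  fun _ _ => ⟨Commute.one_left _, Commute.one_left _⟩

theorem conjTranspose (h : IsLoc site R X) : IsLoc site R Xᴴ := by
  intro p hp
  obtain ⟨h1, h2⟩ := h p hp
  have h1' := congrArg Matrix.conjTranspose h1.eq
  have h2' := congrArg Matrix.conjTranspose h2.eq
  rw [Matrix.conjTranspose_mul, Matrix.conjTranspose_mul, zOp_conjTranspose] at h1'
  rw [Matrix.conjTranspose_mul, Matrix.conjTranspose_mul, flipOp_conjTranspose] at h2'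
  exact ⟨h1'.symm, h2'.symm⟩

theorem list_prod {l : List (FockOp M)} (h : ∀ x ∈ l, IsLoc site R x) :
    IsLoc site R l.prod := by
  induction l with
  | nil => exact one
  | cons a l ih =>
    rw [List.prod_cons]
    exact (h a (by simp)).mul (ih fun x hx => h x (by simp [hx]))

end IsLoc

theorem commute_zOp_iff {X : FockOp M} {p : M} :
    Commute X (zOp p) ↔ ∀ s t : M → Bool, s p ≠ t p → X s t = 0 := by
  have e1 : ∀ s t, (X * zOp p) s t = X s t * (if t p then -1 else 1) := by
    intro s t
    simp only [Matrix.mul_apply, zOp, sgnMap]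
    rw [Finset.sum_eq_single t] <;> simp +contextual
  have e2 : ∀ s t, (zOp p * X) s t = (if s p then -1 else 1) * X s t := by
    intro s t
    simp only [Matrix.mul_apply, zOp, sgnMap]
    rw [Finset.sum_eq_single s]
    · simp
    · intro b _ hb
      simp [hb.symm]
    · simp
  constructor
  · intro h s t hst
    have := congrFun (congrFun h.eq s) t
    rw [e1, e2] at this
    cases hs : s p <;> cases ht : t p <;> simp [hs, ht] at hst this
    · linear_combination (-1 / 2 : ℂ) * this
    · linear_combination (1 / 2 : ℂ) * this
  · intro h
    ext s t
    rw [e1, e2]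
    by_cases hst : s p = t p
    · rw [hst, mul_comm]
    · rw [h s t hst, zero_mul, mul_zero]

theorem commute_flipOp_iff {X : FockOp M} {p : M} :
    Commute X (flipOp p) ↔ ∀ s t : M → Bool,
      X (Function.update s p (!s p)) (Function.update t p (!t p)) = X s t := by
  have e1 : ∀ s t, (X * flipOp p) s t = X s (Function.update t p (!t p)) := by
    intro s t
    simp only [Matrix.mul_apply, flipOp, sgnMap]
    rw [Finset.sum_eq_single (Function.update t p (!t p))] <;> simp +contextual
  have e2 : ∀ s t, (flipOp p * X) s t = X (Function.update s p (!s p)) t := by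
    intro s t
    simp only [Matrix.mul_apply, flipOp, sgnMap]
    rw [Finset.sum_eq_single (Function.update s p (!s p))]
    · simp
    · intro b _ hb
      rw [if_neg, zero_mul]
      rintro rfl
      simp at hb
    · simp
  constructor
  · intro h s t
    have := congrFun (congrFun h.eq s) (Function.update t p (!t p))
    rw [e1, e2] at this
    rw [← this]
    simp
  · intro h
    ext s t
    rw [e1, e2, ← h s (Function.update t p (!t p))]
    simp

theorem IsLoc.apply_eq_zero {site : M → S} {R : Set S} {X : FockOp M} (h : IsLoc site R X)
    {s t : M → Bool} {p : M} (hp : site p ∉ R) (hst : s p ≠ t p) : X s t = 0 :=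
  commute_zOp_iff.1 (h p hp).1 s t hst

/-- Commutation with `flipOp` lets both arguments be flipped at any modes outside `R`. Flipping
where `s` and `s'` differ carries `(s, t)` to `(s', t')`. -/
theorem IsLoc.apply_eq {site : M → S} {R : Set S} {X : FockOp M} (h : IsLoc site R X)
    {s t s' t' : M → Bool} (h1 : ∀ p, site p ∉ R → s p = t p)
    (h2 : ∀ p, site p ∉ R → s' p = t' p) (h3 : ∀ p, site p ∈ R → s p = s' p)
    (h4 : ∀ p, site p ∈ R → t p = t' p) : X s t = X s' t' := by
  have key : ∀ D : Finset M, (∀ p ∈ D, site p ∉ R) →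
      X (fun p => if p ∈ D then !s p else s p) (fun p => if p ∈ D then !t p else t p)
        = X s t := by
    intro D
    induction D using Finset.induction_on with
    | empty => intro _; simp
    | insert a D ha ih =>
      intro hD
      rw [← ih fun p hp => hD p (Finset.mem_insert_of_mem hp),
        ← commute_flipOp_iff.1 (h a (hD a (Finset.mem_insert_self a D))).2]
      congr 1 <;> funext p <;> by_cases hpa : p = a
      · subst hpa; simp [ha]
      · simp [hpa]
      · subst hpa; simp [ha]
      · simp [hpa]
  rw [← key (Finset.univ.filter fun p => s p ≠ s' p) ?_]
  · congr 1 <;> funext p <;> by_cases hp : site p ∈ R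
    · simp [h3 p hp]
    · cases hs : s p <;> cases hs' : s' p <;> simp [hs, hs']
    · simp [h3 p hp, h4 p hp]
    · have := h1 p hp
      have := h2 p hp
      cases hs : s p <;> cases hs' : s' p <;> simp_all
  · intro p hp hR
    exact (Finset.mem_filter.1 hp).2 (h3 p hR)

/-- Operators acting on disjoint regions commute. -/
theorem IsLoc.commute_of_disjoint {site : M → S} {R R' : Set S} {X W : FockOp M}
    (hX : IsLoc site R X) (hW : IsLoc site R' W) (hd : Disjoint R R') : Commute X W := by
  classical
  ext s t
  have hd' : ∀ {x}, x ∈ R → x ∉ R' := fun hx hx' => Set.disjoint_left.1 hd hx hx'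
  -- Only one intermediate configuration can contribute to each product, because `X` changes modes
  -- in `R` only and `W` modes in `R'` only.
  set u : M → Bool := fun p => if site p ∈ R then t p else s p with hu
  set v : M → Bool := fun p => if site p ∈ R then s p else t p with hv
  have e1 : (X * W) s t = X s u * W u t := by
    rw [Matrix.mul_apply, Finset.sum_eq_single u]
    · intro w _ hw
      by_contra hne
      apply hw
      funext p
      by_cases hp : site p ∈ R
      · simp only [hu, hp, if_true]
        by_contra hc
        exact hne (by rw [hW.apply_eq_zero (hd' hp) hc, mul_zero])
      · simp only [hu, hp, if_false]
        by_contra hc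
        exact hne (by rw [hX.apply_eq_zero hp (Ne.symm hc), zero_mul])
    · simp
  have e2 : (W * X) s t = W s v * X v t := by
    rw [Matrix.mul_apply, Finset.sum_eq_single v]
    · intro w _ hw
      by_contra hne
      apply hw
      funext p
      by_cases hp : site p ∈ R
      · simp only [hv, hp, if_true]
        by_contra hc
        exact hne (by rw [hW.apply_eq_zero (hd' hp) (Ne.symm hc), zero_mul])
      · simp only [hv, hp, if_false]
        by_contra hc
        exact hne (by rw [hX.apply_eq_zero hp hc, mul_zero])
    · simp
  rw [e1, e2, mul_comm]
  by_cases hst : ∀ p, site p ∉ R → site p ∉ R' → s p = t p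
  · congr 1
    · refine hW.apply_eq ?_ ?_ ?_ ?_ <;> intro p hp <;> by_cases hR : site p ∈ R
      · simp [hu, hR]
      · simp [hu, hR, hst p hR hp]
      · simp [hv, hR]
      · simp [hv, hR, hst p hR hp]
      · exact absurd hp (hd' hR)
      · simp [hu, hR]
      · exact absurd hp (hd' hR)
      · simp [hv, hR]
    · refine hX.apply_eq ?_ ?_ ?_ ?_ <;> intro p hp <;> simp [hu, hv, hp]
  · push Not at hst
    obtain ⟨p, hp, hp', hne⟩ := hst
    have h1 : W u t = 0 := hW.apply_eq_zero hp' (by simpa [hu, hp] using hne)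
    have h2 : W s v = 0 := hW.apply_eq_zero hp' (by simpa [hv, hp] using hne)
    rw [h1, h2, zero_mul, zero_mul]

theorem qubitLocalized_iff {d : ℕ} {N : Fin d → ℕ} {q : ℕ} {R : Set (Site N)} {X : QubitOp N q} :
    QubitLocalized R X ↔ IsLoc (M := Site N × Fin q) Prod.fst R X := by
  classical
  constructor
  · rintro ⟨Y, hY⟩ p hp
    refine ⟨commute_zOp_iff.2 fun s t hst => ?_, commute_flipOp_iff.2 fun s t => ?_⟩
    · rw [hY, if_neg]
      exact fun h => hst (h p hp)
    · rw [hY, hY]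
      have hcond : (∀ x : Site N × Fin q, x.1 ∉ R →
          Function.update s p (!s p) x = Function.update t p (!t p) x) ↔
          ∀ x : Site N × Fin q, x.1 ∉ R → s x = t x := by
        refine forall₂_congr fun x _ => ?_
        by_cases hx : x = p
        · subst hx; simp
        · simp [hx]
      have hr : ∀ (w : QConf N q) (x : {x : Site N × Fin q // x.1 ∈ R}),
          Function.update w p (!w p) x.1 = w x.1 := by
        intro w x
        rw [Function.update_of_ne]
        rintro rfl
        exact hp x.2
      simp only [hcond, hr]
  · intro h
    -- The qubits outside `R` are filled with `false`; by `IsLoc.apply_eq` the choice does not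
    -- matter.
    refine ⟨fun s t => X (fun p => if hp : p.1 ∈ R then s ⟨p, hp⟩ else false)
      (fun p => if hp : p.1 ∈ R then t ⟨p, hp⟩ else false), fun s t => ?_⟩
    split_ifs with hst
    · refine h.apply_eq hst ?_ ?_ ?_ <;> intro p hp <;> simp [hp]
    · push Not at hst
      obtain ⟨p, hp, hne⟩ := hst
      exact h.apply_eq_zero hp hne

/-- Conjugation by gates acting on disjoint regions. -/
theorem IsLoc.conj_list_of_disjoint {ι : Type} {site : M → S} (W : ι → FockOp M) (B : ι → Set S)
    (hu : ∀ i, (W i)ᴴ * W i = 1) (hW : ∀ i, IsLoc site (B i) (W i)) {R' : Set S} (l : List ι) :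
    ∀ (T : Set S) (X : FockOp M), l.Pairwise (fun i j => Disjoint (B i) (B j)) → T ⊆ R' →
      (∀ i ∈ l, ¬ Disjoint (B i) T → B i ⊆ R') → IsLoc site T X →
      IsLoc site R' ((l.map W).prodᴴ * X * (l.map W).prod) := by
  induction l with
  | nil =>
    intro T X _ hT _ hX
    simpa using hX.mono hT
  | cons a l ih =>
    intro T X hl hT hB hX
    rw [List.pairwise_cons] at hl
    have e : ((a :: l).map W).prodᴴ * X * ((a :: l).map W).prod
        = (l.map W).prodᴴ * ((W a)ᴴ * X * W a) * (l.map W).prod := by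
      rw [List.map_cons, List.prod_cons, Matrix.conjTranspose_mul]
      simp only [mul_assoc]
    rw [e]
    by_cases hd : Disjoint (B a) T
    · have hc : (W a)ᴴ * X * W a = X := by
        rw [mul_assoc, (hX.commute_of_disjoint (hW a) hd.symm).eq, ← mul_assoc, hu, one_mul]
      rw [hc]
      exact ih T X hl.2 hT (fun i hi => hB i (by simp [hi])) hX
    · have hBa := hB a (by simp) hd
      -- The support grows by `B a`, but the remaining gates are disjoint from `B a`, so any of them
      -- that meets `T ∪ B a` already meets `T`.
      refine ih (T ∪ B a) _ hl.2 (Set.union_subset hT hBa) (fun i hi hdi => ?_) ?_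
      · refine hB i (by simp [hi]) fun h => hdi ?_
        exact Set.disjoint_union_right.2 ⟨h, (hl.1 i hi).symm⟩
      · have h1 := (hW a).mono (Set.subset_union_right (s := T))
        exact (h1.conjTranspose.mul (hX.mono Set.subset_union_left)).mul h1

/-- Conjugation by layers of gates, each layer consisting of the gates of one colour. -/
theorem IsLoc.conj_layers [Fintype S] {κ : Type} [DecidableEq κ] {site : M → S} (dist : S → S → ℕ)
    (hsymm : ∀ n m, dist n m = dist m n) (htri : ∀ n m l, dist n l ≤ dist n m + dist m l)
    (color : S → κ) (L : ℕ) (hcol : ∀ n m, color n = color m → n ≠ m → 2 * L < dist n m)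
    (W : S → FockOp M) (hu : ∀ n, (W n)ᴴ * W n = 1)
    (hW : ∀ n, IsLoc site {m | dist n m ≤ L} (W n)) (n : S) (cs : List κ) :
    ∀ (r : ℕ) (X : FockOp M), IsLoc site {m | dist n m ≤ r} X →
      IsLoc site {m | dist n m ≤ r + 2 * L * cs.length}
        (((cs.flatMap fun c => (Finset.univ.filter (color · = c)).toList).map W).prodᴴ * X *
          ((cs.flatMap fun c => (Finset.univ.filter (color · = c)).toList).map W).prod) := by
  induction cs with
  | nil =>
    intro r X hX
    simpa using hX
  | cons c cs ih =>
    intro r X hX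
    rw [List.flatMap_cons, List.map_append, List.prod_append, Matrix.conjTranspose_mul]
    -- Within one layer the supports are disjoint, since centres of equal colour are more than `2 *
    -- L` apart. A gate that meets the ball of radius `r` has diameter at most `2 * L`.
    have h1 : IsLoc site {m | dist n m ≤ r + 2 * L}
        (((Finset.univ.filter (color · = c)).toList.map W).prodᴴ * X *
          ((Finset.univ.filter (color · = c)).toList.map W).prod) := by
      refine IsLoc.conj_list_of_disjoint W _ hu hW _ _ X ?_ ?_ ?_ hX
      · refine (Finset.nodup_toList _).imp_of_mem fun {a b} ha hb hab => ?_
        rw [Finset.mem_toList, Finset.mem_filter] at ha hb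
        rw [Set.disjoint_left]
        intro x hx hx'
        have h1 := hcol a b (ha.2.trans hb.2.symm) hab
        have h2 := htri a x b
        have h3 := hsymm x b
        simp only [Set.mem_ofPred_eq] at hx hx'
        omega
      · intro m hm
        simp only [Set.mem_ofPred_eq] at hm ⊢
        omega
      · intro a _ ha m hm
        rw [Set.not_disjoint_iff] at ha
        obtain ⟨x, hx, hx'⟩ := ha
        have h2 := htri n x m
        have h3 := htri x a m
        have h4 := hsymm x a
        simp only [Set.mem_ofPred_eq] at hx hx' hm ⊢
        omega
    have h2 := ih _ _ h1
    refine IsLoc.mono (R := {m | dist n m ≤ r + 2 * L + 2 * L * cs.length}) ?_ ?_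
    · simpa only [mul_assoc] using h2
    · intro m hm
      simp only [Set.mem_ofPred_eq, List.length_cons] at hm ⊢
      linarith

end Locality

/-! ### Pairs of ladder operators on one site. -/

section LadderPairs

variable {M : Type} [Fintype M] [LinearOrder M] {S : Type}

/-- `x` is the annihilation or the creation operator of mode `j`. -/
def IsLadder (j : M) (x : FockOp M) : Prop := x = ann j ∨ x = (ann j)ᴴ

theorem IsLadder.conjTranspose {j : M} {x : FockOp M} (h : IsLadder j x) : IsLadder j xᴴ := by
  rcases h with rfl | rfl
  · exact Or.inr rfl
  · exact Or.inl (Matrix.conjTranspose_conjTranspose _)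

theorem IsLadder.commute_zOp {j p : M} {x : FockOp M} (h : IsLadder j x) (hp : j ≠ p) :
    Commute x (zOp p) := by
  rcases h with rfl | rfl
  · exact ann_mul_zOp hp
  · have := congrArg Matrix.conjTranspose (ann_mul_zOp hp).eq
    rw [Matrix.conjTranspose_mul, Matrix.conjTranspose_mul, zOp_conjTranspose] at this
    exact this.symm

theorem IsLadder.mul_flipOp {j p : M} {x : FockOp M} (h : IsLadder j x) (hp : j ≠ p) :
    x * flipOp p = (if p < j then -1 else 1 : ℂ) • (flipOp p * x) := by
  rcases h with rfl | rfl
  · exact ann_mul_flipOp hp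
  · have := congrArg Matrix.conjTranspose (ann_mul_flipOp hp)
    rw [Matrix.conjTranspose_smul, Matrix.conjTranspose_mul, Matrix.conjTranspose_mul,
      flipOp_conjTranspose] at this
    rw [this, smul_smul]
    split_ifs <;> simp

/-- A flip of an outside mode `p` produces one sign from the string of each factor. The order
hypothesis places `p` on the same side of `i` and `j`, so the signs cancel. -/
theorem IsLadder.isLoc_mul {site : M → S}
    (hord : ∀ p i j, site i = site j → site p ≠ site i → (p < i ↔ p < j))
    {i j : M} {x y : FockOp M} (hx : IsLadder i x) (hy : IsLadder j y) (hij : site i = site j) :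
    IsLoc site {site i} (x * y) := by
  intro p hp
  have hi : i ≠ p := by rintro rfl; simp at hp
  have hj : j ≠ p := by rintro rfl; simp [hij] at hp
  refine ⟨(hx.commute_zOp hi).mul_left (hy.commute_zOp hj), ?_⟩
  have hiff := hord p i j hij (by simpa using hp)
  rw [Commute, SemiconjBy, mul_assoc, hy.mul_flipOp hj, Matrix.mul_smul, ← mul_assoc,
    hx.mul_flipOp hi, Matrix.smul_mul, smul_smul, mul_assoc]
  by_cases h : p < i
  · simp [h, hiff.1 h]
  · simp [h, mt hiff.2 h]

end LadderPairs

/-! ### Change of the Jordan–Wigner order. -/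

section Reorder

variable {M M' : Type} [Fintype M] [LinearOrder M] [Fintype M'] [LinearOrder M']

/-- The sign of the permutation that brings the occupied modes of `t` from the order of `M` into
the order of `M'`. -/
def reorderSign (e : M ≃ M') (t : M → Bool) : ℂ :=
  ∏ i, ∏ j, if (i < j ∧ e j < e i) ∧ t i = true ∧ t j = true then (-1 : ℂ) else 1

theorem reorderSign_mul_self (e : M ≃ M') (t : M → Bool) :
    reorderSign e t * reorderSign e t = 1 := by
  simp only [reorderSign, ← Finset.prod_mul_distrib]
  refine Finset.prod_eq_one fun i _ => Finset.prod_eq_one fun j _ => ?_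
  split_ifs <;> norm_num

theorem star_reorderSign (e : M ≃ M') (t : M → Bool) :
    star (reorderSign e t) = reorderSign e t := by
  simp only [reorderSign, star_prod]
  refine Finset.prod_congr rfl fun i _ => Finset.prod_congr rfl fun j _ => ?_
  split_ifs <;> simp

/-- Emptying `j` removes exactly the inversions involving `j`. In the product of the two strings,
occupied modes below `j` in both orders cancel, and those below it in only one order are these
inversions. -/
theorem reorderSign_of_true (e : M ≃ M') (t : M → Bool) (j : M) (hj : t j = true) :
    reorderSign e t = reorderSign e (Function.update t j false) *
      (str j t * str (e j) (fun i => t (e.symm i))) := by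
  have h1 : str (e j) (fun i => t (e.symm i))
      = ∏ i, if e i < e j ∧ t i = true then (-1 : ℂ) else 1 := by
    rw [str, ← Equiv.prod_comp e]
    simp
  have h2 : str j t * str (e j) (fun i => t (e.symm i)) =
      (∏ i, if (i < j ∧ e j < e i) ∧ t i = true then (-1 : ℂ) else 1) *
        ∏ i, if (j < i ∧ e i < e j) ∧ t i = true then (-1 : ℂ) else 1 := by
    rw [h1, str, ← Finset.prod_mul_distrib, ← Finset.prod_mul_distrib]
    refine Finset.prod_congr rfl fun i _ => ?_
    rcases lt_trichotomy i j with h | h | h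
    · rcases lt_or_gt_of_ne (e.injective.ne h.ne) with h' | h' <;>
        cases t i <;> simp [h, h', h.not_gt, h'.not_gt]
    · subst h
      simp
    · rcases lt_or_gt_of_ne (e.injective.ne h.ne) with h' | h' <;>
        cases t i <;> simp [h, h', h.not_gt, h'.not_gt]
  have h3 : ∀ f : M → ℂ, ∏ i, f i = ∏ i, ∏ k, if k = j then f i else 1 := by
    intro f
    refine Finset.prod_congr rfl fun i _ => ?_
    rw [Finset.prod_ite_eq' Finset.univ j]
    simp
  have h4 : ∀ f : M → ℂ, ∏ i, f i = ∏ i, ∏ k, if i = j then f k else 1 := by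
    intro f
    rw [Finset.prod_comm]
    exact h3 f
  rw [h2, reorderSign, reorderSign,
    h3 fun i => if (i < j ∧ e j < e i) ∧ t i = true then (-1 : ℂ) else 1,
    h4 fun i => if (j < i ∧ e i < e j) ∧ t i = true then (-1 : ℂ) else 1]
  simp only [← Finset.prod_mul_distrib]
  refine Finset.prod_congr rfl fun i _ => Finset.prod_congr rfl fun k _ => ?_
  by_cases hi : i = j <;> by_cases hk : k = j
  · subst hi hk
    simp
  · subst hi
    simp [hk, hj]
  · subst hk
    simp [hi, hj]
  · simp [hi, hk]

/-- The unitary that identifies the Fock spaces over two orderings of the same modes. -/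
def reorder (e : M ≃ M') : Matrix (M' → Bool) (M → Bool) ℂ :=
  sgnMap (fun t i => t (e.symm i)) (reorderSign e)

theorem reorder_mul_ann (e : M ≃ M') (j : M) :
    reorder e * ann j = ann (e j) * reorder e := by
  rw [ann_eq, ann_eq, reorder, sgnMap_mul, sgnMap_mul]
  refine sgnMap_ext fun t => ⟨?_, fun _ => ?_⟩
  · cases h : t j
    · simp [h]
    · simp only [if_true, Equiv.symm_apply_apply, h]
      rw [reorderSign_of_true e t j h]
      linear_combination (reorderSign e (Function.update t j false)) * str j t *
        -str_mul_self (e j) (fun i => t (e.symm i))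
  · funext i
    by_cases h : i = e j
    · subst h; simp
    · rw [Function.update_of_ne h, Function.update_of_ne]
      rintro h'
      exact h (by rw [← h', Equiv.apply_symm_apply])

theorem reorder_conjTranspose (e : M ≃ M') :
    (reorder e)ᴴ = sgnMap (fun t i => t (e i)) (fun t => reorderSign e (fun i => t (e i))) := by
  ext s t
  simp only [reorder, sgnMap, Matrix.conjTranspose_apply]
  have : (t = fun i => s (e.symm i)) ↔ s = fun i => t (e i) := by
    constructor <;> rintro rfl <;> simp
  by_cases h : s = fun i => t (e i)
  · rw [if_pos h, if_pos (this.2 h), star_reorderSign, h]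
  · rw [if_neg h, if_neg (mt this.1 h), star_zero]

theorem reorder_conjTranspose_mul (e : M ≃ M') : (reorder e)ᴴ * reorder e = 1 := by
  rw [reorder_conjTranspose, reorder, sgnMap_mul, ← sgnMap_one]
  refine sgnMap_ext fun t => ⟨?_, fun _ => ?_⟩
  · simp [reorderSign_mul_self]
  · simp

theorem reorder_mul_conjTranspose (e : M ≃ M') : reorder e * (reorder e)ᴴ = 1 := by
  rw [reorder_conjTranspose, reorder, sgnMap_mul, ← sgnMap_one]
  refine sgnMap_ext fun t => ⟨?_, fun _ => ?_⟩
  · simp [reorderSign_mul_self]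
  · simp

theorem reorder_mul_annH (e : M ≃ M') (j : M) :
    reorder e * (ann j)ᴴ = (ann (e j))ᴴ * reorder e := by
  have h := congrArg Matrix.conjTranspose (reorder_mul_ann e j)
  rw [Matrix.conjTranspose_mul, Matrix.conjTranspose_mul] at h
  calc reorder e * (ann j)ᴴ = reorder e * ((ann j)ᴴ * (reorder e)ᴴ) * reorder e := by
        rw [Matrix.mul_assoc, Matrix.mul_assoc, reorder_conjTranspose_mul, Matrix.mul_one]
    _ = reorder e * ((reorder e)ᴴ * (ann (e j))ᴴ) * reorder e := by rw [h]
    _ = _ := by rw [← Matrix.mul_assoc, reorder_mul_conjTranspose, Matrix.one_mul]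

end Reorder

/-! ### Fock space over a disjoint union as a tensor product. -/

section Sum

variable {A B : Type} [Fintype A] [LinearOrder A] [Fintype B] [LinearOrder B]

/-- Configurations of `A ⊕ₗ B` as pairs of configurations. -/
def sumConf : (A ⊕ₗ B → Bool) ≃ (A → Bool) × (B → Bool) :=
  (Equiv.arrowCongr (ofLex (α := A ⊕ B)) (Equiv.refl Bool)).trans (Equiv.sumArrowEquivProdArrow A B Bool)

theorem sumConf_fst (w : A ⊕ₗ B → Bool) : (sumConf w).1 = fun a => w (Sum.inlₗ a) := rfl
theorem sumConf_snd (w : A ⊕ₗ B → Bool) : (sumConf w).2 = fun b => w (Sum.inrₗ b) := rfl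

theorem sumConf_update_inl {_ : DecidableEq (A ⊕ₗ B)} (w : A ⊕ₗ B → Bool) (a : A) (x : Bool) :
    sumConf (Function.update w (Sum.inlₗ a) x)
      = (Function.update (sumConf w).1 a x, (sumConf w).2) := by
  ext i
  · by_cases h : i = a
    · subst h; simp [sumConf_fst]
    · simp [sumConf_fst, h]
  · simp [sumConf_snd]

theorem sumConf_update_inr {_ : DecidableEq (A ⊕ₗ B)} (w : A ⊕ₗ B → Bool) (b : B) (x : Bool) :
    sumConf (Function.update w (Sum.inrₗ b) x)
      = ((sumConf w).1, Function.update (sumConf w).2 b x) := by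
  ext i
  · simp [sumConf_fst]
  · by_cases h : i = b
    · subst h; simp [sumConf_snd]
    · simp [sumConf_snd, h]

theorem eq_update_inl_iff {_ : DecidableEq (A ⊕ₗ B)} (s t : A ⊕ₗ B → Bool) (a : A) :
    s = Function.update t (Sum.inlₗ a) false ↔
      (sumConf s).1 = Function.update (sumConf t).1 a false ∧ (sumConf s).2 = (sumConf t).2 := by
  rw [← sumConf.apply_eq_iff_eq, sumConf_update_inl, Prod.ext_iff]

theorem eq_update_inr_iff {_ : DecidableEq (A ⊕ₗ B)} (s t : A ⊕ₗ B → Bool) (b : B) :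
    s = Function.update t (Sum.inrₗ b) false ↔
      (sumConf s).1 = (sumConf t).1 ∧ (sumConf s).2 = Function.update (sumConf t).2 b false := by
  rw [← sumConf.apply_eq_iff_eq, sumConf_update_inr, Prod.ext_iff]

theorem str_inl (w : A ⊕ₗ B → Bool) (a : A) : str (Sum.inlₗ a) w = str a (sumConf w).1 := by
  rw [str, ← Equiv.prod_comp (toLex (α := A ⊕ B)), Fintype.prod_sum_type]
  simp [str, sumConf_fst, Sum.inlₗ]
  congr!

theorem str_inr (w : A ⊕ₗ B → Bool) (b : B) : str (Sum.inrₗ b) w =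
    (∏ i, if (sumConf w).1 i = true then (-1 : ℂ) else 1) * str b (sumConf w).2 := by
  rw [str, ← Equiv.prod_comp (toLex (α := A ⊕ B)), Fintype.prod_sum_type]
  simp [str, sumConf_fst, sumConf_snd, Sum.inlₗ, Sum.inrₗ]
  congr!

theorem ann_inl_apply (s t : A ⊕ₗ B → Bool) (a : A) : ann (Sum.inlₗ a) s t =
    (ann a ⊗ₖ (1 : FockOp B)) (sumConf s) (sumConf t) := by
  have ha : t (Sum.inlₗ a) = (sumConf t).1 a := rfl
  rw [Matrix.kroneckerMap_apply, ann_eq, ann_eq]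
  simp only [sgnMap, Matrix.one_apply, str_inl, ha]
  simp only [eq_update_inl_iff]
  by_cases h1 : (sumConf s).1 = Function.update (sumConf t).1 a false <;>
    by_cases h2 : (sumConf s).2 = (sumConf t).2 <;> simp [h1, h2]

/-- All modes of the first block precede those of the second, so the string of a mode in the second
block contains the full parity `par A`. -/
theorem ann_inr_apply (s t : A ⊕ₗ B → Bool) (b : B) : ann (Sum.inrₗ b) s t =
    (par A ⊗ₖ ann b) (sumConf s) (sumConf t) := by
  have hb : t (Sum.inrₗ b) = (sumConf t).2 b := rfl
  rw [Matrix.kroneckerMap_apply, ann_eq, ann_eq, par]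
  simp only [sgnMap, str_inr, hb]
  simp only [eq_update_inr_iff]
  by_cases h1 : (sumConf s).1 = (sumConf t).1 <;>
    by_cases h2 : (sumConf s).2 = Function.update (sumConf t).2 b false <;> simp [h1, h2]

/-- The identification of the tensor product of two Fock spaces with the Fock space over both sets
of modes. -/
def sumIso (A B : Type) [Fintype A] [LinearOrder A] [Fintype B] [LinearOrder B] :
    Matrix (A ⊕ₗ B → Bool) ((A → Bool) × (B → Bool)) ℂ :=
  fun w st => if sumConf w = st then 1 else 0

theorem sumIso_mul_apply {γ : Type*} (X : Matrix ((A → Bool) × (B → Bool)) γ ℂ) (w : A ⊕ₗ B → Bool)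
    (t : γ) : (sumIso A B * X) w t = X (sumConf w) t := by
  simp [Matrix.mul_apply, sumIso]

theorem mul_sumIso_apply {γ : Type*} (X : Matrix γ (A ⊕ₗ B → Bool) ℂ) (s : γ)
    (t : (A → Bool) × (B → Bool)) : (X * sumIso A B) s t = X s (sumConf.symm t) := by
  rw [Matrix.mul_apply, Finset.sum_eq_single (sumConf.symm t)]
  · simp [sumIso]
  · intro b _ hb
    rw [sumIso, if_neg, mul_zero]
    rintro rfl
    simp at hb
  · simp

theorem sumIso_conjTranspose_mul : (sumIso A B)ᴴ * sumIso A B = 1 := by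
  ext s t
  rw [mul_sumIso_apply, Matrix.conjTranspose_apply, sumIso, Matrix.one_apply]
  simp only [Equiv.apply_symm_apply, eq_comm]
  split_ifs <;> simp

theorem sumIso_mul_conjTranspose : sumIso A B * (sumIso A B)ᴴ = 1 := by
  ext s t
  rw [sumIso_mul_apply, Matrix.conjTranspose_apply, sumIso, Matrix.one_apply]
  simp only [sumConf.apply_eq_iff_eq, eq_comm]
  split_ifs <;> simp

theorem ann_inl_mul_sumIso (a : A) : ann (Sum.inlₗ a : A ⊕ₗ B) * sumIso A B =
    sumIso A B * (ann a ⊗ₖ (1 : FockOp B)) := by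
  ext s t
  rw [mul_sumIso_apply, sumIso_mul_apply, ann_inl_apply, Equiv.apply_symm_apply]

theorem ann_inr_mul_sumIso (b : B) : ann (Sum.inrₗ b : A ⊕ₗ B) * sumIso A B =
    sumIso A B * (par A ⊗ₖ ann b) := by
  ext s t
  rw [mul_sumIso_apply, sumIso_mul_apply, ann_inr_apply, Equiv.apply_symm_apply]

end Sum

/-! ### Majorana operators, couplings and their common eigenstate. -/

section Majorana

variable {M : Type} [Fintype M] [LinearOrder M]

theorem eq_zero_of_eq_neg {m n : Type*} {x : Matrix m n ℂ} (h : x = -x) : x = 0 := by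
  ext i j
  have := congrFun (congrFun h i) j
  exact self_eq_neg.1 this

theorem annH_mul_annH (i j : M) : (ann i)ᴴ * (ann j)ᴴ = -((ann j)ᴴ * (ann i)ᴴ) := by
  rw [← Matrix.conjTranspose_mul, ann_mul_ann, Matrix.conjTranspose_neg, Matrix.conjTranspose_mul]

theorem IsLadder.anticomm {i j : M} (hij : i ≠ j) {x y : FockOp M} (hx : IsLadder i x)
    (hy : IsLadder j y) : x * y = -(y * x) := by
  rcases hx with rfl | rfl <;> rcases hy with rfl | rfl
  · exact ann_mul_ann i j
  · exact ann_mul_annH_of_ne hij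
  · rw [ann_mul_annH_of_ne hij.symm, neg_neg]
  · exact annH_mul_annH i j

/-- The first self-adjoint Majorana operator of a mode. -/
def majX (j : M) : FockOp M := ann j + (ann j)ᴴ

/-- The second self-adjoint Majorana operator of a mode. -/
def majY (j : M) : FockOp M := Complex.I • ((ann j)ᴴ - ann j)

theorem majX_conjTranspose (j : M) : (majX j)ᴴ = majX j := by
  rw [majX, Matrix.conjTranspose_add, Matrix.conjTranspose_conjTranspose, add_comm]

theorem majY_conjTranspose (j : M) : (majY j)ᴴ = majY j := by
  rw [majY, Matrix.conjTranspose_smul, Matrix.conjTranspose_sub,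
    Matrix.conjTranspose_conjTranspose]
  simp only [Complex.star_def, Complex.conj_I]
  module

theorem IsLadder.majX_anticomm {i j : M} (hij : i ≠ j) {x : FockOp M} (hx : IsLadder i x) :
    x * majX j = -(majX j * x) := by
  rw [majX, mul_add, add_mul, hx.anticomm hij (Or.inl rfl), hx.anticomm hij (Or.inr rfl), neg_add]

theorem IsLadder.majY_anticomm {i j : M} (hij : i ≠ j) {x : FockOp M} (hx : IsLadder i x) :
    x * majY j = -(majY j * x) := by
  rw [majY, Matrix.mul_smul, mul_sub, Matrix.smul_mul, sub_mul, hx.anticomm hij (Or.inl rfl),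
    hx.anticomm hij (Or.inr rfl), ← smul_neg]
  congr 1
  abel

theorem majX_mul_self (j : M) : majX j * majX j = 1 := by
  have h1 := ann_mul_annH_add j j
  rw [if_pos rfl] at h1
  have h2 := eq_zero_of_eq_neg (ann_mul_ann j j)
  have h3 := eq_zero_of_eq_neg (annH_mul_annH j j)
  rw [majX, mul_add, add_mul, add_mul, h2, h3, zero_add, add_zero, add_comm, h1]

theorem majY_mul_self (j : M) : majY j * majY j = 1 := by
  have h1 := ann_mul_annH_add j j
  rw [if_pos rfl] at h1
  have h2 := eq_zero_of_eq_neg (ann_mul_ann j j)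
  have h3 := eq_zero_of_eq_neg (annH_mul_annH j j)
  rw [majY, Matrix.mul_smul, Matrix.smul_mul, smul_smul, Complex.I_mul_I, mul_sub, sub_mul, sub_mul,
    h2, h3, ← h1]
  module

theorem majX_mul_majX {i j : M} (hij : i ≠ j) : majX i * majX j = -(majX j * majX i) := by
  conv_lhs => rw [majX]
  conv_rhs => rw [majX.eq_1 i]
  rw [add_mul, mul_add, IsLadder.majX_anticomm hij (Or.inl rfl),
    IsLadder.majX_anticomm hij (Or.inr rfl), neg_add]

theorem majY_mul_majY {i j : M} (hij : i ≠ j) : majY i * majY j = -(majY j * majY i) := by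
  conv_lhs => rw [majY]
  conv_rhs => rw [majY.eq_1 i]
  rw [Matrix.smul_mul, Matrix.mul_smul, sub_mul, mul_sub, IsLadder.majY_anticomm hij (Or.inl rfl),
    IsLadder.majY_anticomm hij (Or.inr rfl), ← smul_neg]
  congr 1
  abel

/-- Including `i = j` means that a mode may be coupled to itself, as happens in a direction with a
single site. -/
theorem majX_mul_majY (i j : M) : majX i * majY j = -(majY j * majX i) := by
  by_cases hij : i = j
  · subst hij
    have h2 := eq_zero_of_eq_neg (ann_mul_ann i i)
    have h3 := eq_zero_of_eq_neg (annH_mul_annH i i)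
    rw [majX, majY, Matrix.smul_mul, Matrix.mul_smul, ← smul_neg]
    congr 1
    rw [add_mul, mul_sub, mul_sub, sub_mul, mul_add, mul_add, h2, h3]
    abel
  · conv_lhs => rw [majX]
    conv_rhs => rw [majX.eq_1 i]
    rw [add_mul, mul_add, IsLadder.majY_anticomm hij (Or.inl rfl),
      IsLadder.majY_anticomm hij (Or.inr rfl), neg_add]

theorem commute_of_anticomm {R : Type*} [Ring R] {x y u : R} (h1 : x * u = -(u * x))
    (h2 : y * u = -(u * y)) : Commute (x * y) u := by
  rw [Commute, SemiconjBy, mul_assoc, h2, mul_neg, ← mul_assoc, h1, neg_mul, neg_neg, mul_assoc]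

/-- The coupling between two modes whose `+1` eigenstates are used for the encoding. -/
def coupling (b c : M) : FockOp M := Complex.I • (majX b * majY c)

theorem coupling_mul_self (b c : M) : coupling b c * coupling b c = 1 := by
  rw [coupling, Matrix.mul_smul, Matrix.smul_mul, smul_smul, Complex.I_mul_I]
  have : majX b * majY c * (majX b * majY c) = -1 := by
    calc majX b * majY c * (majX b * majY c) = majX b * (majY c * majX b) * majY c := by
          simp only [mul_assoc]
      _ = majX b * -(majX b * majY c) * majY c := by rw [majX_mul_majY b c, neg_neg]
      _ = -((majX b * majX b) * (majY c * majY c)) := by simp only [mul_assoc, mul_neg, neg_mul]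
      _ = -1 := by rw [majX_mul_self, majY_mul_self, mul_one]
  rw [this]
  simp

theorem majX_coupling_anticomm (b c : M) : majX b * coupling b c = -(coupling b c * majX b) := by
  rw [coupling, Matrix.mul_smul, Matrix.smul_mul, ← smul_neg]
  congr 1
  rw [mul_assoc (majX b) (majY c), ← mul_neg, ← majX_mul_majY]

theorem majX_commute_coupling {a b : M} (h : a ≠ b) (c : M) : Commute (majX a) (coupling b c) := by
  refine Commute.smul_right (commute_of_anticomm ?_ ?_).symm _
  · exact majX_mul_majX h.symm
  · rw [majX_mul_majY, neg_neg]

theorem majY_commute_coupling {a c : M} (h : a ≠ c) (b : M) : Commute (majY a) (coupling b c) := by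
  refine Commute.smul_right (commute_of_anticomm ?_ ?_).symm _
  · exact majX_mul_majY b a
  · exact majY_mul_majY h.symm

theorem coupling_commute {b c b' c' : M} (hb : b ≠ b') (hc : c ≠ c') :
    Commute (coupling b c) (coupling b' c') :=
  ((majX_commute_coupling hb c').mul_left (majY_commute_coupling hc b')).smul_left _

theorem exists_smul_unit {n : Type} [Fintype n] {v : n → ℂ} (hv : v ≠ 0) :
    ∃ c : ℂ, c ≠ 0 ∧ ∑ i, ‖(c • v) i‖ ^ 2 = 1 := by
  have hpos : 0 < ∑ i, ‖v i‖ ^ 2 := by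
    obtain ⟨i, hi⟩ := Function.ne_iff.1 hv
    refine Finset.sum_pos' (fun _ _ => by positivity) ⟨i, Finset.mem_univ i, ?_⟩
    have := norm_pos_iff.2 hi
    positivity
  have hs := Real.sqrt_pos.2 hpos
  refine ⟨(Real.sqrt (∑ i, ‖v i‖ ^ 2) : ℂ)⁻¹, inv_ne_zero (Complex.ofReal_ne_zero.2 hs.ne'), ?_⟩
  simp only [Pi.smul_apply, smul_eq_mul, norm_mul, mul_pow, ← Finset.mul_sum]
  rw [norm_inv, Complex.norm_real, Real.norm_of_nonneg (Real.sqrt_nonneg _), inv_pow,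
    Real.sq_sqrt hpos.le, inv_mul_cancel₀ hpos.ne']

/-- The constraints are imposed one at a time. The vector `v + P a v` satisfies the new one and
keeps the old ones; if it vanishes, then `P a v = -v`, and `G a v` works instead, because `G a`
reverses the sign of `P a` alone and is invertible. -/
theorem exists_stabilized {n ι : Type} [Fintype n] [DecidableEq n] [Nonempty n] [Fintype ι]
    (P G : ι → Matrix n n ℂ) (hP : ∀ x, P x * P x = 1) (hPP : ∀ x y, Commute (P x) (P y))
    (hG : ∀ x, G x * G x = 1) (hGP : ∀ x, G x * P x = -(P x * G x))
    (hGP' : ∀ x y, x ≠ y → Commute (G x) (P y)) :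
    ∃ v : n → ℂ, ∑ i, ‖v i‖ ^ 2 = 1 ∧ ∀ x, (P x).mulVec v = v := by
  classical
  have key : ∀ s : Finset ι, ∃ v : n → ℂ, v ≠ 0 ∧ ∀ x ∈ s, (P x).mulVec v = v := by
    intro s
    induction s using Finset.induction_on with
    | empty => exact ⟨fun _ => 1, fun h => one_ne_zero (congrFun h (Classical.arbitrary n)), by simp⟩
    | insert a s ha ih =>
      obtain ⟨v, hv0, hv⟩ := ih
      by_cases h : v + (P a).mulVec v = 0
      · refine ⟨(G a).mulVec v, fun h0 => hv0 ?_, fun x hx => ?_⟩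
        · have := congrArg (G a).mulVec h0
          rwa [Matrix.mulVec_mulVec, hG, Matrix.one_mulVec, Matrix.mulVec_zero] at this
        · rcases Finset.mem_insert.1 hx with rfl | hx
          · have h1 : (P x).mulVec v = -v := eq_neg_of_add_eq_zero_right h
            have h2 : P x * G x = -(G x * P x) := by rw [hGP, neg_neg]
            rw [Matrix.mulVec_mulVec, h2, Matrix.neg_mulVec, ← Matrix.mulVec_mulVec, h1,
              Matrix.mulVec_neg, neg_neg]
          · have hne : a ≠ x := by rintro rfl; exact ha hx
            rw [Matrix.mulVec_mulVec, ← (hGP' a x hne).eq, ← Matrix.mulVec_mulVec, hv x hx]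
      · refine ⟨_, h, fun x hx => ?_⟩
        rcases Finset.mem_insert.1 hx with rfl | hx
        · rw [Matrix.mulVec_add, Matrix.mulVec_mulVec, hP, Matrix.one_mulVec, add_comm]
        · rw [Matrix.mulVec_add, Matrix.mulVec_mulVec, (hPP x a).eq, ← Matrix.mulVec_mulVec, hv x hx]
  obtain ⟨v, hv0, hv⟩ := key Finset.univ
  obtain ⟨c, -, hc⟩ := exists_smul_unit hv0
  exact ⟨c • v, hc, fun x => by rw [Matrix.mulVec_smul, hv x (Finset.mem_univ x)]⟩

/-- As `τ` is a bijection, every mode enters one coupling through `majX` and one through `majY`.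
Hence the couplings commute, and `majX b` anticommutes with the coupling of `b` only. -/
theorem exists_coupled (τ : M ≃ M) :
    ∃ χ : (M → Bool) → ℂ, ∑ i, ‖χ i‖ ^ 2 = 1 ∧ ∀ b, (coupling b (τ b)).mulVec χ = χ := by
  refine exists_stabilized (fun b => coupling b (τ b)) majX (fun b => coupling_mul_self _ _)
    (fun b c => ?_) majX_mul_self (fun b => majX_coupling_anticomm _ _)
    (fun b c h => majX_commute_coupling h _)
  by_cases h : b = c
  · subst h; exact Commute.refl _
  · exact coupling_commute h (τ.injective.ne h)

end Majorana

/-! ### Embedding of the physical modes among the auxiliary ones. -/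

section Encoding

variable {A B M : Type} [Fintype A] [LinearOrder A] [Fintype B] [LinearOrder B]
  [Fintype M] [LinearOrder M]

/-- The map `ψ ↦ ψ ⊗ χ`. -/
def kronCol (α : Type*) {β : Type*} [DecidableEq α] (χ : β → ℂ) : Matrix (α × β) α ℂ :=
  fun st a => if st.1 = a then χ st.2 else 0

theorem kronecker_mul_kronCol {α β : Type*} [Fintype α] [Fintype β] [DecidableEq α]
    (X : Matrix α α ℂ) (Y : Matrix β β ℂ) (χ : β → ℂ) :
    (X ⊗ₖ Y) * kronCol α χ = kronCol α (Y.mulVec χ) * X := by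
  ext s t
  simp only [Matrix.mul_apply, Fintype.sum_prod_type, kronCol, Matrix.kroneckerMap_apply,
    Matrix.mulVec, dotProduct, mul_ite, mul_zero, ite_mul, zero_mul]
  rw [Finset.sum_comm]
  simp [Finset.mul_sum, mul_comm, mul_left_comm]

theorem kronCol_conjTranspose_mul {α β : Type*} [Fintype α] [Fintype β] [DecidableEq α]
    (χ : β → ℂ) (hχ : ∑ i, ‖χ i‖ ^ 2 = 1) :
    (kronCol α χ)ᴴ * kronCol α χ = 1 := by
  ext s t
  simp only [Matrix.mul_apply, Fintype.sum_prod_type, kronCol, Matrix.conjTranspose_apply,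
    Matrix.one_apply]
  by_cases h : s = t
  · subst h
    rw [Finset.sum_eq_single s]
    · simp only [if_true, Complex.star_def]
      simp only [← Complex.normSq_eq_conj_mul_self, Complex.normSq_eq_norm_sq]
      rw [← Complex.ofReal_sum, hχ, Complex.ofReal_one]
    · intro b _ hb
      simp [hb]
    · simp
  · rw [if_neg h]
    refine Finset.sum_eq_zero fun x _ => Finset.sum_eq_zero fun y _ => ?_
    by_cases hx : x = s
    · subst hx; simp [h]
    · simp [hx]

/-- The modes `A` among the modes `M`, the others being in the state `χ`. -/
def encode (e : A ⊕ₗ B ≃ M) (χ : (B → Bool) → ℂ) : Matrix (M → Bool) (A → Bool) ℂ :=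
  reorder e * (sumIso A B * kronCol (A → Bool) χ)

theorem encode_conjTranspose_mul (e : A ⊕ₗ B ≃ M) (χ : (B → Bool) → ℂ)
    (hχ : ∑ i, ‖χ i‖ ^ 2 = 1) : (encode e χ)ᴴ * encode e χ = 1 := by
  rw [encode, Matrix.conjTranspose_mul, Matrix.mul_assoc, ← Matrix.mul_assoc (reorder e)ᴴ,
    reorder_conjTranspose_mul, Matrix.one_mul, Matrix.conjTranspose_mul, Matrix.mul_assoc,
    ← Matrix.mul_assoc (sumIso A B)ᴴ, sumIso_conjTranspose_mul, Matrix.one_mul,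
    kronCol_conjTranspose_mul χ hχ]

/-- Adjoints of intertwining relations with a unitary. -/
theorem conjTranspose_mul_of_mul {α β : Type*} [Fintype α] [Fintype β] [DecidableEq α]
    [DecidableEq β] {T : Matrix α β ℂ} (h1 : Tᴴ * T = 1) (h2 : T * Tᴴ = 1) {X : Matrix α α ℂ}
    {Y : Matrix β β ℂ} (h : X * T = T * Y) : Xᴴ * T = T * Yᴴ := by
  have h' := congrArg Matrix.conjTranspose h
  rw [Matrix.conjTranspose_mul, Matrix.conjTranspose_mul] at h'
  calc Xᴴ * T = T * (Tᴴ * Xᴴ) * T := by rw [← Matrix.mul_assoc, h2, Matrix.one_mul]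
    _ = T * Yᴴ := by rw [h', Matrix.mul_assoc, Matrix.mul_assoc, h1, Matrix.mul_one]

theorem annH_inl_mul_sumIso (a : A) : (ann (Sum.inlₗ a : A ⊕ₗ B))ᴴ * sumIso A B =
    sumIso A B * ((ann a)ᴴ ⊗ₖ (1 : FockOp B)) := by
  rw [conjTranspose_mul_of_mul sumIso_conjTranspose_mul sumIso_mul_conjTranspose
    (ann_inl_mul_sumIso a), Matrix.conjTranspose_kronecker, Matrix.conjTranspose_one]

theorem annH_inr_mul_sumIso (b : B) : (ann (Sum.inrₗ b : A ⊕ₗ B))ᴴ * sumIso A B =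
    sumIso A B * (par A ⊗ₖ (ann b)ᴴ) := by
  rw [conjTranspose_mul_of_mul sumIso_conjTranspose_mul sumIso_mul_conjTranspose
    (ann_inr_mul_sumIso b), Matrix.conjTranspose_kronecker, par_conjTranspose]

/-- The encoded modes come first in `A ⊕ₗ B`, so their strings do not see `χ`; `reorder e` then
moves them to their places in `M`. -/
theorem ann_mul_encode (e : A ⊕ₗ B ≃ M) (χ : (B → Bool) → ℂ) (a : A) :
    ann (e (Sum.inlₗ a)) * encode e χ = encode e χ * ann a := by
  rw [encode, ← Matrix.mul_assoc, ← reorder_mul_ann, Matrix.mul_assoc, ← Matrix.mul_assoc (ann _),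
    ann_inl_mul_sumIso, Matrix.mul_assoc (sumIso A B), kronecker_mul_kronCol, Matrix.one_mulVec]
  simp only [Matrix.mul_assoc]
  rfl

theorem annH_mul_encode (e : A ⊕ₗ B ≃ M) (χ : (B → Bool) → ℂ) (a : A) :
    (ann (e (Sum.inlₗ a)))ᴴ * encode e χ = encode e χ * (ann a)ᴴ := by
  rw [encode, ← Matrix.mul_assoc, ← reorder_mul_annH, Matrix.mul_assoc, ← Matrix.mul_assoc (ann _)ᴴ,
    annH_inl_mul_sumIso, Matrix.mul_assoc (sumIso A B), kronecker_mul_kronCol, Matrix.one_mulVec]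
  simp only [Matrix.mul_assoc]
  rfl

theorem majX_mul_reorder (e : A ⊕ₗ B ≃ M) (b : B) :
    majX (e (Sum.inrₗ b)) * (reorder e * sumIso A B) =
      reorder e * sumIso A B * (par A ⊗ₖ majX b) := by
  rw [majX, majX, Matrix.add_mul, ← Matrix.mul_assoc, ← Matrix.mul_assoc, ← reorder_mul_ann,
    ← reorder_mul_annH, Matrix.mul_assoc, Matrix.mul_assoc, ann_inr_mul_sumIso,
    annH_inr_mul_sumIso, ← Matrix.mul_assoc, ← Matrix.mul_assoc, ← Matrix.mul_add,
    Matrix.kronecker_add]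
  rfl

theorem majY_mul_reorder (e : A ⊕ₗ B ≃ M) (b : B) :
    majY (e (Sum.inrₗ b)) * (reorder e * sumIso A B) =
      reorder e * sumIso A B * (par A ⊗ₖ majY b) := by
  rw [majY, majY, Matrix.smul_mul, Matrix.sub_mul, ← Matrix.mul_assoc, ← Matrix.mul_assoc,
    ← reorder_mul_ann, ← reorder_mul_annH, Matrix.mul_assoc, Matrix.mul_assoc, ann_inr_mul_sumIso,
    annH_inr_mul_sumIso, ← Matrix.mul_assoc, ← Matrix.mul_assoc, ← Matrix.mul_sub,
    Matrix.kronecker_smul, Matrix.mul_smul]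
  congr 2
  ext s t
  simp [Matrix.kroneckerMap_apply, mul_sub]

/-- Both Majorana operators of the second block carry a factor `par A`. The factors cancel, leaving
`coupling b c` to act on `χ` alone. -/
theorem coupling_mul_encode (e : A ⊕ₗ B ≃ M) (χ : (B → Bool) → ℂ) (b c : B)
    (h : (coupling b c).mulVec χ = χ) :
    coupling (e (Sum.inrₗ b)) (e (Sum.inrₗ c)) * encode e χ = encode e χ := by
  rw [encode, ← Matrix.mul_assoc (reorder e), ← Matrix.mul_assoc, coupling, Matrix.smul_mul,
    Matrix.mul_assoc, majY_mul_reorder, ← Matrix.mul_assoc, majX_mul_reorder, Matrix.mul_assoc,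
    ← Matrix.mul_kronecker_mul, par_mul_self, ← Matrix.mul_smul, ← Matrix.kronecker_smul,
    ← coupling, Matrix.mul_assoc, kronecker_mul_kronCol, h, Matrix.mul_one]

end Encoding

/-! ### Couplings and ladder operators. -/

section Coupling

variable {M : Type} [Fintype M] [LinearOrder M]

theorem coupling_conjTranspose (b c : M) : (coupling b c)ᴴ = coupling b c := by
  rw [coupling, Matrix.conjTranspose_smul, Matrix.conjTranspose_mul, majX_conjTranspose,
    majY_conjTranspose, majX_mul_majY]
  simp

theorem IsLadder.commute_coupling {a b c : M} (hb : a ≠ b) (hc : a ≠ c) {x : FockOp M}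
    (hx : IsLadder a x) : Commute (coupling b c) x := by
  refine Commute.smul_left (commute_of_anticomm ?_ ?_) _
  · rw [hx.majX_anticomm hb, neg_neg]
  · rw [hx.majY_anticomm hc, neg_neg]

theorem IsLadder.isLoc_mul_majX {S : Type} {site : M → S}
    (hord : ∀ p i j, site i = site j → site p ≠ site i → (p < i ↔ p < j))
    {i j : M} {x : FockOp M} (hx : IsLadder i x) (hij : site i = site j) :
    IsLoc site {site i} (x * majX j) := by
  rw [majX, mul_add]
  exact (hx.isLoc_mul hord (Or.inl rfl) hij).add (hx.isLoc_mul hord (Or.inr rfl) hij)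

theorem IsLadder.isLoc_mul_majY {S : Type} {site : M → S}
    (hord : ∀ p i j, site i = site j → site p ≠ site i → (p < i ↔ p < j))
    {i j : M} {x : FockOp M} (hx : IsLadder i x) (hij : site i = site j) :
    IsLoc site {site i} (x * majY j) := by
  rw [majY, Matrix.mul_smul, mul_sub, sub_eq_add_neg, ← neg_one_smul ℂ (x * ann j)]
  exact ((hx.isLoc_mul hord (Or.inr rfl) hij).add
    ((hx.isLoc_mul hord (Or.inl rfl) hij).smul _)).smul _

end Coupling

/-! ### The fermions and their copy as one fermionic system. -/

section Double

variable {A : Type} [Fintype A] [LinearOrder A]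

/-- Operators on the tensor product of two Fock spaces over the same modes. -/
abbrev PairOp (A : Type) : Type :=
  Matrix ((A → Bool) × (A → Bool)) ((A → Bool) × (A → Bool)) ℂ

/-- The transfer of operators from the Fock space over `A ⊕ₗ A` to the tensor product. -/
def toPair (X : FockOp (A ⊕ₗ A)) : PairOp A := (sumIso A A)ᴴ * X * sumIso A A

theorem toPair_mul (X Y : FockOp (A ⊕ₗ A)) : toPair (X * Y) = toPair X * toPair Y := by
  have h : toPair X * toPair Y =
      (sumIso A A)ᴴ * X * (sumIso A A * (sumIso A A)ᴴ) * Y * sumIso A A := by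
    simp only [toPair, Matrix.mul_assoc]
  rw [h, sumIso_mul_conjTranspose, Matrix.mul_one, toPair]
  simp only [Matrix.mul_assoc]

theorem toPair_add (X Y : FockOp (A ⊕ₗ A)) : toPair (X + Y) = toPair X + toPair Y := by
  rw [toPair, toPair, toPair, Matrix.mul_add, Matrix.add_mul]

theorem toPair_neg (X : FockOp (A ⊕ₗ A)) : toPair (-X) = -toPair X := by
  rw [toPair, toPair, Matrix.mul_neg, Matrix.neg_mul]

theorem toPair_one : toPair (1 : FockOp (A ⊕ₗ A)) = 1 := by
  rw [toPair, Matrix.mul_one, sumIso_conjTranspose_mul]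

theorem toPair_conjTranspose (X : FockOp (A ⊕ₗ A)) : toPair Xᴴ = (toPair X)ᴴ := by
  rw [toPair, toPair, Matrix.conjTranspose_mul, Matrix.conjTranspose_mul,
    Matrix.conjTranspose_conjTranspose, Matrix.mul_assoc]

theorem sumIso_mul_toPair (X : FockOp (A ⊕ₗ A)) : sumIso A A * toPair X = X * sumIso A A := by
  rw [toPair, Matrix.mul_assoc, ← Matrix.mul_assoc, sumIso_mul_conjTranspose, Matrix.one_mul]

/-- The annihilation operators of the modes and of their copies. -/
def pairAnn (u : A ⊕ A) : PairOp A := toPair (ann (toLex u))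

theorem pairAnn_inl (j : A) : pairAnn (Sum.inl j) = ann j ⊗ₖ (1 : FockOp A) := by
  have h := ann_inl_mul_sumIso (A := A) (B := A) j
  rw [pairAnn, toPair, Matrix.mul_assoc]
  erw [h]
  rw [← Matrix.mul_assoc, sumIso_conjTranspose_mul, Matrix.one_mul]

theorem pairAnn_inr (j : A) : pairAnn (Sum.inr j) = par A ⊗ₖ ann j := by
  have h := ann_inr_mul_sumIso (A := A) (B := A) j
  rw [pairAnn, toPair, Matrix.mul_assoc]
  erw [h]
  rw [← Matrix.mul_assoc, sumIso_conjTranspose_mul, Matrix.one_mul]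

theorem pairAnn_mul_pairAnn (u v : A ⊕ A) : pairAnn u * pairAnn v = -(pairAnn v * pairAnn u) := by
  rw [pairAnn, pairAnn, ← toPair_mul, ← toPair_mul, ← toPair_neg]
  exact congrArg toPair (ann_mul_ann _ _)

theorem pairAnn_mul_pairAnnH_add (u v : A ⊕ A) :
    pairAnn u * (pairAnn v)ᴴ + (pairAnn v)ᴴ * pairAnn u = if u = v then 1 else 0 := by
  rw [pairAnn, pairAnn, ← toPair_conjTranspose, ← toPair_mul, ← toPair_mul, ← toPair_add]
  have h := ann_mul_annH_add (toLex u) (toLex v)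
  refine (congrArg toPair h).trans ?_
  by_cases huv : u = v
  · subst huv
    rw [if_pos rfl, if_pos rfl]
    exact toPair_one
  · rw [if_neg huv, if_neg (fun h => huv (toLex.injective h)), toPair]
    simp

/-- `x` is the annihilation or the creation operator of `u`. -/
def IsPairLadder (u : A ⊕ A) (x : PairOp A) : Prop := x = pairAnn u ∨ x = (pairAnn u)ᴴ

theorem IsPairLadder.conjTranspose {u : A ⊕ A} {x : PairOp A} (h : IsPairLadder u x) :
    IsPairLadder u xᴴ := by
  rcases h with rfl | rfl
  · exact Or.inr rfl
  · exact Or.inl (Matrix.conjTranspose_conjTranspose _)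

/-- This square is the unit inserted into even products to split them at an intermediate mode. -/
theorem pairMaj_mul_self (u : A ⊕ A) :
    (pairAnn u + (pairAnn u)ᴴ) * (pairAnn u + (pairAnn u)ᴴ) = 1 := by
  have h1 := pairAnn_mul_pairAnnH_add u u
  rw [if_pos rfl] at h1
  have h2 := eq_zero_of_eq_neg (pairAnn_mul_pairAnn u u)
  have h3 := congrArg Matrix.conjTranspose h2
  rw [Matrix.conjTranspose_mul, Matrix.conjTranspose_zero] at h3
  rw [mul_add, add_mul, add_mul, h2, h3, zero_add, add_zero, add_comm, h1]

end Double

/-! ### Local representation of even operators. -/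

section Representation

variable {A : Type} [Fintype A] [LinearOrder A] {M : Type} [Fintype M] [LinearOrder M] {S : Type}

/-- The isometry `J` maps two copies of the fermions over the modes `A` into the Fock space over
the modes `M`, the sites `n` and `m` with `link n m` being coupled by auxiliary modes. -/
structure IsEncoding (sd : A → S) (sq : M → S) (link : S → S → Prop)
    (J : Matrix (M → Bool) ((A → Bool) × (A → Bool)) ℂ) : Prop where
  isometry : Jᴴ * J = 1
  order : ∀ p i j, sq i = sq j → sq p ≠ sq i → (p < i ↔ p < j)
  lift : ∃ f : A ⊕ A → M, (∀ u, sq (f u) = sd (Sum.elim id id u)) ∧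
    (∀ u, ann (f u) * J = J * pairAnn u) ∧ (∀ u, (ann (f u))ᴴ * J = J * (pairAnn u)ᴴ) ∧
    ∀ n m, link n m → ∃ b c, sq b = n ∧ sq c = m ∧ (∀ u, f u ≠ b) ∧ (∀ u, f u ≠ c) ∧
      coupling b c * J = J

/-- The operator `X` and its adjoint are represented by an operator on the region `R` and its
adjoint. -/
def Represented (sq : M → S) (J : Matrix (M → Bool) ((A → Bool) × (A → Bool)) ℂ) (R : Set S)
    (X : PairOp A) : Prop :=
  ∃ Y : FockOp M, IsLoc sq R Y ∧ Y * J = J * X ∧ Yᴴ * J = J * Xᴴ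

namespace Represented

variable {sq : M → S} {J : Matrix (M → Bool) ((A → Bool) × (A → Bool)) ℂ} {R : Set S}
  {X X' : PairOp A}

theorem one : Represented sq J R 1 :=
  ⟨1, IsLoc.one, by rw [Matrix.one_mul, Matrix.mul_one],
    by rw [Matrix.conjTranspose_one, Matrix.conjTranspose_one, Matrix.one_mul, Matrix.mul_one]⟩

theorem mul (h : Represented sq J R X) (h' : Represented sq J R X') :
    Represented sq J R (X * X') := by
  obtain ⟨Y, h1, h2, h3⟩ := h
  obtain ⟨Y', h1', h2', h3'⟩ := h'
  refine ⟨Y * Y', h1.mul h1', ?_, ?_⟩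
  · rw [Matrix.mul_assoc, h2', ← Matrix.mul_assoc, h2, Matrix.mul_assoc]
  · rw [Matrix.conjTranspose_mul, Matrix.conjTranspose_mul, Matrix.mul_assoc, h3,
      ← Matrix.mul_assoc, h3', Matrix.mul_assoc]

theorem add (h : Represented sq J R X) (h' : Represented sq J R X') :
    Represented sq J R (X + X') := by
  obtain ⟨Y, h1, h2, h3⟩ := h
  obtain ⟨Y', h1', h2', h3'⟩ := h'
  refine ⟨Y + Y', h1.add h1', ?_, ?_⟩
  · rw [Matrix.add_mul, Matrix.mul_add, h2, h2']
  · rw [Matrix.conjTranspose_add, Matrix.conjTranspose_add, Matrix.add_mul, Matrix.mul_add, h3, h3']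

theorem smul (a : ℂ) (h : Represented sq J R X) : Represented sq J R (a • X) := by
  obtain ⟨Y, h1, h2, h3⟩ := h
  refine ⟨a • Y, h1.smul a, ?_, ?_⟩
  · rw [Matrix.smul_mul, Matrix.mul_smul, h2]
  · rw [Matrix.conjTranspose_smul, Matrix.conjTranspose_smul, Matrix.smul_mul, Matrix.mul_smul, h3]

theorem conjTranspose (h : Represented sq J R X) : Represented sq J R Xᴴ := by
  obtain ⟨Y, h1, h2, h3⟩ := h
  exact ⟨Yᴴ, h1.conjTranspose, h3, by
    rw [Matrix.conjTranspose_conjTranspose, Matrix.conjTranspose_conjTranspose, h2]⟩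

/-- Averaging `Y` with its adjoint works because `Represented` also controls `Yᴴ`. For a mere
isometry `J`, the relation `Y * J = J * X` alone would say nothing about `Yᴴ * J`. -/
theorem exists_isHermitian (h : Represented sq J R X) (hX : X.IsHermitian) :
    ∃ Y : FockOp M, Y.IsHermitian ∧ IsLoc sq R Y ∧ Y * J = J * X := by
  obtain ⟨Y, h1, h2, h3⟩ := h
  refine ⟨(1 / 2 : ℂ) • (Y + Yᴴ), ?_, (h1.add h1.conjTranspose).smul _, ?_⟩
  · rw [Matrix.IsHermitian, Matrix.conjTranspose_smul, Matrix.conjTranspose_add,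
      Matrix.conjTranspose_conjTranspose, add_comm]
    simp
  · rw [Matrix.smul_mul, Matrix.add_mul, h2, h3, hX.eq, ← two_smul ℂ, smul_smul]
    norm_num

end Represented

namespace IsEncoding

variable {sd : A → S} {sq : M → S} {link : S → S → Prop}
  {J : Matrix (M → Bool) ((A → Bool) × (A → Bool)) ℂ}

/-- The site of a mode or of its copy. -/
def pairSite (sd : A → S) (u : A ⊕ A) : S := sd (Sum.elim id id u)

/-- All products of a ladder operator on site `n` and one on site `m` are represented on `R`. -/
def Linked (sd : A → S) (sq : M → S) (J : Matrix (M → Bool) ((A → Bool) × (A → Bool)) ℂ)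
    (R : Set S) (n m : S) : Prop :=
  ∀ u v, pairSite sd u = n → pairSite sd v = m → ∀ x y : PairOp A, IsPairLadder u x →
    IsPairLadder v y → Represented sq J R (x * y)

theorem exists_lift (h : IsEncoding sd sq link J) :
    ∃ f : A ⊕ A → M, (∀ u, sq (f u) = pairSite sd u) ∧
      (∀ u x, IsPairLadder u x → ∃ X, IsLadder (f u) X ∧ X * J = J * x ∧ Xᴴ * J = J * xᴴ) ∧
      ∀ n m, link n m → ∃ b c, sq b = n ∧ sq c = m ∧ (∀ u, f u ≠ b) ∧ (∀ u, f u ≠ c) ∧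
        coupling b c * J = J := by
  obtain ⟨f, h1, h2, h3, h4⟩ := h.lift
  refine ⟨f, h1, ?_, h4⟩
  rintro u x (rfl | rfl)
  · exact ⟨_, Or.inl rfl, h2 u, h3 u⟩
  · refine ⟨_, Or.inr rfl, h3 u, ?_⟩
    rw [Matrix.conjTranspose_conjTranspose, Matrix.conjTranspose_conjTranspose, h2]

theorem linked_self (h : IsEncoding sd sq link J) {R : Set S} {n : S} (hn : n ∈ R) :
    Linked sd sq J R n n := by
  intro u v hu hv x y hx hy
  obtain ⟨f, h1, h2, -⟩ := h.exists_lift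
  obtain ⟨X, hX, hX1, hX2⟩ := h2 u x hx
  obtain ⟨Y, hY, hY1, hY2⟩ := h2 v y hy
  refine ⟨X * Y, (hX.isLoc_mul h.order hY (by rw [h1, h1, hu, hv])).mono ?_, ?_, ?_⟩
  · rw [h1, hu]
    simpa using hn
  · rw [Matrix.mul_assoc, hY1, ← Matrix.mul_assoc, hX1, Matrix.mul_assoc]
  · rw [Matrix.conjTranspose_mul, Matrix.conjTranspose_mul, Matrix.mul_assoc, hX2,
      ← Matrix.mul_assoc, hY2, Matrix.mul_assoc]

/-- The coupling fixes `J`, so it may be appended to `X * Y`. Its two Majorana factors are then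
paired with `X` and `Y` into products confined to one site each. -/
theorem linked_of_link (h : IsEncoding sd sq link J) {R : Set S} {n m : S} (hn : n ∈ R)
    (hm : m ∈ R) (hl : link n m) : Linked sd sq J R n m := by
  intro u v hu hv x y hx hy
  obtain ⟨f, h1, h2, h3⟩ := h.exists_lift
  obtain ⟨X, hX, hX1, hX2⟩ := h2 u x hx
  obtain ⟨Y, hY, hY1, hY2⟩ := h2 v y hy
  obtain ⟨b, c, hb, hc, hfb, hfc, hJ⟩ := h3 n m hl
  have e1 : X * Y * J = J * (x * y) := by
    rw [Matrix.mul_assoc, hY1, ← Matrix.mul_assoc, hX1, Matrix.mul_assoc]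
  have e2 : Yᴴ * Xᴴ * J = J * (yᴴ * xᴴ) := by
    rw [Matrix.mul_assoc, hX2, ← Matrix.mul_assoc, hY2, Matrix.mul_assoc]
  -- In the adjoint the coupling stands on the left. It can be moved next to `J` because `b` and `c`
  -- differ from the modes `f u` and `f v`.
  have hcomm : Commute (coupling b c) (Yᴴ * Xᴴ) :=
    (hY.conjTranspose.commute_coupling (hfb v) (hfc v)).mul_right
      (hX.conjTranspose.commute_coupling (hfb u) (hfc u))
  refine ⟨X * Y * coupling b c, ?_, ?_, ?_⟩
  · have e : X * Y * coupling b c = (-Complex.I) • ((X * majX b) * (Y * majY c)) := by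
      have : X * majX b * (Y * majY c) = -(X * Y * (majX b * majY c)) := by
        calc X * majX b * (Y * majY c) = X * (majX b * Y) * majY c := by simp only [mul_assoc]
          _ = X * -(Y * majX b) * majY c := by rw [hY.majX_anticomm (hfb v), neg_neg]
          _ = _ := by simp only [mul_assoc, mul_neg, neg_mul]
      rw [this, coupling, Matrix.mul_smul, smul_neg, neg_smul, neg_neg]
    rw [e]
    have l1 := (hX.isLoc_mul_majX h.order (j := b) (by rw [h1, hu, hb])).mono (R' := R)
      (by rw [h1, hu]; simpa using hn)
    have l2 := (hY.isLoc_mul_majY h.order (j := c) (by rw [h1, hv, hc])).mono (R' := R)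
      (by rw [h1, hv]; simpa using hm)
    exact (l1.mul l2).smul _
  · rw [Matrix.mul_assoc, hJ, e1]
  · rw [Matrix.conjTranspose_mul, Matrix.conjTranspose_mul, coupling_conjTranspose, hcomm.eq,
      Matrix.mul_assoc, hJ, e2, Matrix.conjTranspose_mul]

theorem Linked.symm {R : Set S} {n m : S} (h : Linked sd sq J R n m) : Linked sd sq J R m n := by
  intro u v hu hv x y hx hy
  have := (h v u hv hu yᴴ xᴴ hy.conjTranspose hx.conjTranspose).conjTranspose
  rwa [Matrix.conjTranspose_mul, Matrix.conjTranspose_conjTranspose,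
    Matrix.conjTranspose_conjTranspose] at this

/-- With `γ` the self-adjoint Majorana operator of `u` and `γ * γ = 1`, one has `x * y = (x * γ) *
(γ * y)`. -/
theorem represented_mul_of_maj {R : Set S} (u : A ⊕ A) {x y : PairOp A}
    (h1 : ∀ z, IsPairLadder u z → Represented sq J R (x * z))
    (h2 : ∀ z, IsPairLadder u z → Represented sq J R (z * y)) : Represented sq J R (x * y) := by
  have e : x * y = (x * pairAnn u + x * (pairAnn u)ᴴ) * (pairAnn u * y + (pairAnn u)ᴴ * y) := by
    rw [← mul_add, ← add_mul, mul_assoc, ← mul_assoc (pairAnn u + (pairAnn u)ᴴ), pairMaj_mul_self,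
      one_mul]
  rw [e]
  exact ((h1 _ (Or.inl rfl)).add (h1 _ (Or.inr rfl))).mul
    ((h2 _ (Or.inl rfl)).add (h2 _ (Or.inr rfl)))

theorem Linked.trans {R : Set S} {n m l : S} (hsd : ∃ j, sd j = m) (h : Linked sd sq J R n m)
    (h' : Linked sd sq J R m l) : Linked sd sq J R n l := by
  intro u v hu hv x y hx hy
  obtain ⟨j, hj⟩ := hsd
  exact represented_mul_of_maj (Sum.inl j) (fun z hz => h u (Sum.inl j) hu hj x z hx hz)
    fun z hz => h' (Sum.inl j) v hj hv z y hz hy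

end IsEncoding

/-- `o` times a ladder operator on a site of `R` is represented on `R`. -/
def OddRepresented (sd : A → S) (sq : M → S) (J : Matrix (M → Bool) ((A → Bool) × (A → Bool)) ℂ)
    (R : Set S) (o : PairOp A) : Prop :=
  ∀ u, IsEncoding.pairSite sd u ∈ R → ∀ z, IsPairLadder u z →
    Represented sq J R (o * z) ∧ Represented sq J R (z * o)

namespace OddRepresented

variable {sd : A → S} {sq : M → S} {J : Matrix (M → Bool) ((A → Bool) × (A → Bool)) ℂ}
  {R : Set S} {o o' X : PairOp A}

theorem add (h : OddRepresented sd sq J R o) (h' : OddRepresented sd sq J R o') :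
    OddRepresented sd sq J R (o + o') := by
  intro u hu z hz
  rw [add_mul, mul_add]
  exact ⟨(h u hu z hz).1.add (h' u hu z hz).1, (h u hu z hz).2.add (h' u hu z hz).2⟩

theorem smul (a : ℂ) (h : OddRepresented sd sq J R o) : OddRepresented sd sq J R (a • o) := by
  intro u hu z hz
  rw [Matrix.smul_mul, Matrix.mul_smul]
  exact ⟨(h u hu z hz).1.smul a, (h u hu z hz).2.smul a⟩

theorem zero : OddRepresented sd sq J R 0 := by
  intro u hu z hz
  rw [zero_mul, mul_zero, ← zero_smul ℂ (1 : PairOp A)]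
  exact ⟨Represented.one.smul 0, Represented.one.smul 0⟩

theorem conjTranspose (h : OddRepresented sd sq J R o) : OddRepresented sd sq J R oᴴ := by
  intro u hu z hz
  obtain ⟨h1, h2⟩ := h u hu zᴴ hz.conjTranspose
  have h1' := h1.conjTranspose
  have h2' := h2.conjTranspose
  rw [Matrix.conjTranspose_mul, Matrix.conjTranspose_conjTranspose] at h1' h2'
  exact ⟨h2', h1'⟩

/-- The predicate for odd operators supplies only products with ladder operators; a Majorana square
at a mode of `R` splits `o * o'` into two such products. -/
theorem mul (hR : ∃ j, sd j ∈ R) (h : OddRepresented sd sq J R o)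
    (h' : OddRepresented sd sq J R o') : Represented sq J R (o * o') := by
  obtain ⟨j, hj⟩ := hR
  exact IsEncoding.represented_mul_of_maj (Sum.inl j) (fun z hz => (h (Sum.inl j) hj z hz).1)
    fun z hz => (h' (Sum.inl j) hj z hz).2

end OddRepresented

/-- `X` is represented on `R`, and so is its product with two ladder operators on sites of `R`. -/
def EvenRepresented (sd : A → S) (sq : M → S) (J : Matrix (M → Bool) ((A → Bool) × (A → Bool)) ℂ)
    (R : Set S) (X : PairOp A) : Prop :=
  Represented sq J R X ∧ ∀ u v, IsEncoding.pairSite sd u ∈ R → IsEncoding.pairSite sd v ∈ R →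
    ∀ z w, IsPairLadder u z → IsPairLadder v w → Represented sq J R (z * X * w)

section EvenOdd

variable {sd : A → S} {sq : M → S} {J : Matrix (M → Bool) ((A → Bool) × (A → Bool)) ℂ}
  {R : Set S} {o o' X X' : PairOp A}

theorem EvenRepresented.add (h : EvenRepresented sd sq J R X) (h' : EvenRepresented sd sq J R X') :
    EvenRepresented sd sq J R (X + X') := by
  refine ⟨h.1.add h'.1, fun u v hu hv z w hz hw => ?_⟩
  rw [mul_add, add_mul]
  exact (h.2 u v hu hv z w hz hw).add (h'.2 u v hu hv z w hz hw)

theorem EvenRepresented.smul (a : ℂ) (h : EvenRepresented sd sq J R X) :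
    EvenRepresented sd sq J R (a • X) := by
  refine ⟨h.1.smul a, fun u v hu hv z w hz hw => ?_⟩
  rw [Matrix.mul_smul, Matrix.smul_mul]
  exact (h.2 u v hu hv z w hz hw).smul a

theorem EvenRepresented.one
    (hl : ∀ n ∈ R, ∀ m ∈ R, IsEncoding.Linked sd sq J R n m) : EvenRepresented sd sq J R 1 := by
  refine ⟨Represented.one, fun u v hu hv z w hz hw => ?_⟩
  rw [mul_one]
  exact hl _ hu _ hv u v rfl rfl z w hz hw

theorem EvenRepresented.mul (hR : ∃ j, sd j ∈ R) (h : EvenRepresented sd sq J R X)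
    (h' : EvenRepresented sd sq J R X') : EvenRepresented sd sq J R (X * X') := by
  obtain ⟨j, hj⟩ := hR
  refine ⟨h.1.mul h'.1, fun u v hu hv z w hz hw => ?_⟩
  have e : z * (X * X') * w = z * X * (X' * w) := by simp only [mul_assoc]
  rw [e]
  refine IsEncoding.represented_mul_of_maj (Sum.inl j) (fun y hy => h.2 u (Sum.inl j) hu hj z y hz hy)
    fun y hy => ?_
  rw [← mul_assoc]
  exact h'.2 (Sum.inl j) v hj hv y w hy hw

theorem OddRepresented.mul_odd (hR : ∃ j, sd j ∈ R) (h : OddRepresented sd sq J R o)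
    (h' : OddRepresented sd sq J R o') : EvenRepresented sd sq J R (o * o') := by
  refine ⟨h.mul hR h', fun u v hu hv z w hz hw => ?_⟩
  have e : z * (o * o') * w = z * o * (o' * w) := by simp only [mul_assoc]
  rw [e]
  exact (h u hu z hz).2.mul (h' v hv w hw).1

theorem EvenRepresented.mul_odd (hR : ∃ j, sd j ∈ R) (h : EvenRepresented sd sq J R X)
    (h' : OddRepresented sd sq J R o) : OddRepresented sd sq J R (X * o) := by
  obtain ⟨j, hj⟩ := hR
  refine fun u hu z hz => ⟨?_, ?_⟩
  · rw [mul_assoc]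
    exact h.1.mul (h' u hu z hz).1
  · rw [← mul_assoc]
    exact IsEncoding.represented_mul_of_maj (Sum.inl j) (fun y hy => h.2 u (Sum.inl j) hu hj z y hz hy)
      fun y hy => (h' (Sum.inl j) hj y hy).2

theorem OddRepresented.mul_even (hR : ∃ j, sd j ∈ R) (h' : OddRepresented sd sq J R o)
    (h : EvenRepresented sd sq J R X) : OddRepresented sd sq J R (o * X) := by
  obtain ⟨j, hj⟩ := hR
  refine fun u hu z hz => ⟨?_, ?_⟩
  · rw [mul_assoc]
    refine IsEncoding.represented_mul_of_maj (Sum.inl j) (fun y hy => (h' (Sum.inl j) hj y hy).1)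
      fun y hy => ?_
    rw [← mul_assoc]
    exact h.2 (Sum.inl j) u hj hu y z hy hz
  · rw [← mul_assoc]
    exact (h' u hu z hz).2.mul h.1

theorem IsPairLadder.oddRepresented (hl : ∀ n ∈ R, ∀ m ∈ R, IsEncoding.Linked sd sq J R n m)
    {u : A ⊕ A} {x : PairOp A} (hx : IsPairLadder u x) (hu : IsEncoding.pairSite sd u ∈ R) :
    OddRepresented sd sq J R x :=
  fun v hv z hz => ⟨hl _ hu _ hv u v rfl rfl x z hx hz, hl _ hv _ hu v u rfl rfl z x hz hx⟩

theorem IsLadder.kronecker {j : A} {x : FockOp A} (hx : IsLadder j x) :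
    IsPairLadder (Sum.inl j) (x ⊗ₖ (1 : FockOp A)) := by
  rcases hx with rfl | rfl
  · exact Or.inl (pairAnn_inl j).symm
  · right
    rw [pairAnn_inl, Matrix.conjTranspose_kronecker, Matrix.conjTranspose_one]

theorem IsLadder.par_mul {j : A} {x : FockOp A} (hx : IsLadder j x) :
    par A * x = -(x * par A) := by
  rcases hx with rfl | rfl
  · exact par_mul_ann j
  · exact par_mul_annH j

/-- The ladder operators on the sites of `R`. -/
def siteLadders (sd : A → S) (R : Set S) : Set (FockOp A) :=
  {x | ∃ j, sd j ∈ R ∧ IsLadder j x}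

theorem mul_kronecker_one (X Y : FockOp A) :
    (X * Y) ⊗ₖ (1 : FockOp A) = (X ⊗ₖ (1 : FockOp A)) * (Y ⊗ₖ (1 : FockOp A)) := by
  rw [← Matrix.mul_kronecker_mul, mul_one]

/-- A polynomial in ladder operators on `R` is the sum of an even and an odd represented part. -/
theorem exists_even_add_odd (hR : ∃ j, sd j ∈ R)
    (hl : ∀ n ∈ R, ∀ m ∈ R, IsEncoding.Linked sd sq J R n m) {X : FockOp A}
    (hX : X ∈ Algebra.adjoin ℂ (siteLadders sd R)) :
    ∃ E O : FockOp A, X = E + O ∧ par A * E = E * par A ∧ par A * O = -(O * par A) ∧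
      EvenRepresented sd sq J R (E ⊗ₖ (1 : FockOp A)) ∧
      OddRepresented sd sq J R (O ⊗ₖ (1 : FockOp A)) := by
  induction hX using Algebra.adjoin_induction with
  | mem x hx =>
    obtain ⟨j, hj, hx⟩ := hx
    refine ⟨0, x, (zero_add x).symm, by simp, hx.par_mul, ?_, hx.kronecker.oddRepresented hl hj⟩
    rw [Matrix.zero_kronecker, ← zero_smul ℂ (1 : PairOp A)]
    exact (EvenRepresented.one hl).smul 0
  | algebraMap r =>
    refine ⟨algebraMap ℂ _ r, 0, (add_zero _).symm, (Algebra.commutes r (par A)).symm, by simp, ?_, ?_⟩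
    · rw [Algebra.algebraMap_eq_smul_one, Matrix.smul_kronecker, Matrix.one_kronecker_one]
      exact (EvenRepresented.one hl).smul r
    · rw [Matrix.zero_kronecker]
      exact OddRepresented.zero
  | add x y _ _ hx hy =>
    obtain ⟨E, O, h1, h2, h3, h4, h5⟩ := hx
    obtain ⟨E', O', h1', h2', h3', h4', h5'⟩ := hy
    refine ⟨E + E', O + O', by rw [h1, h1']; abel, by rw [mul_add, add_mul, h2, h2'],
      by rw [mul_add, add_mul, h3, h3', neg_add], ?_, ?_⟩
    · rw [Matrix.add_kronecker]
      exact h4.add h4'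
    · rw [Matrix.add_kronecker]
      exact h5.add h5'
  | mul x y _ _ hx hy =>
    obtain ⟨E, O, h1, h2, h3, h4, h5⟩ := hx
    obtain ⟨E', O', h1', h2', h3', h4', h5'⟩ := hy
    refine ⟨E * E' + O * O', E * O' + O * E', by rw [h1, h1']; noncomm_ring, ?_, ?_, ?_, ?_⟩
    · have a1 : par A * (E * E') = E * E' * par A := by
        rw [← mul_assoc, h2, mul_assoc, h2', mul_assoc]
      have a2 : par A * (O * O') = O * O' * par A := by
        rw [← mul_assoc, h3, neg_mul, mul_assoc, h3', mul_neg, neg_neg, mul_assoc]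
      rw [mul_add, add_mul, a1, a2]
    · have a1 : par A * (E * O') = -(E * O' * par A) := by
        rw [← mul_assoc, h2, mul_assoc, h3', mul_neg, mul_assoc]
      have a2 : par A * (O * E') = -(O * E' * par A) := by
        rw [← mul_assoc, h3, neg_mul, mul_assoc, h2', mul_assoc]
      rw [mul_add, add_mul, a1, a2, neg_add]
    · rw [Matrix.add_kronecker, mul_kronecker_one, mul_kronecker_one]
      exact (h4.mul hR h4').add (h5.mul_odd hR h5')
    · rw [Matrix.add_kronecker, mul_kronecker_one, mul_kronecker_one]
      exact (h4.mul_odd hR h5').add (h5.mul_even hR h4')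

/-- The even part of `X` both commutes and anticommutes with the invertible parity, hence vanishes.
-/
theorem oddRepresented_of_anticomm (hR : ∃ j, sd j ∈ R)
    (hl : ∀ n ∈ R, ∀ m ∈ R, IsEncoding.Linked sd sq J R n m) {X : FockOp A}
    (hX : X ∈ Algebra.adjoin ℂ (siteLadders sd R)) (hpar : par A * X = -(X * par A)) :
    OddRepresented sd sq J R (X ⊗ₖ (1 : FockOp A)) := by
  obtain ⟨E, O, rfl, h2, h3, -, h5⟩ := exists_even_add_odd hR hl hX
  have hE : E * par A = 0 := by
    apply eq_zero_of_eq_neg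
    rw [mul_add, add_mul, h2, h3, neg_add] at hpar
    exact add_right_cancel hpar
  have hE' : E = 0 := by
    rw [← mul_one E, ← par_mul_self, ← mul_assoc, hE, zero_mul]
  rw [hE', zero_add]
  exact h5

theorem represented_of_mem_adjoin_pairs
    (hl : ∀ n ∈ R, ∀ m ∈ R, IsEncoding.Linked sd sq J R n m) {X : FockOp A}
    (hX : X ∈ Algebra.adjoin ℂ {z : FockOp A | ∃ x ∈ siteLadders sd R, ∃ y ∈ siteLadders sd R,
      z = x * y}) : Represented sq J R (X ⊗ₖ (1 : FockOp A)) := by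
  induction hX using Algebra.adjoin_induction with
  | mem z hz =>
    obtain ⟨x, ⟨i, hi, hx⟩, y, ⟨j, hj, hy⟩, rfl⟩ := hz
    rw [mul_kronecker_one]
    exact hl _ hi _ hj (Sum.inl i) (Sum.inl j) rfl rfl _ _ hx.kronecker hy.kronecker
  | algebraMap r =>
    rw [Algebra.algebraMap_eq_smul_one, Matrix.smul_kronecker, Matrix.one_kronecker_one]
    exact Represented.one.smul r
  | add x y _ _ hx hy =>
    rw [Matrix.add_kronecker]
    exact hx.add hy
  | mul x y _ _ hx hy =>
    rw [mul_kronecker_one]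
    exact hx.mul hy

end EvenOdd

end Representation

/-! ### Irreducibility of the ladder operators, and evenness of the evolution. -/

section Commutant

variable {M : Type} [Fintype M] [LinearOrder M]

/-- The ladder operators act irreducibly. -/
theorem eq_smul_one_of_commute {C : FockOp M} (h1 : ∀ j, Commute C (ann j))
    (h2 : ∀ j, Commute C (ann j)ᴴ) : ∃ c : ℂ, C = c • (1 : FockOp M) := by
  have hoff : ∀ s t : M → Bool, s ≠ t → C s t = 0 := by
    intro s t hst
    obtain ⟨p, hp⟩ := Function.ne_iff.1 hst
    refine commute_zOp_iff.1 ?_ s t hp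
    -- The sign operator is a polynomial in the ladder operators, so `C` commutes with it for every
    -- mode and is diagonal.
    have hz : zOp p = 1 - (2 : ℂ) • ((ann p)ᴴ * ann p) := by
      rw [annH_mul_ann_self]
      ext a b
      simp only [zOp, sgnMap, Matrix.sub_apply, Matrix.smul_apply, Matrix.one_apply, smul_eq_mul]
      by_cases hab : a = b <;> cases hb : b p <;> simp [hab]
      norm_num
    rw [hz]
    exact (Commute.one_right C).sub_right (((h2 p).mul_right (h1 p)).smul_right _)
  have hmaj : ∀ (p : M) (s t : M → Bool), majX p s t =
      if s = Function.update t p (!t p) then str p t else 0 := by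
    intro p s t
    rw [majX, annH_eq, ann_eq, Matrix.add_apply]
    simp only [sgnMap]
    cases t p <;> simp
  -- `majX p` connects `t` to its flip with a nonzero coefficient, so the two diagonal entries of
  -- `C` agree.
  have hflip : ∀ (p : M) (t : M → Bool),
      C (Function.update t p (!t p)) (Function.update t p (!t p)) = C t t := by
    intro p t
    have hc : Commute C (majX p) := (h1 p).add_right (h2 p)
    have h := congrFun (congrFun hc.eq (Function.update t p (!t p))) t
    rw [Matrix.mul_apply, Matrix.mul_apply, Finset.sum_eq_single (Function.update t p (!t p)),
      Finset.sum_eq_single t, hmaj, if_pos rfl, mul_comm] at h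
    · exact mul_left_cancel₀ (left_ne_zero_of_mul_eq_one (str_mul_self p t)) h
    · intro b _ hb
      rw [hoff b t hb, mul_zero]
    · simp
    · intro b _ hb
      rw [hoff _ b hb.symm, zero_mul]
    · simp
  have hset : ∀ (p : M) (b : Bool) (t : M → Bool),
      C (Function.update t p b) (Function.update t p b) = C t t := by
    intro p b t
    by_cases hb : b = t p
    · rw [hb, Function.update_eq_self]
    · rw [show b = !t p by cases b <;> cases h : t p <;> simp_all]
      exact hflip p t
  have key : ∀ (t : M → Bool) (D : Finset M), C (fun p => if p ∈ D then t p else false)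
      (fun p => if p ∈ D then t p else false) = C (fun _ => false) (fun _ => false) := by
    intro t D
    induction D using Finset.induction_on with
    | empty => simp
    | insert a D ha ih =>
      rw [← ih, ← hset a (t a) (fun p => if p ∈ D then t p else false)]
      congr 1 <;>
      · funext p
        by_cases hp : p = a
        · subst hp; simp
        · simp [hp]
  refine ⟨C (fun _ => false) (fun _ => false), ?_⟩
  ext s t
  by_cases hst : s = t
  · subst hst
    have := key s Finset.univ
    simp only [Finset.mem_univ, if_true] at this
    simp [this]
  · simp [hoff s t hst, hst]

/-- An evolution that leaves an added mode invariant is even. -/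
theorem LeavesAddedModeInvariant.par_mul {U : FockOp M} (h : LeavesAddedModeInvariant U) :
    par M * U = U * par M := by
  ext s t
  have e1 : (par M * U) s t = (∏ i, if s i = true then (-1 : ℂ) else 1) * U s t := by
    simp only [Matrix.mul_apply, par, sgnMap]
    rw [Finset.sum_eq_single s]
    · simp
    · intro b _ hb
      simp [hb.symm]
    · simp
  have e2 : (U * par M) s t = U s t * ∏ i, if t i = true then (-1 : ℂ) else 1 := by
    simp only [Matrix.mul_apply, par, sgnMap]
    rw [Finset.sum_eq_single t] <;> simp +contextual
  let ext (b : Bool) (w : M → Bool) : WithTop M → Bool := fun x => WithTop.recTopCoe b w x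
  have ext_top : ∀ b w, ext b w ⊤ = b := fun b w => rfl
  have ext_coe : ∀ b w (j : M), ext b w (j : WithTop M) = w j := fun b w j => rfl
  have hext : ∀ (w : WithTop M → Bool), ext (w ⊤) (fun j => w j) = w := by
    intro w
    funext x
    induction x using WithTop.recTopCoe <;> rfl
  have hupd : ∀ (b b' : Bool) (w : M → Bool), Function.update (ext b w) ⊤ b' = ext b' w := by
    intro b b' w
    funext x
    induction x using WithTop.recTopCoe with
    | top => simp [ext_top]
    | coe x => rw [Function.update_of_ne (WithTop.coe_ne_top), ext_coe, ext_coe]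
  have hstr : ∀ b (w : M → Bool), str (⊤ : WithTop M) (ext b w)
      = ∏ i, if w i = true then (-1 : ℂ) else 1 := by
    intro b w
    have hp := Fintype.prod_equiv (Equiv.optionEquivSumPUnit.{0, 0} M).symm
      (fun x => Sum.elim (fun i => if w i = true then (-1 : ℂ) else 1) (fun _ => 1) x)
      (fun x : WithTop M => if x < ⊤ ∧ ext b w x = true then (-1 : ℂ) else 1) ?_
    · rw [Fintype.prod_sum_type] at hp
      simp only [Sum.elim_inl, Sum.elim_inr, Finset.prod_const_one, mul_one] at hp
      rw [hp, str]
      rfl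
    · rintro (x | x)
      · have : ((x : WithTop M) < ⊤) := WithTop.coe_lt_top x
        show _ = if (x : WithTop M) < ⊤ ∧ ext b w (x : WithTop M) = true then (-1 : ℂ) else 1
        simp [this, ext_coe]
      · show _ = if (⊤ : WithTop M) < ⊤ ∧ ext b w (⊤ : WithTop M) = true then (-1 : ℂ) else 1
        simp
  -- The entry that empties the added mode has a single intermediate state on each side. The string
  -- of `⊤` then gives the parity of `t` on the left and of `s` on the right.
  have hh := congrFun (congrFun h (ext false s)) (ext true t)
  rw [Matrix.mul_apply, Matrix.mul_apply, Finset.sum_eq_single (ext false t),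
    Finset.sum_eq_single (ext true s)] at hh
  · rw [ann_eq] at hh
    simp only [sgnMap, addMode, hupd, ext_top, hstr] at hh
    rw [e1, e2]
    simpa [ext_coe] using hh.symm
  · intro b _ hb
    rw [ann_eq, addMode]
    simp only [sgnMap]
    by_cases hb' : b ⊤ = true
    · rw [if_neg, zero_mul]
      intro hs
      apply hb
      rw [← hext b, hb']
      have := congrArg (fun v : WithTop M → Bool => fun j : M => v (j : WithTop M)) hs
      simp only [ext_coe] at this
      congr 1
      funext j
      rw [congrFun this j, Function.update_of_ne (WithTop.coe_ne_top)]
    · simp [hb']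
  · simp
  · intro b _ hb
    rw [ann_eq]
    simp only [sgnMap]
    rw [if_neg, mul_zero]
    rw [hupd]
    exact hb
  · simp

end Commutant

/-! ### Exchange of the two copies, globally and mode by mode. -/

section Swap

variable {A : Type} [Fintype A] [LinearOrder A]

/-- The parity of a configuration as a sign. -/
def parSign (s : A → Bool) : ℂ := ∏ i, if s i = true then (-1 : ℂ) else 1

theorem parSign_eq (s : A → Bool) : parSign s = 1 ∨ parSign s = -1 :=
  mul_self_eq_one_iff.1 (par_sign_mul_self s)

theorem par_mul_apply (X : FockOp A) (s t : A → Bool) : (par A * X) s t = parSign s * X s t := by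
  simp only [Matrix.mul_apply, par, sgnMap, parSign]
  rw [Finset.sum_eq_single s]
  · simp
  · intro b _ hb
    simp [hb.symm]
  · simp

theorem mul_par_apply (X : FockOp A) (s t : A → Bool) : (X * par A) s t = X s t * parSign t := by
  simp only [Matrix.mul_apply, par, sgnMap, parSign]
  rw [Finset.sum_eq_single t] <;> simp +contextual

/-- The sign of exchanging two blocks of fermions. -/
def swapSign (s t : A → Bool) : ℂ := if parSign s = 1 then 1 else parSign t

theorem swapSign_comm (s t : A → Bool) : swapSign s t = swapSign t s := by
  have h : (-1 : ℂ) ≠ 1 := by norm_num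
  rcases parSign_eq s with hs | hs <;> rcases parSign_eq t with ht | ht <;>
    simp [swapSign, hs, ht, h]

theorem swapSign_mul_self (s t : A → Bool) : swapSign s t * swapSign s t = 1 := by
  have h : (-1 : ℂ) ≠ 1 := by norm_num
  rcases parSign_eq s with hs | hs <;> rcases parSign_eq t with ht | ht <;>
    simp [swapSign, hs, ht, h]

/-- The exchange of the two copies of the fermions. -/
def swapOp (A : Type) [Fintype A] [LinearOrder A] : PairOp A :=
  sgnMap (fun st => (st.2, st.1)) (fun st => swapSign st.1 st.2)

theorem swapOp_mul_self : swapOp A * swapOp A = 1 := by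
  rw [swapOp, sgnMap_mul, ← sgnMap_one]
  refine sgnMap_ext fun t => ⟨?_, fun _ => rfl⟩
  rw [swapSign_comm t.2, swapSign_mul_self]

theorem swapOp_mul_apply (X : PairOp A) (s t : (A → Bool) × (A → Bool)) :
    (swapOp A * X) s t = swapSign s.2 s.1 * X (s.2, s.1) t := by
  rw [Matrix.mul_apply, Finset.sum_eq_single (s.2, s.1)]
  · simp [swapOp, sgnMap]
  · rintro ⟨b, b'⟩ _ hb
    rw [swapOp, sgnMap, if_neg, zero_mul]
    rintro rfl
    exact hb rfl
  · simp

theorem mul_swapOp_apply (X : PairOp A) (s t : (A → Bool) × (A → Bool)) :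
    (X * swapOp A) s t = X s (t.2, t.1) * swapSign t.1 t.2 := by
  rw [Matrix.mul_apply, Finset.sum_eq_single (t.2, t.1)]
  · simp [swapOp, sgnMap]
  · intro b _ hb
    rw [swapOp, sgnMap, if_neg hb, mul_zero]
  · simp

theorem even_apply {X : FockOp A} (h : par A * X = X * par A) {s t : A → Bool}
    (hst : X s t ≠ 0) : parSign s = parSign t := by
  have := congrFun (congrFun h s) t
  rw [par_mul_apply, mul_par_apply, mul_comm] at this
  exact mul_left_cancel₀ hst this

theorem odd_apply {X : FockOp A} (h : par A * X = -(X * par A)) {s t : A → Bool}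
    (hst : X s t ≠ 0) : parSign s = -parSign t := by
  have := congrFun (congrFun h s) t
  rw [par_mul_apply, Matrix.neg_apply, mul_par_apply, mul_comm, ← mul_neg] at this
  exact mul_left_cancel₀ hst this

/-- The exchange sign depends only on the parities of the two blocks, which an even `X` preserves.
-/
theorem even_mul_swapOp {X : FockOp A} (h : par A * X = X * par A) :
    (X ⊗ₖ (1 : FockOp A)) * swapOp A = swapOp A * ((1 : FockOp A) ⊗ₖ X) := by
  ext ⟨s, s'⟩ ⟨t, t'⟩
  rw [swapOp_mul_apply, mul_swapOp_apply, Matrix.kroneckerMap_apply, Matrix.kroneckerMap_apply]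
  by_cases h1 : s' = t
  · subst h1
    by_cases h0 : X s t' = 0
    · simp [h0]
    · simp only [swapSign, even_apply h h0, Matrix.one_apply_eq]
      ring
  · simp [h1]

/-- An odd `X` changes the parity of one block, which alters the exchange sign by the parity of the
other; this is the factor `par A`. -/
theorem odd_mul_swapOp {X : FockOp A} (h : par A * X = -(X * par A)) :
    (X ⊗ₖ (1 : FockOp A)) * swapOp A = swapOp A * (par A ⊗ₖ X) := by
  ext ⟨s, s'⟩ ⟨t, t'⟩
  rw [swapOp_mul_apply, mul_swapOp_apply, Matrix.kroneckerMap_apply, Matrix.kroneckerMap_apply]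
  by_cases h1 : s' = t
  · subst h1
    have hp : par A s' s' = parSign s' := by simp [par, sgnMap, parSign]
    simp only [Matrix.one_apply_eq, hp]
    by_cases h0 : X s t' = 0
    · simp [h0]
    · have h2 : (-1 : ℂ) ≠ 1 := by norm_num
      have h3 := odd_apply h h0
      rcases parSign_eq s' with hs | hs <;> rcases parSign_eq t' with ht | ht <;>
        simp [swapSign, h3, hs, ht, h2]
  · simp [par, sgnMap, h1]

theorem par_kronecker_odd_mul_swapOp {X : FockOp A} (h : par A * X = -(X * par A)) :
    (par A ⊗ₖ X) * swapOp A = swapOp A * (X ⊗ₖ (1 : FockOp A)) := by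
  calc (par A ⊗ₖ X) * swapOp A
      = swapOp A * (swapOp A * (par A ⊗ₖ X)) * swapOp A := by
        rw [← mul_assoc, swapOp_mul_self, one_mul]
    _ = swapOp A * (X ⊗ₖ (1 : FockOp A)) := by
        rw [← odd_mul_swapOp h, mul_assoc, mul_assoc, swapOp_mul_self, mul_one]

/-- The ladder operators of both copies act irreducibly. -/
theorem pair_eq_smul_one_of_commute {C : PairOp A} (h1 : ∀ u, Commute C (pairAnn u))
    (h2 : ∀ u, Commute C (pairAnn u)ᴴ) : ∃ c : ℂ, C = c • (1 : PairOp A) := by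
  have hC : C = toPair (sumIso A A * C * (sumIso A A)ᴴ) := by
    have : toPair (sumIso A A * C * (sumIso A A)ᴴ) =
        (sumIso A A)ᴴ * sumIso A A * C * ((sumIso A A)ᴴ * sumIso A A) := by
      simp only [toPair, Matrix.mul_assoc]
    rw [this, sumIso_conjTranspose_mul, Matrix.one_mul, Matrix.mul_one]
  have key : ∀ Y : FockOp (A ⊕ₗ A), Commute C (toPair Y) →
      Commute (sumIso A A * C * (sumIso A A)ᴴ) Y := by
    intro Y hY
    have inj : ∀ Z Z' : FockOp (A ⊕ₗ A), toPair Z = toPair Z' → Z = Z' := by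
      intro Z Z' hZ
      have h := congrArg (fun x => sumIso A A * x * (sumIso A A)ᴴ) hZ
      simp only [sumIso_mul_toPair] at h
      rwa [Matrix.mul_assoc, Matrix.mul_assoc, sumIso_mul_conjTranspose, Matrix.mul_one,
        Matrix.mul_one] at h
    apply inj
    rw [toPair_mul, toPair_mul, ← hC]
    exact hY
  obtain ⟨c, hc⟩ := eq_smul_one_of_commute (M := A ⊕ₗ A) (C := sumIso A A * C * (sumIso A A)ᴴ)
    (fun j => key _ (h1 (ofLex j))) (fun j => key _ (by
      rw [toPair_conjTranspose]
      exact h2 (ofLex j)))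
  refine ⟨c, ?_⟩
  rw [hC, hc, toPair, Matrix.mul_smul, Matrix.smul_mul, Matrix.mul_one, sumIso_conjTranspose_mul]

/-- A unitary that exchanges the ladder operators of the two copies exchanges all even
operators. -/
theorem even_mul_of_swaps {T : PairOp A} (hT : Tᴴ * T = 1)
    (h1 : ∀ j, pairAnn (Sum.inl j) * T = T * pairAnn (Sum.inr j))
    (h2 : ∀ j, pairAnn (Sum.inr j) * T = T * pairAnn (Sum.inl j)) {X : FockOp A}
    (hX : par A * X = X * par A) :
    (X ⊗ₖ (1 : FockOp A)) * T = T * ((1 : FockOp A) ⊗ₖ X) := by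
  have hT' : T * Tᴴ = 1 := mul_eq_one_comm.1 hT
  have s1 : ∀ u : A ⊕ A, pairAnn u * swapOp A = swapOp A * pairAnn u.swap := by
    rintro (j | j)
    · rw [Sum.swap_inl, pairAnn_inl, pairAnn_inr, odd_mul_swapOp (par_mul_ann j)]
    · rw [Sum.swap_inr, pairAnn_inl, pairAnn_inr, par_kronecker_odd_mul_swapOp (par_mul_ann j)]
  have s2 : ∀ u : A ⊕ A, (pairAnn u)ᴴ * swapOp A = swapOp A * (pairAnn u.swap)ᴴ := by
    rintro (j | j)
    · rw [Sum.swap_inl, pairAnn_inl, pairAnn_inr, Matrix.conjTranspose_kronecker,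
        Matrix.conjTranspose_kronecker, par_conjTranspose, Matrix.conjTranspose_one,
        odd_mul_swapOp (par_mul_annH j)]
    · rw [Sum.swap_inr, pairAnn_inl, pairAnn_inr, Matrix.conjTranspose_kronecker,
        Matrix.conjTranspose_kronecker, par_conjTranspose, Matrix.conjTranspose_one,
        par_kronecker_odd_mul_swapOp (par_mul_annH j)]
  have t1 : ∀ u : A ⊕ A, pairAnn u * T = T * pairAnn u.swap := by
    rintro (j | j)
    · exact h1 j
    · exact h2 j
  have t2 : ∀ u : A ⊕ A, (pairAnn u)ᴴ * T = T * (pairAnn u.swap)ᴴ :=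
    fun u => conjTranspose_mul_of_mul hT hT' (t1 u)
  -- `T` and the explicit `swapOp A` exchange the ladder operators in the same way. Their product
  -- commutes with all of these and is a scalar, so the sign computation for `swapOp A` applies to
  -- `T`.
  obtain ⟨c, hc⟩ := pair_eq_smul_one_of_commute (C := swapOp A * T) (fun u => by
      rw [Commute, SemiconjBy, ← mul_assoc (pairAnn u), s1, mul_assoc, mul_assoc, t1, Sum.swap_swap])
    (fun u => by
      rw [Commute, SemiconjBy, ← mul_assoc (pairAnn u)ᴴ, s2, mul_assoc, mul_assoc, t2,
        Sum.swap_swap])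
  have hTe : T = c • swapOp A := by
    rw [← one_mul T, ← swapOp_mul_self, mul_assoc, hc, Matrix.mul_smul, mul_one]
  rw [hTe, Matrix.mul_smul, Matrix.smul_mul, even_mul_swapOp hX]

/-- The difference of the annihilation operators of a mode and of its copy. -/
def diffAnn (j : A) : PairOp A := pairAnn (Sum.inl j) - pairAnn (Sum.inr j)

/-- The exchange of a single mode with its copy. -/
def modeSwap (j : A) : PairOp A := 1 - (diffAnn j)ᴴ * diffAnn j

theorem diffAnn_mul_self (j : A) : diffAnn j * diffAnn j = 0 := by
  apply eq_zero_of_eq_neg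
  rw [diffAnn, mul_sub, sub_mul, sub_mul, eq_zero_of_eq_neg (pairAnn_mul_pairAnn (Sum.inl j) _),
    eq_zero_of_eq_neg (pairAnn_mul_pairAnn (Sum.inr j) _),
    pairAnn_mul_pairAnn (Sum.inr j) (Sum.inl j)]
  abel

theorem diffAnn_mul_conjTranspose_add (j : A) :
    diffAnn j * (diffAnn j)ᴴ + (diffAnn j)ᴴ * diffAnn j = (2 : ℂ) • (1 : PairOp A) := by
  have h1 := pairAnn_mul_pairAnnH_add (Sum.inl j) (Sum.inl j)
  have h2 := pairAnn_mul_pairAnnH_add (Sum.inr j) (Sum.inr j)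
  have h3 := pairAnn_mul_pairAnnH_add (Sum.inl j) (Sum.inr j)
  have h4 := pairAnn_mul_pairAnnH_add (Sum.inr j) (Sum.inl j)
  rw [if_pos rfl] at h1 h2
  rw [if_neg (by simp)] at h3 h4
  rw [diffAnn, Matrix.conjTranspose_sub]
  set a := pairAnn (Sum.inl j)
  set b := pairAnn (Sum.inr j)
  have : (a - b) * (aᴴ - bᴴ) + (aᴴ - bᴴ) * (a - b) = (a * aᴴ + aᴴ * a) + (b * bᴴ + bᴴ * b)
      - (a * bᴴ + bᴴ * a) - (b * aᴴ + aᴴ * b) := by noncomm_ring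
  rw [this, h1, h2, h3, h4, two_smul]
  simp

theorem modeSwap_conjTranspose (j : A) : (modeSwap j)ᴴ = modeSwap j := by
  rw [modeSwap, Matrix.conjTranspose_sub, Matrix.conjTranspose_mul,
    Matrix.conjTranspose_conjTranspose, Matrix.conjTranspose_one]

theorem diffAnn_triple (j : A) :
    diffAnn j * ((diffAnn j)ᴴ * diffAnn j) = (2 : ℂ) • diffAnn j := by
  have h := congrArg (fun x => x * diffAnn j) (diffAnn_mul_conjTranspose_add j)
  simp only [add_mul, Matrix.smul_mul, one_mul] at h
  rwa [mul_assoc _ (diffAnn j) (diffAnn j), diffAnn_mul_self, mul_zero, add_zero, mul_assoc] at h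

/-- `(diffAnn j)ᴴ * diffAnn j` is twice a projection, because `diffAnn j` squares to zero and its
anticommutator with its adjoint is `2`. Thus `modeSwap j` is a reflection. -/
theorem modeSwap_mul_self (j : A) : modeSwap j * modeSwap j = 1 := by
  have h : (diffAnn j)ᴴ * diffAnn j * ((diffAnn j)ᴴ * diffAnn j)
      = (2 : ℂ) • ((diffAnn j)ᴴ * diffAnn j) := by
    rw [mul_assoc, diffAnn_triple, Matrix.mul_smul]
  rw [modeSwap, mul_sub, sub_mul, sub_mul, h, two_smul]
  simp only [one_mul, mul_one]
  abel

theorem modeSwap_mul_diffAnn (j : A) : modeSwap j * diffAnn j = -(diffAnn j * modeSwap j) := by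
  rw [modeSwap, sub_mul, mul_sub, mul_assoc, diffAnn_mul_self, diffAnn_triple, two_smul]
  noncomm_ring

theorem modeSwap_commute_sum (j : A) :
    Commute (modeSwap j) (pairAnn (Sum.inl j) + pairAnn (Sum.inr j)) := by
  refine (Commute.one_left _).sub_left (commute_of_anticomm ?_ ?_)
  · have h1 := pairAnn_mul_pairAnnH_add (Sum.inl j) (Sum.inl j)
    have h2 := pairAnn_mul_pairAnnH_add (Sum.inr j) (Sum.inr j)
    have h3 := pairAnn_mul_pairAnnH_add (Sum.inl j) (Sum.inr j)
    have h4 := pairAnn_mul_pairAnnH_add (Sum.inr j) (Sum.inl j)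
    rw [if_pos rfl] at h1 h2
    rw [if_neg (by simp)] at h3 h4
    rw [diffAnn, Matrix.conjTranspose_sub]
    set a := pairAnn (Sum.inl j)
    set b := pairAnn (Sum.inr j)
    have : (aᴴ - bᴴ) * (a + b) + (a + b) * (aᴴ - bᴴ) = (a * aᴴ + aᴴ * a) - (b * bᴴ + bᴴ * b)
      - (a * bᴴ + bᴴ * a) + (b * aᴴ + aᴴ * b) := by noncomm_ring
    rw [h1, h2, h3, h4] at this
    apply eq_neg_of_add_eq_zero_left
    rw [this]
    simp
  · have h1 := eq_zero_of_eq_neg (pairAnn_mul_pairAnn (Sum.inl j) (Sum.inl j))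
    have h2 := eq_zero_of_eq_neg (pairAnn_mul_pairAnn (Sum.inr j) (Sum.inr j))
    rw [diffAnn, mul_add, sub_mul, sub_mul, mul_sub, add_mul, add_mul, h1, h2,
      pairAnn_mul_pairAnn (Sum.inr j) (Sum.inl j)]
    abel

/-- `modeSwap j` commutes with the sum and anticommutes with the difference of the two annihilation
operators; adding these relations isolates one operator on each side. -/
theorem pairAnn_inl_mul_modeSwap (j : A) :
    pairAnn (Sum.inl j) * modeSwap j = modeSwap j * pairAnn (Sum.inr j) := by
  have h1 := (modeSwap_commute_sum j).eq
  have h2 := modeSwap_mul_diffAnn j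
  rw [diffAnn, mul_sub, sub_mul, neg_sub] at h2
  rw [mul_add, add_mul] at h1
  ext s t
  have h1' := congrFun (congrFun h1 s) t
  have h2' := congrFun (congrFun h2 s) t
  simp only [Matrix.add_apply, Matrix.sub_apply] at h1' h2'
  linear_combination (-1 / 2 : ℂ) * h1' + (1 / 2 : ℂ) * h2'

theorem pairAnn_inr_mul_modeSwap (j : A) :
    pairAnn (Sum.inr j) * modeSwap j = modeSwap j * pairAnn (Sum.inl j) := by
  have h1 := (modeSwap_commute_sum j).eq
  have h2 := modeSwap_mul_diffAnn j
  rw [diffAnn, mul_sub, sub_mul, neg_sub] at h2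
  rw [mul_add, add_mul] at h1
  ext s t
  have h1' := congrFun (congrFun h1 s) t
  have h2' := congrFun (congrFun h2 s) t
  simp only [Matrix.add_apply, Matrix.sub_apply] at h1' h2'
  linear_combination (-1 / 2 : ℂ) * h1' - (1 / 2 : ℂ) * h2'

theorem pairAnn_commute_modeSwap {j : A} {u : A ⊕ A} (hl : u ≠ Sum.inl j) (hr : u ≠ Sum.inr j) :
    pairAnn u * modeSwap j = modeSwap j * pairAnn u := by
  refine Eq.symm ((Commute.one_left _).sub_left (commute_of_anticomm ?_ ?_))
  · have h1 := pairAnn_mul_pairAnnH_add u (Sum.inl j)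
    have h2 := pairAnn_mul_pairAnnH_add u (Sum.inr j)
    rw [if_neg hl] at h1
    rw [if_neg hr] at h2
    rw [diffAnn, Matrix.conjTranspose_sub, sub_mul, mul_sub, eq_neg_of_add_eq_zero_left h1,
      eq_neg_of_add_eq_zero_left h2]
    abel
  · rw [diffAnn, sub_mul, mul_sub, pairAnn_mul_pairAnn u, pairAnn_mul_pairAnn u]
    abel

/-- A mode occurs at most once in the list, so its ladder operators are exchanged once or not at
all. -/
theorem pairAnn_mul_list_prod (l : List A) (hl : l.Nodup) (u : A ⊕ A) :
    pairAnn u * (l.map modeSwap).prod =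
      (l.map modeSwap).prod * pairAnn (if Sum.elim id id u ∈ l then u.swap else u) := by
  induction l generalizing u with
  | nil => simp
  | cons i l ih =>
    rw [List.nodup_cons] at hl
    rw [List.map_cons, List.prod_cons, ← mul_assoc]
    by_cases h : Sum.elim id id u = i
    · have h1 : pairAnn u * modeSwap i = modeSwap i * pairAnn u.swap := by
        rcases u with j | j
        · simp only [Sum.elim_inl, id_eq] at h
          rw [h, pairAnn_inl_mul_modeSwap, Sum.swap_inl]
        · simp only [Sum.elim_inr, id_eq] at h
          rw [h, pairAnn_inr_mul_modeSwap, Sum.swap_inr]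
      have h2 : Sum.elim id id u.swap = Sum.elim id id u := by
        rcases u with j | j <;> rfl
      have h3 := ih hl.2 (u := u.swap)
      rw [h2, h, if_neg hl.1] at h3
      rw [h1, mul_assoc, h3, ← mul_assoc, h, if_pos (List.mem_cons_self ..)]
    · have h1 : pairAnn u * modeSwap i = modeSwap i * pairAnn u := by
        refine pairAnn_commute_modeSwap ?_ ?_ <;> rintro rfl <;> exact h rfl
      rw [h1, mul_assoc, ih hl.2 u, ← mul_assoc]
      simp only [List.mem_cons, h, false_or]

theorem list_prod_unitary {n : Type*} [Fintype n] [DecidableEq n] (l : List (Matrix n n ℂ))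
    (h : ∀ x ∈ l, xᴴ * x = 1) : l.prodᴴ * l.prod = 1 := by
  induction l with
  | nil => simp
  | cons a l ih =>
    rw [List.prod_cons, Matrix.conjTranspose_mul, mul_assoc, ← mul_assoc aᴴ, h a (by simp), one_mul]
    exact ih fun x hx => h x (by simp [hx])

/-- Exchanging all modes one by one maps an even evolution of the first copy to the second. -/
theorem even_mul_modeSwaps (l : List A) (hl : l.Nodup) (hmem : ∀ j, j ∈ l) {X : FockOp A}
    (hX : par A * X = X * par A) :
    (X ⊗ₖ (1 : FockOp A)) * (l.map modeSwap).prod =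
      (l.map modeSwap).prod * ((1 : FockOp A) ⊗ₖ X) := by
  refine even_mul_of_swaps ?_ (fun j => ?_) (fun j => ?_) hX
  · refine list_prod_unitary _ fun x hx => ?_
    obtain ⟨j, -, rfl⟩ := List.mem_map.1 hx
    rw [modeSwap_conjTranspose, modeSwap_mul_self]
  · rw [pairAnn_mul_list_prod l hl, if_pos (hmem _), Sum.swap_inl]
  · rw [pairAnn_mul_list_prod l hl, if_pos (hmem _), Sum.swap_inr]

end Swap

/-! ### Local unitary gates for the evolved exchanges. -/

section Gates

/-- The reflection that is `-1` on the eigenspace of eigenvalue `1` of a Hermitian matrix. -/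
theorem exists_reflection {n : Type} [Fintype n] [DecidableEq n] {Y : Matrix n n ℂ}
    (hY : Y.IsHermitian) : ∃ W : Matrix n n ℂ, Wᴴ * W = 1 ∧ (∀ C, Commute Y C → Commute W C) ∧
      ∀ (m : Type) [Fintype m] [DecidableEq m] (J : Matrix n m ℂ) (Q : Matrix m m ℂ),
        Q * Q = Q → Y * J = J * Q → W * J = J * (1 - (2 : ℂ) • Q) := by
  set G : Matrix n n ℂ := (hY.eigenvectorUnitary : Matrix n n ℂ) with hG
  have hG1 : Gᴴ * G = 1 := Unitary.coe_star_mul_self hY.eigenvectorUnitary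
  have hG2 : G * Gᴴ = 1 := Unitary.coe_mul_star_self hY.eigenvectorUnitary
  set e : n → ℂ := fun i => (hY.eigenvalues i : ℂ) with he
  have hYe : Y = G * Matrix.diagonal e * Gᴴ := by
    have h := hY.spectral_theorem
    rw [Unitary.conjStarAlgAut_apply] at h
    exact h
  -- Applying this function of the eigenvalues gives a unitary even if `Y` has eigenvalues other
  -- than `0` and `1` away from the range of `J`.
  set w : n → ℂ := fun i => if e i = 1 then -1 else 1 with hw
  have hww : ∀ i, star (w i) * w i = 1 := by
    intro i
    simp only [hw]
    split_ifs <;> simp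
  have key : ∀ (m : Type) [Fintype m] [DecidableEq m] (Z : Matrix n m ℂ) (Z' : Matrix n m ℂ),
      Matrix.diagonal w * (Gᴴ * Z) = Gᴴ * Z' → G * Matrix.diagonal w * Gᴴ * Z = Z' := by
    intro m _ _ Z Z' h
    rw [Matrix.mul_assoc, Matrix.mul_assoc, h, ← Matrix.mul_assoc, hG2, Matrix.one_mul]
  have key' : ∀ (m : Type) [Fintype m] [DecidableEq m] (Z : Matrix n m ℂ) (Z' : Matrix n m ℂ),
      Y * Z = Z' → Matrix.diagonal e * (Gᴴ * Z) = Gᴴ * Z' := by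
    intro m _ _ Z Z' h
    rw [← h, hYe, Matrix.mul_assoc G, Matrix.mul_assoc G, ← Matrix.mul_assoc Gᴴ, hG1, Matrix.one_mul,
      Matrix.mul_assoc]
  refine ⟨G * Matrix.diagonal w * Gᴴ, ?_, fun C hC => ?_, fun m _ _ J Q hQ hJ => ?_⟩
  · have : (G * Matrix.diagonal w * Gᴴ)ᴴ * (G * Matrix.diagonal w * Gᴴ) =
        G * ((Matrix.diagonal w)ᴴ * ((Gᴴ * G) * Matrix.diagonal w)) * Gᴴ := by
      simp only [Matrix.conjTranspose_mul, Matrix.conjTranspose_conjTranspose, Matrix.mul_assoc]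
    rw [this, hG1, Matrix.one_mul, Matrix.diagonal_conjTranspose, Matrix.diagonal_mul_diagonal]
    have h1 : (fun i => star w i * w i) = fun _ => 1 := funext hww
    rw [h1, Matrix.diagonal_one, Matrix.mul_one, hG2]
  · have h1 := key' n (C * G) (C * Y * G) (by rw [← Matrix.mul_assoc, hC.eq])
    have h2 : C * Y * G = C * G * Matrix.diagonal e := by
      rw [hYe]
      simp only [Matrix.mul_assoc, hG1, Matrix.mul_one]
    rw [h2] at h1
    have h3 : Matrix.diagonal w * (Gᴴ * (C * G)) = Gᴴ * (C * G) * Matrix.diagonal w := by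
      ext i k
      have h := congrFun (congrFun h1 i) k
      rw [← Matrix.mul_assoc Gᴴ (C * G)] at h
      rw [Matrix.diagonal_mul, Matrix.mul_diagonal] at h ⊢
      -- An operator that commutes with `Y` has nonzero entries only between equal eigenvalues,
      -- where `w` also agrees.
      by_cases h0 : (Gᴴ * (C * G)) i k = 0
      · rw [h0, mul_zero, zero_mul]
      · rw [mul_comm] at h
        have hik : w i = w k := by simp only [hw, mul_left_cancel₀ h0 h]
        rw [hik, mul_comm]
    have h4 := key n (C * G) (C * G * Matrix.diagonal w) (by rw [h3, Matrix.mul_assoc])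
    have h5 := congrArg (fun x => x * Gᴴ) h4
    simp only [Matrix.mul_assoc, hG2, Matrix.mul_one] at h5
    simpa only [Commute, SemiconjBy, Matrix.mul_assoc] using h5
  · apply key m J
    have h1 := key' m J (J * Q) hJ
    rw [← Matrix.mul_assoc Gᴴ J] at h1 ⊢
    set K := Gᴴ * J
    have h2 : Matrix.diagonal e * (K * Q) = K * Q := by
      rw [← Matrix.mul_assoc, h1, Matrix.mul_assoc, hQ]
    rw [Matrix.mul_sub, Matrix.mul_one, Matrix.mul_smul]
    ext i k
    have e1 := congrFun (congrFun h1 i) k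
    have e2 := congrFun (congrFun h2 i) k
    rw [Matrix.diagonal_mul] at e1 e2
    rw [Matrix.diagonal_mul, Matrix.sub_apply, Matrix.smul_apply, smul_eq_mul]
    -- In the eigenbasis of `Y`, rows with eigenvalue `1` satisfy `K * Q = K`; in all other rows `K
    -- * Q` vanishes.
    by_cases hi : e i = 1
    · rw [hi, one_mul] at e1
      simp only [hw, hi, if_true]
      rw [← e1]
      ring
    · have h0 : (K * Q) i k = 0 := by
        have : (e i - 1) * (K * Q) i k = 0 := by rw [sub_mul, e2, one_mul, sub_self]
        exact (mul_eq_zero.1 this).resolve_left (sub_ne_zero.2 hi)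
      simp only [hw, hi, if_false]
      rw [h0]
      ring

variable {A : Type} [Fintype A] [LinearOrder A] {M : Type} [Fintype M] [LinearOrder M] {S : Type}
  {sd : A → S} {sq : M → S} {J : Matrix (M → Bool) ((A → Bool) × (A → Bool)) ℂ}

/-- A local reflection is represented by a local unitary. -/
theorem Represented.exists_gate {R : Set S} {Q : PairOp A} (h : Represented sq J R Q)
    (hQ : Q.IsHermitian) (hQQ : Q * Q = Q) :
    ∃ W : FockOp M, Wᴴ * W = 1 ∧ IsLoc sq R W ∧ W * J = J * (1 - (2 : ℂ) • Q) := by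
  obtain ⟨Y, h1, h2, h3⟩ := h.exists_isHermitian hQ
  obtain ⟨W, w1, w2, w3⟩ := exists_reflection h1
  exact ⟨W, w1, fun p hp => ⟨w2 _ (h2 p hp).1, w2 _ (h2 p hp).2⟩, w3 _ J Q hQQ h3⟩

theorem par_conj_ann {U : FockOp A} (hU : par A * U = U * par A) (j : A) :
    par A * (Uᴴ * ann j * U) = -(Uᴴ * ann j * U * par A) := by
  have hU' : par A * Uᴴ = Uᴴ * par A := by
    have := congrArg Matrix.conjTranspose hU
    rw [Matrix.conjTranspose_mul, Matrix.conjTranspose_mul, par_conjTranspose] at this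
    exact this.symm
  calc par A * (Uᴴ * ann j * U) = (par A * Uᴴ) * (ann j * U) := by simp only [mul_assoc]
    _ = Uᴴ * (par A * ann j) * U := by rw [hU']; simp only [mul_assoc]
    _ = -(Uᴴ * ann j * (par A * U)) := by
      rw [par_mul_ann]; simp only [mul_assoc, mul_neg, neg_mul]
    _ = _ := by rw [hU]; simp only [mul_assoc]

/-- An evolved exchange of a mode with its copy is represented by a local unitary. -/
theorem exists_modeSwap_gate {R : Set S} (hl : ∀ n ∈ R, ∀ m ∈ R, IsEncoding.Linked sd sq J R n m)
    {U : FockOp A} (hUU : Uᴴ * U = 1) (hU : par A * U = U * par A) {j : A} (hj : sd j ∈ R)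
    (hloc : Uᴴ * ann j * U ∈ Algebra.adjoin ℂ (siteLadders sd R)) :
    ∃ W : FockOp M, Wᴴ * W = 1 ∧ IsLoc sq R W ∧
      W * J = J * ((U ⊗ₖ (1 : FockOp A))ᴴ * modeSwap j * (U ⊗ₖ (1 : FockOp A))) := by
  set T : PairOp A := U ⊗ₖ (1 : FockOp A) with hT
  have hTT : Tᴴ * T = 1 := by
    rw [hT, Matrix.conjTranspose_kronecker, ← Matrix.mul_kronecker_mul, hUU,
      Matrix.conjTranspose_one, one_mul, Matrix.one_kronecker_one]
  have hTT' : T * Tᴴ = 1 := mul_eq_one_comm.1 hTT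
  set q : PairOp A := Tᴴ * diffAnn j * T with hq
  have e1 : Tᴴ * pairAnn (Sum.inl j) * T = (Uᴴ * ann j * U) ⊗ₖ (1 : FockOp A) := by
    rw [hT, pairAnn_inl, Matrix.conjTranspose_kronecker, Matrix.conjTranspose_one,
      ← Matrix.mul_kronecker_mul, ← Matrix.mul_kronecker_mul, one_mul, one_mul]
  -- The copy is unaffected because its annihilation operator involves the first copy only through
  -- `par A`, with which `U` commutes.
  have e2 : Tᴴ * pairAnn (Sum.inr j) * T = pairAnn (Sum.inr j) := by
    rw [hT, pairAnn_inr, Matrix.conjTranspose_kronecker, Matrix.conjTranspose_one,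
      ← Matrix.mul_kronecker_mul, ← Matrix.mul_kronecker_mul, one_mul, mul_one, mul_assoc, hU,
      ← mul_assoc, hUU, one_mul]
  have hqodd : OddRepresented sd sq J R q := by
    have : q = (Uᴴ * ann j * U) ⊗ₖ (1 : FockOp A) + (-1 : ℂ) • pairAnn (Sum.inr j) := by
      rw [hq, diffAnn, mul_sub, sub_mul, e1, e2, neg_one_smul, sub_eq_add_neg]
    rw [this]
    refine (oddRepresented_of_anticomm ⟨j, hj⟩ hl hloc (par_conj_ann hU j)).add
      (OddRepresented.smul _ ?_)
    exact IsPairLadder.oddRepresented hl (u := Sum.inr j) (Or.inl rfl) hj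
  -- The factor `1 / 2` compensates the anticommutator `2` of `diffAnn j`, making this a projection.
  have hrep : Represented sq J R ((1 / 2 : ℂ) • (qᴴ * q)) :=
    (hqodd.conjTranspose.mul ⟨j, hj⟩ hqodd).smul _
  have hqq : qᴴ * q = Tᴴ * ((diffAnn j)ᴴ * diffAnn j) * T := by
    have : qᴴ * q = Tᴴ * (diffAnn j)ᴴ * (T * Tᴴ) * diffAnn j * T := by
      rw [hq]
      simp only [Matrix.conjTranspose_mul, Matrix.conjTranspose_conjTranspose, mul_assoc]
    rw [this, hTT', mul_one]
    simp only [mul_assoc]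
  have hherm : ((1 / 2 : ℂ) • (qᴴ * q)).IsHermitian := by
    rw [Matrix.IsHermitian, Matrix.conjTranspose_smul, Matrix.conjTranspose_mul,
      Matrix.conjTranspose_conjTranspose]
    simp
  have hidem : (1 / 2 : ℂ) • (qᴴ * q) * ((1 / 2 : ℂ) • (qᴴ * q)) = (1 / 2 : ℂ) • (qᴴ * q) := by
    have h3 : qᴴ * q * (qᴴ * q) = (2 : ℂ) • (qᴴ * q) := by
      have : qᴴ * q * (qᴴ * q) =
          Tᴴ * (diffAnn j)ᴴ * diffAnn j * (T * Tᴴ) * ((diffAnn j)ᴴ * diffAnn j) * T := by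
        rw [hqq]
        simp only [mul_assoc]
      rw [this, hTT', mul_one, mul_assoc (Tᴴ * (diffAnn j)ᴴ), diffAnn_triple, hqq, Matrix.mul_smul,
        Matrix.smul_mul]
      simp only [mul_assoc]
    rw [Matrix.smul_mul, Matrix.mul_smul, h3, smul_smul, smul_smul]
    norm_num
  obtain ⟨W, w1, w2, w3⟩ := hrep.exists_gate hherm hidem
  refine ⟨W, w1, w2, ?_⟩
  rw [w3, smul_smul, modeSwap, mul_sub, sub_mul, mul_one, hTT, hqq]
  norm_num

/-- The modes of a site. -/
def modesAt [DecidableEq S] (sd : A → S) (n : S) : List A :=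
  (Finset.univ.filter (sd · = n)).toList

theorem list_prod_mul_eq {n m : Type*} [Fintype n] [DecidableEq n] [Fintype m] [DecidableEq m]
    {ι : Type*} (J : Matrix n m ℂ) (W : ι → Matrix n n ℂ) (X : ι → Matrix m m ℂ)
    (h : ∀ i, W i * J = J * X i) (l : List ι) : (l.map W).prod * J = J * (l.map X).prod := by
  induction l with
  | nil => simp
  | cons a l ih =>
    rw [List.map_cons, List.map_cons, List.prod_cons, List.prod_cons, Matrix.mul_assoc, ih,
      ← Matrix.mul_assoc, h, Matrix.mul_assoc]

theorem conj_list_prod {n : Type*} [Fintype n] [DecidableEq n] {ι : Type*} {T : Matrix n n ℂ}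
    (hT : Tᴴ * T = 1) (X : ι → Matrix n n ℂ) (l : List ι) :
    (l.map fun i => Tᴴ * X i * T).prod = Tᴴ * (l.map X).prod * T := by
  have hT' : T * Tᴴ = 1 := mul_eq_one_comm.1 hT
  induction l with
  | nil => simp [hT]
  | cons a l ih =>
    have : Tᴴ * X a * T * (Tᴴ * (l.map X).prod * T) = Tᴴ * X a * (T * Tᴴ) * (l.map X).prod * T := by
      simp only [mul_assoc]
    rw [List.map_cons, List.map_cons, List.prod_cons, List.prod_cons, ih, this, hT', mul_one]
    simp only [mul_assoc]

theorem list_prod_map_flatMap {R ι κ : Type*} [Monoid R] (f : ι → R) (g : κ → List ι)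
    (l : List κ) : ((l.flatMap g).map f).prod = (l.map fun k => ((g k).map f).prod).prod := by
  induction l with
  | nil => simp
  | cons a l ih => simp [ih]

/-- The gates, one for each site, that represent the evolved exchange of the two copies. -/
theorem exists_site_gates [DecidableEq S] (R : S → Set S) (hself : ∀ n, n ∈ R n)
    (hl : ∀ k, ∀ n ∈ R k, ∀ m ∈ R k, IsEncoding.Linked sd sq J (R k) n m)
    {U : FockOp A} (hUU : Uᴴ * U = 1) (hU : par A * U = U * par A)
    (hloc : ∀ j, Uᴴ * ann j * U ∈ Algebra.adjoin ℂ (siteLadders sd (R (sd j)))) :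
    ∃ W : S → FockOp M, (∀ n, (W n)ᴴ * W n = 1) ∧ (∀ n, IsLoc sq (R n) (W n)) ∧
      ∀ l : List S, (l.map W).prod * J = J * ((U ⊗ₖ (1 : FockOp A))ᴴ *
        ((l.flatMap (modesAt sd)).map modeSwap).prod * (U ⊗ₖ (1 : FockOp A))) := by
  have hTT : (U ⊗ₖ (1 : FockOp A))ᴴ * (U ⊗ₖ (1 : FockOp A)) = 1 := by
    rw [Matrix.conjTranspose_kronecker, ← Matrix.mul_kronecker_mul, hUU,
      Matrix.conjTranspose_one, one_mul, Matrix.one_kronecker_one]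
  choose G g1 g2 g3 using fun j => exists_modeSwap_gate (hl (sd j)) hUU hU (hself (sd j)) (hloc j)
  refine ⟨fun n => ((modesAt sd n).map G).prod, fun n => ?_, fun n => ?_, fun l => ?_⟩
  · refine list_prod_unitary _ fun x hx => ?_
    obtain ⟨j, -, rfl⟩ := List.mem_map.1 hx
    exact g1 j
  · refine IsLoc.list_prod fun x hx => ?_
    obtain ⟨j, hj, rfl⟩ := List.mem_map.1 hx
    rw [modesAt, Finset.mem_toList, Finset.mem_filter] at hj
    rw [← hj.2]
    exact g2 j
  · rw [← list_prod_map_flatMap, list_prod_mul_eq J G _ g3, conj_list_prod hTT]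

end Gates

/-! ### Distances, colourings and paths in the lattice. -/

section Geometry

theorem coordDist_comm {m : ℕ} (per : Bool) (a b : Fin m) :
    coordDist per a b = coordDist per b a := by
  simp only [coordDist, Nat.dist]
  split_ifs <;> omega

theorem coordDist_triangle {m : ℕ} (per : Bool) (a b c : Fin m) :
    coordDist per a c ≤ coordDist per a b + coordDist per b c := by
  simp only [coordDist, Nat.dist]
  split_ifs <;> omega

/-- The colour of a point of a line, such that points of the same colour have distance at least
`w`: the residue modulo `w`, with separate colours for the last, incomplete block. -/
def coordColor {m : ℕ} (w : ℕ) (a : Fin m) : ℕ := if (a : ℕ) < w * (m / w) then a % w else w + a % w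

theorem coordColor_lt {m w : ℕ} (hw : 0 < w) (a : Fin m) : coordColor w a < 2 * w := by
  have := Nat.mod_lt (a : ℕ) hw
  rw [coordColor]
  split_ifs <;> omega

/-- Two points of equal residue in complete blocks are at least `w` apart directly, and also around
the circle, since there are only `m / w` such blocks. In the incomplete block the residue determines
the point. -/
theorem le_coordDist_of_coordColor {m w : ℕ} (hw : 0 < w) (per : Bool) (a b : Fin m)
    (h : coordColor w a = coordColor w b) (hab : a ≠ b) : w ≤ coordDist per a b := by
  have hab' : (a : ℕ) ≠ b := fun h => hab (Fin.ext h)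
  have h1 := Nat.mod_lt (a : ℕ) hw
  have h2 := Nat.mod_lt (b : ℕ) hw
  have h3 := Nat.div_add_mod (a : ℕ) w
  have h4 := Nat.div_add_mod (b : ℕ) w
  have h5 := Nat.mul_div_le m w
  have h6 := Nat.div_add_mod m w
  have h7 := Nat.mod_lt m hw
  have h8 := a.isLt
  have h9 := b.isLt
  have hstep : ∀ x y : ℕ, x < y → w * x + w ≤ w * y := by
    intro x y hxy
    have := Nat.mul_le_mul_left w (Nat.succ_le_of_lt hxy)
    rwa [Nat.succ_eq_add_one, mul_add, mul_one] at this
  have hlt : ∀ x y : ℕ, w * x < w * y + w → x ≤ y := by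
    intro x y hxy
    by_contra hc
    have := hstep y x (by omega)
    omega
  rw [coordColor, coordColor] at h
  by_cases ha : (a : ℕ) < w * (m / w) <;> by_cases hb : (b : ℕ) < w * (m / w)
  · rw [if_pos ha, if_pos hb] at h
    have hne : (a : ℕ) / w ≠ (b : ℕ) / w := by
      intro hc
      rw [hc] at h3
      omega
    have ha' := hstep _ _ (Nat.lt_of_mul_lt_mul_left (a := w) (b := (a : ℕ) / w) (c := m / w) (by omega))
    have hb' := hstep _ _ (Nat.lt_of_mul_lt_mul_left (a := w) (b := (b : ℕ) / w) (c := m / w) (by omega))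
    have hs : w * ((a : ℕ) / w) + w ≤ w * ((b : ℕ) / w) ∨
        w * ((b : ℕ) / w) + w ≤ w * ((a : ℕ) / w) := by
      rcases lt_or_gt_of_ne hne with hc | hc
      · exact Or.inl (hstep _ _ hc)
      · exact Or.inr (hstep _ _ hc)
    simp only [coordDist, Nat.dist]
    split_ifs <;> omega
  · rw [if_pos ha, if_neg hb] at h
    omega
  · rw [if_neg ha, if_pos hb] at h
    omega
  · rw [if_neg ha, if_neg hb] at h
    have e1 : (a : ℕ) / w ≤ m / w := hlt _ _ (by omega)
    have e2 : (b : ℕ) / w ≤ m / w := hlt _ _ (by omega)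
    have e3 : m / w ≤ (a : ℕ) / w := hlt _ _ (by omega)
    have e4 : m / w ≤ (b : ℕ) / w := hlt _ _ (by omega)
    have e5 : (a : ℕ) / w = (b : ℕ) / w := by omega
    rw [e5] at h3
    omega

theorem val_finRotate {n : ℕ} (a : Fin (n + 1)) :
    (finRotate (n + 1) a : ℕ) = if (a : ℕ) = n then (0 : ℕ) else (a : ℕ) + 1 := by
  rw [coe_finRotate]
  simp only [Fin.ext_iff, Fin.val_last]

/-- A neighbour of `a` that is closer to `b`. -/
theorem exists_closer {m : ℕ} (per : Bool) (a b : Fin m) (hab : a ≠ b) :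
    ∃ a', (a' = finRotate m a ∨ a = finRotate m a') ∧ coordDist per b a' < coordDist per b a := by
  obtain ⟨n, rfl⟩ : ∃ n, m = n + 1 := ⟨m - 1, by have := a.isLt; omega⟩
  have hab' : (a : ℕ) ≠ b := fun h => hab (Fin.ext h)
  have ha := a.isLt
  have hb := b.isLt
  have hup := val_finRotate a
  obtain ⟨a', ha'⟩ : ∃ a', finRotate (n + 1) a' = a := (finRotate (n + 1)).surjective a
  have hdown := val_finRotate a'
  have ha'' := a'.isLt
  rw [ha'] at hdown
  generalize finRotate (n + 1) a = a₁ at hup ⊢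
  -- At least one of the two cyclic neighbours is closer to `b`. In an open direction it may lie
  -- across the boundary; this is harmless, since a link is used through its two endpoints only.
  by_cases h : coordDist per b a' < coordDist per b a
  · exact ⟨a', Or.inr ha'.symm, h⟩
  · refine ⟨_, Or.inl rfl, ?_⟩
    have ha₁ := a₁.isLt
    simp only [coordDist, Nat.dist] at h ⊢
    generalize (a : ℕ) = x at *
    generalize (a' : ℕ) = y at *
    generalize (a₁ : ℕ) = z at *
    generalize (b : ℕ) = w at *
    split_ifs at hup hdown h ⊢ <;> omega

variable {d : ℕ} {N : Fin d → ℕ} (per : Fin d → Bool)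

theorem siteDist_comm (n m : Site N) : siteDist per n m = siteDist per m n := by
  simp only [siteDist, coordDist_comm]

theorem coordDist_le_siteDist (n m : Site N) (i : Fin d) :
    coordDist (per i) (ofLex n i) (ofLex m i) ≤ siteDist per n m :=
  Finset.le_sup (f := fun i => coordDist (per i) (ofLex n i) (ofLex m i)) (Finset.mem_univ i)

theorem siteDist_triangle (n m l : Site N) :
    siteDist per n l ≤ siteDist per n m + siteDist per m l :=
  Finset.sup_le fun i _ => (coordDist_triangle _ _ _ _).trans
    (add_le_add (coordDist_le_siteDist per n m i) (coordDist_le_siteDist per m l i))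

theorem siteDist_self (n : Site N) : siteDist per n n = 0 := by
  refine Nat.le_zero.1 (Finset.sup_le fun i _ => ?_)
  simp only [coordDist, Nat.dist]
  split_ifs <;> omega

theorem coordDist_eq_zero {m : ℕ} {per : Bool} {a b : Fin m} (h : coordDist per a b = 0) :
    a = b := by
  have ha := a.isLt
  have hb := b.isLt
  apply Fin.ext
  simp only [coordDist, Nat.dist] at h
  split_ifs at h <;> omega

theorem siteBall_zero (n : Site N) : siteBall per n 0 = {n} := by
  ext m
  simp only [siteBall, Set.mem_ofPred_eq, Set.mem_singleton_iff]
  constructor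
  · intro h
    apply ofLex.injective
    funext i
    have := (coordDist_le_siteDist per n m i).trans h
    exact (coordDist_eq_zero (Nat.le_zero.1 this)).symm
  · rintro rfl
    exact (siteDist_self per m).le

/-- A colouring of the lattice such that distinct sites of the same colour have distance more than
`2 * L`. -/
def siteColor (L : ℕ) (n : Site N) : Fin d → Fin (2 * (2 * L + 1)) :=
  fun i => ⟨coordColor (2 * L + 1) (ofLex n i), coordColor_lt (Nat.succ_pos _) _⟩

theorem lt_siteDist_of_siteColor (L : ℕ) (n m : Site N) (h : siteColor L n = siteColor L m)
    (hnm : n ≠ m) : 2 * L < siteDist per n m := by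
  obtain ⟨i, hi⟩ := Function.ne_iff.1 (fun h => hnm (ofLex.injective h) : ofLex n ≠ ofLex m)
  have h1 := le_coordDist_of_coordColor (w := 2 * L + 1) (Nat.succ_pos _) (per i) (ofLex n i)
    (ofLex m i) (Fin.ext_iff.1 (congrFun h i)) hi
  exact lt_of_lt_of_le (Nat.lt_of_succ_le h1) (coordDist_le_siteDist per n m i)

/-- The cyclic shift of the lattice by one site in direction `i`. -/
def siteShift (i : Fin d) : Equiv.Perm (Site N) :=
  ofLex.trans ((Equiv.piCongrRight fun j => if j = i then finRotate (N j) else Equiv.refl _).trans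
    toLex)

/-- Neighbouring sites, the boundary conditions being read as periodic. -/
def neighbor (n m : Site N) : Prop := ∃ i, siteShift i n = m

theorem eq_siteShift {n m : Site N} {i : Fin d} (h1 : ofLex m i = finRotate (N i) (ofLex n i))
    (h2 : ∀ j, j ≠ i → ofLex m j = ofLex n j) : siteShift i n = m := by
  apply ofLex.injective
  funext j
  show (if j = i then finRotate (N j) else Equiv.refl _) (ofLex n j) = ofLex m j
  by_cases hj : j = i
  · subst hj
    rw [if_pos rfl, h1]
  · rw [if_neg hj, h2 j hj]
    rfl

/-- A neighbour of `m` that is closer to `n`. -/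
theorem exists_neighbor_closer (n m : Site N) (hnm : m ≠ n) :
    ∃ m', (neighbor m m' ∨ neighbor m' m) ∧ siteDist per n m' ≤ siteDist per n m ∧
      ∑ i, coordDist (per i) (ofLex n i) (ofLex m' i)
        < ∑ i, coordDist (per i) (ofLex n i) (ofLex m i) := by
  obtain ⟨i, hi⟩ := Function.ne_iff.1 (fun h => hnm (ofLex.injective h) : ofLex m ≠ ofLex n)
  obtain ⟨a, ha, hlt⟩ := exists_closer (per i) (ofLex m i) (ofLex n i) hi
  let m' : Site N := toLex (Function.update (ofLex m) i a)
  have h1 : ofLex m' i = a := by simp [m']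
  have h2 : ∀ j, j ≠ i → ofLex m' j = ofLex m j := by
    intro j hj
    simp [m', hj]
  have hle : ∀ j, coordDist (per j) (ofLex n j) (ofLex m' j)
      ≤ coordDist (per j) (ofLex n j) (ofLex m j) := by
    intro j
    by_cases hj : j = i
    · subst hj
      rw [h1]
      exact hlt.le
    · rw [h2 j hj]
  refine ⟨m', ?_, ?_, ?_⟩
  · rcases ha with ha | ha
    · exact Or.inl ⟨i, eq_siteShift (by rw [h1, ha]) h2⟩
    · exact Or.inr ⟨i, eq_siteShift (by rw [h1, ha]) fun j hj => (h2 j hj).symm⟩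
  · exact Finset.sup_mono_fun fun j _ => hle j
  · refine Finset.sum_lt_sum (fun j _ => hle j) ⟨i, Finset.mem_univ i, ?_⟩
    rw [h1]
    exact hlt

/-- Ladder operators on the sites of a ball are linked through paths within the ball. -/
theorem IsEncoding.linked_siteBall {A M : Type} [Fintype A] [LinearOrder A] [Fintype M]
    [LinearOrder M] {sd : A → Site N} {sq : M → Site N}
    {J : Matrix (M → Bool) ((A → Bool) × (A → Bool)) ℂ} (h : IsEncoding sd sq neighbor J)
    (hsd : ∀ n, ∃ j, sd j = n) (n : Site N) (r : ℕ) :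
    ∀ m ∈ siteBall per n r, ∀ l ∈ siteBall per n r,
      Linked sd sq J (siteBall per n r) m l := by
  -- Induction on the sum of the coordinate distances to the centre: a suitable step decreases the
  -- sum without increasing the maximum, so the path never leaves the ball.
  have key : ∀ (k : ℕ) (m : Site N), m ∈ siteBall per n r →
      ∑ i, coordDist (per i) (ofLex n i) (ofLex m i) = k →
      Linked sd sq J (siteBall per n r) m n := by
    intro k
    induction k using Nat.strong_induction_on with
    | _ k ih =>
      intro m hm hk
      by_cases hnm : m = n
      · subst hnm
        exact h.linked_self hm
      · obtain ⟨m', h1, h2, h3⟩ := exists_neighbor_closer per n m hnm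
        have hm' : m' ∈ siteBall per n r := h2.trans hm
        refine Linked.trans (hsd m') ?_ (ih _ (hk ▸ h3) m' hm' rfl)
        rcases h1 with h1 | h1
        · exact h.linked_of_link hm hm' h1
        · exact (h.linked_of_link hm' hm h1).symm
  exact fun m hm l hl => (key _ m hm rfl).trans (hsd n) (key _ l hl rfl).symm

end Geometry

/-! ### The causal evolution and the stationary state of the copy. -/

section Evolution

theorem nodup_flatMap_fibers {α κ : Type*} [Fintype α] [DecidableEq κ] (f : α → κ) (cs : List κ)
    (hcs : cs.Nodup) : (cs.flatMap fun c => (Finset.univ.filter (f · = c)).toList).Nodup := by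
  rw [List.nodup_flatMap]
  refine ⟨fun c _ => Finset.nodup_toList _, hcs.imp fun {a b} hab => ?_⟩
  intro x ha hb
  rw [Finset.mem_toList, Finset.mem_filter] at ha hb
  exact hab (ha.2.symm.trans hb.2)

theorem mem_flatMap_fibers {α κ : Type*} [Fintype α] [DecidableEq κ] (f : α → κ) (cs : List κ)
    (hcs : ∀ c, c ∈ cs) (x : α) :
    x ∈ cs.flatMap fun c => (Finset.univ.filter (f · = c)).toList := by
  rw [List.mem_flatMap]
  exact ⟨f x, hcs _, by simp⟩

theorem isLoc_conj_of_pointwise {M S : Type} [Fintype M] [DecidableEq M] {sq : M → S}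
    (W : S → FockOp M) (hu : ∀ n, (W n)ᴴ * W n = 1) (hW : ∀ n, IsLoc sq {n} (W n)) (l : List S)
    (hl : l.Nodup) (n : S) {X : FockOp M} (hX : IsLoc sq {n} X) :
    IsLoc sq {n} ((l.map W).prodᴴ * X * (l.map W).prod) := by
  refine IsLoc.conj_list_of_disjoint W (fun m => {m}) hu hW l {n} X ?_ subset_rfl ?_ hX
  · exact hl.imp fun {a b} hab => Set.disjoint_singleton.2 hab
  · intro i _ hi
    rw [Set.disjoint_singleton, not_not] at hi
    rw [hi]

theorem unitary_mul_of_mul {n m : Type*} [Fintype n] [DecidableEq n] [Fintype m] [DecidableEq m]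
    {J : Matrix n m ℂ} {W : Matrix n n ℂ} {X : Matrix m m ℂ} (hW : Wᴴ * W = 1) (hX : Xᴴ * X = 1)
    (h : W * J = J * X) : Wᴴ * J = J * Xᴴ := by
  calc Wᴴ * J = Wᴴ * (J * X) * Xᴴ := by
        rw [Matrix.mul_assoc, Matrix.mul_assoc, mul_eq_one_comm.1 hX, Matrix.mul_one]
    _ = J * Xᴴ := by rw [← h, ← Matrix.mul_assoc, hW, Matrix.one_mul]

variable {A : Type} [Fintype A] [LinearOrder A] {M : Type} [Fintype M] [LinearOrder M] {S : Type}
  [Fintype S] [DecidableEq S] {sd : A → S} {sq : M → S}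
  {J : Matrix (M → Bool) ((A → Bool) × (A → Bool)) ℂ}

/-- The evolution of the fermions, together with the inverse evolution of their copy, is
represented by a causal evolution. -/
theorem exists_causal_evolution (dist : S → S → ℕ) (hself : ∀ n, dist n n = 0)
    (hsymm : ∀ n m, dist n m = dist m n)
    (htri : ∀ n m l, dist n l ≤ dist n m + dist m l) (hzero : ∀ n m, dist n m ≤ 0 → n = m)
    (hl : ∀ n r m, dist n m ≤ r → ∀ l, dist n l ≤ r →
      IsEncoding.Linked sd sq J {x | dist n x ≤ r} m l)
    {κ : Type} [Fintype κ] [DecidableEq κ] (color : S → κ) (L : ℕ)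
    (hcol : ∀ n m, color n = color m → n ≠ m → 2 * L < dist n m)
    {U : FockOp A} (hUU : Uᴴ * U = 1) (hU : par A * U = U * par A)
    (hloc : ∀ j, Uᴴ * ann j * U ∈ Algebra.adjoin ℂ (siteLadders sd {m | dist (sd j) m ≤ L})) :
    ∃ V : FockOp M, Vᴴ * V = 1 ∧
      (∀ (n : S) (X : FockOp M), IsLoc sq {n} X →
        IsLoc sq {m | dist n m ≤ 2 * L * Fintype.card κ} (Vᴴ * X * V)) ∧
      V * J = J * (U ⊗ₖ Uᴴ) := by
  set cs : List κ := Finset.univ.toList with hcs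
  set l : List S := cs.flatMap fun c => (Finset.univ.filter (color · = c)).toList with hl'
  have hnodup : l.Nodup := nodup_flatMap_fibers color cs (Finset.nodup_toList _)
  have hmem : ∀ n, n ∈ l := mem_flatMap_fibers color cs (by simp [hcs])
  set T : PairOp A := ((l.flatMap (modesAt sd)).map modeSwap).prod with hT
  have hTT : Tᴴ * T = 1 := by
    refine list_prod_unitary _ fun x hx => ?_
    obtain ⟨j, -, rfl⟩ := List.mem_map.1 hx
    rw [modeSwap_conjTranspose, modeSwap_mul_self]
  obtain ⟨W, w1, w2, w3⟩ := exists_site_gates (sd := sd) (sq := sq) (J := J)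
    (fun n => {m | dist n m ≤ L}) (fun n => by simp [hself]) (fun n m hm k hk => hl n L m hm k hk)
    hUU hU hloc
  have hball : ∀ n, {m | dist n m ≤ 0} = ({n} : Set S) := by
    intro n
    ext m
    simp only [Set.mem_ofPred_eq, Set.mem_singleton_iff]
    constructor
    · exact fun h => (hzero n m h).symm
    · rintro rfl
      exact (hself m).le
  -- The case `U = 1` with single sites as regions represents the unevolved exchange `T` by gates on
  -- one site each.
  obtain ⟨W', w1', w2', w3'⟩ := exists_site_gates (sd := sd) (sq := sq) (J := J)
    (fun n => ({n} : Set S)) (fun n => rfl) (fun n m hm k hk => by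
      have := hl n 0 m (by rw [hm, hself]) k (by rw [hk, hself])
      rwa [hball] at this) (U := 1) (by simp) (by simp) (fun j => by
      rw [Matrix.conjTranspose_one, one_mul, mul_one]
      exact Algebra.subset_adjoin ⟨j, rfl, Or.inl rfl⟩)
  have hWu : (l.map W).prodᴴ * (l.map W).prod = 1 := by
    refine list_prod_unitary _ fun x hx => ?_
    obtain ⟨j, -, rfl⟩ := List.mem_map.1 hx
    exact w1 j
  have hWu' : (l.map W').prodᴴ * (l.map W').prod = 1 := by
    refine list_prod_unitary _ fun x hx => ?_
    obtain ⟨j, -, rfl⟩ := List.mem_map.1 hx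
    exact w1' j
  have hJ' : (l.map W').prodᴴ * J = J * Tᴴ := by
    refine unitary_mul_of_mul hWu' hTT ?_
    rw [w3' l, Matrix.one_kronecker_one, Matrix.conjTranspose_one, one_mul, mul_one]
  -- Written as a product of gates in reverse order, the adjoint is again covered by
  -- `isLoc_conj_of_pointwise`.
  have hrev : (l.map W').prodᴴ = (l.reverse.map fun n => (W' n)ᴴ).prod := by
    rw [Matrix.conjTranspose_list_prod, List.map_map, List.map_reverse]
    rfl
  -- On the range of `J` this is `Tᴴ * ((U ⊗ 1)ᴴ * T * (U ⊗ 1))`. The first factor does not spread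
  -- supports, so the range comes from the coloured layers of `W` alone.
  refine ⟨(l.map W').prodᴴ * (l.map W).prod, ?_, fun n X hX => ?_, ?_⟩
  · rw [Matrix.conjTranspose_mul, Matrix.conjTranspose_conjTranspose, mul_assoc,
      ← mul_assoc (l.map W').prod, mul_eq_one_comm.1 hWu', one_mul, hWu]
  · have h1 : IsLoc sq {m | dist n m ≤ 0} ((l.map W').prodᴴᴴ * X * (l.map W').prodᴴ) := by
      rw [hball, hrev]
      exact isLoc_conj_of_pointwise _ (fun m => by
        rw [Matrix.conjTranspose_conjTranspose, mul_eq_one_comm.1 (w1' m)])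
        (fun m => (w2' m).conjTranspose) _ (List.nodup_reverse.2 hnodup) n hX
    have h2 := IsLoc.conj_layers dist hsymm htri color L hcol W w1 w2 n cs 0 _ h1
    have e : ((l.map W').prodᴴ * (l.map W).prod)ᴴ * X * ((l.map W').prodᴴ * (l.map W).prod)
        = (l.map W).prodᴴ * ((l.map W').prodᴴᴴ * X * (l.map W').prodᴴ) * (l.map W).prod := by
      rw [Matrix.conjTranspose_mul]
      simp only [mul_assoc]
    rw [e]
    have hlen : cs.length = Fintype.card κ := by
      rw [hcs, Finset.length_toList, Finset.card_univ]
    rwa [hlen, zero_add] at h2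
  · have hU' : par A * Uᴴ = Uᴴ * par A := by
      have := congrArg Matrix.conjTranspose hU
      rw [Matrix.conjTranspose_mul, Matrix.conjTranspose_mul, par_conjTranspose] at this
      exact this.symm
    have hswap : (Uᴴ ⊗ₖ (1 : FockOp A)) * T = T * ((1 : FockOp A) ⊗ₖ Uᴴ) :=
      even_mul_modeSwaps _ (nodup_flatMap_fibers sd l hnodup) (mem_flatMap_fibers sd l hmem) hU'
    rw [Matrix.mul_assoc, w3 l, ← Matrix.mul_assoc, hJ', Matrix.mul_assoc,
      Matrix.conjTranspose_kronecker, Matrix.conjTranspose_one, hswap, mul_assoc, ← mul_assoc Tᴴ, hTT,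
      one_mul, ← Matrix.mul_kronecker_mul, one_mul, mul_one]

-- For an eigenvector `v` of the unitary `U`, applying `Uᴴ` to `U v = z • v` gives `z • Uᴴ v = v`;
-- preservation of the inner product forces `z` onto the unit circle.
open scoped ComplexOrder in
theorem exists_unit_eigenvector {n : Type} [Fintype n] [DecidableEq n] [Nonempty n]
    {U : Matrix n n ℂ} (hU : Uᴴ * U = 1) : ∃ (z : ℂ) (v : n → ℂ), ‖z‖ = 1 ∧ ∑ i, ‖v i‖ ^ 2 = 1 ∧
      (z • Uᴴ).mulVec v = v := by
  obtain ⟨z, hz⟩ := Module.End.exists_eigenvalue (Matrix.toLin' U)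
  obtain ⟨v, hv⟩ := hz.exists_hasEigenvector
  have hv1 : U.mulVec v = z • v := by
    have := hv.apply_eq_smul
    rwa [Matrix.toLin'_apply] at this
  obtain ⟨c, hc0, hc⟩ := exists_smul_unit hv.2
  have e1 : Uᴴ.mulVec (z • v) = v := by
    rw [← hv1, Matrix.mulVec_mulVec, hU, Matrix.one_mulVec]
  have hzz : star z * z = 1 := by
    have h1 : star (U.mulVec v) ⬝ᵥ U.mulVec v = star v ⬝ᵥ v := by
      rw [Matrix.star_mulVec, ← Matrix.dotProduct_mulVec, Matrix.mulVec_mulVec, hU,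
        Matrix.one_mulVec]
    rw [hv1, star_smul, smul_dotProduct, dotProduct_smul, smul_smul, smul_eq_mul] at h1
    have h0 : star v ⬝ᵥ v ≠ 0 := by
      intro h
      exact hv.2 (dotProduct_star_self_eq_zero.1 h)
    exact mul_right_cancel₀ h0 (by rw [h1, one_mul])
  refine ⟨z, c • v, ?_, hc, ?_⟩
  · have : (‖z‖ ^ 2 : ℝ) = 1 := by
      have h := hzz
      rw [Complex.star_def, ← Complex.normSq_eq_conj_mul_self, Complex.normSq_eq_norm_sq] at h
      exact_mod_cast h
    nlinarith [norm_nonneg z]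
  · rw [Matrix.mulVec_smul, Matrix.smul_mulVec, ← Matrix.mulVec_smul, e1]

theorem sector_eq {A B C : Type} [Fintype B] [DecidableEq B] [Fintype C] (J : Matrix A (B × C) ℂ)
    (φ : C → ℂ) : sector J φ = J * kronCol B φ := by
  ext s t
  simp only [sector, Matrix.mul_apply, kronCol, Fintype.sum_prod_type, mul_ite, mul_zero]
  rw [Finset.sum_comm]
  simp

end Evolution

/-! ### Compatibility of the equality tests carried by linear orders. -/

section Instances

/-- A linear order with another decision procedure for equality. -/
@[reducible] def withDecidableEq {α : Type} (o : LinearOrder α) (e : DecidableEq α) : LinearOrder α :=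
  { o with
    toDecidableEq := e
    compare_eq_compareOfLessAndEq := by
      intro a b
      rw [o.compare_eq_compareOfLessAndEq]
      unfold compareOfLessAndEq
      congr! }

/-- The finite type of configurations depends on an equality test for modes, so the order must carry
the test used in the matrix types. The annihilation operators do not depend on it. -/
theorem ann_withDecidableEq {M : Type} [Fintype M] (o : LinearOrder M) (e : DecidableEq M) (j : M) :
    @ann M _ (withDecidableEq o e) j = @ann M _ o j := by
  funext s t
  unfold ann
  congr!

end Instances

/-! ### The encoding of the lattice system. -/

section LatticeEncoding

theorem exists_isEncoding {A B M S : Type} [Fintype A] [LinearOrder A] [Fintype B] [LinearOrder B]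
    [Fintype M] [LinearOrder M] (sd : A → S) (sb : B → S) (sq : M → S) (link : S → S → Prop)
    (hord : ∀ p i j, sq i = sq j → sq p ≠ sq i → (p < i ↔ p < j))
    (e : (A ⊕ₗ A) ⊕ₗ B ≃ M) (hea : ∀ u : A ⊕ A, sq (e (Sum.inlₗ (toLex u))) = sd (Sum.elim id id u))
    (heb : ∀ b, sq (e (Sum.inrₗ b)) = sb b) (τ : Equiv.Perm B)
    (hlink : ∀ n m, link n m → ∃ b, sb b = n ∧ sb (τ b) = m) :
    ∃ J : Matrix (M → Bool) ((A → Bool) × (A → Bool)) ℂ, IsEncoding sd sq link J := by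
  obtain ⟨χ, hχ1, hχ2⟩ := exists_coupled τ
  have hiso := encode_conjTranspose_mul e χ hχ1
  refine ⟨encode e χ * sumIso A A, ?_, hord, fun u => e (Sum.inlₗ (toLex u)), hea, fun u => ?_,
    fun u => ?_, fun n m hnm => ?_⟩
  · have : (encode e χ * sumIso A A)ᴴ * (encode e χ * sumIso A A) =
        (sumIso A A)ᴴ * ((encode e χ)ᴴ * encode e χ) * sumIso A A := by
      simp only [Matrix.conjTranspose_mul, Matrix.mul_assoc]
    rw [this]
    have h2 : (sumIso A A)ᴴ * ((encode e χ)ᴴ * encode e χ) = (sumIso A A)ᴴ := by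
      rw [hiso, Matrix.mul_one]
    rw [h2, sumIso_conjTranspose_mul]
  · rw [Matrix.mul_assoc, pairAnn, sumIso_mul_toPair, ← Matrix.mul_assoc, ← Matrix.mul_assoc]
    exact congrArg (fun x => x * sumIso A A) (ann_mul_encode e χ (toLex u))
  · rw [Matrix.mul_assoc, pairAnn, ← toPair_conjTranspose, sumIso_mul_toPair, ← Matrix.mul_assoc,
      ← Matrix.mul_assoc]
    exact congrArg (fun x => x * sumIso A A) (annH_mul_encode e χ (toLex u))
  · obtain ⟨b, hb, hb'⟩ := hlink n m hnm
    refine ⟨e (Sum.inrₗ b), e (Sum.inrₗ (τ b)), by rw [heb, hb], by rw [heb, hb'],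
      fun u hu => ?_, fun u hu => ?_, ?_⟩
    · have := e.injective hu
      simp [Sum.inlₗ, Sum.inrₗ] at this
    · have := e.injective hu
      simp [Sum.inlₗ, Sum.inrₗ] at this
    · rw [← Matrix.mul_assoc, coupling_mul_encode e χ b (τ b) (hχ2 b)]

variable {d : ℕ} (N : Fin d → ℕ) (k : ℕ)

/-- The assignment of the modes, their copies and the auxiliary modes to the qubits. -/
def modeQubit : (Mode N k ⊕ₗ Mode N k) ⊕ₗ (Fin d ×ₗ Site N) ≃ Site N × Fin (2 * k + d) :=
  ofLex.trans ((Equiv.sumCongr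
    (ofLex.trans ((Equiv.sumCongr ofLex ofLex).trans (Equiv.prodSumDistrib _ _ _).symm))
    (ofLex.trans (Equiv.prodComm _ _))).trans ((Equiv.prodSumDistrib _ _ _).symm.trans
      (Equiv.prodCongr (Equiv.refl _) ((Equiv.sumCongr finSumFinEquiv (Equiv.refl _)).trans
        (finSumFinEquiv.trans (finCongr (by rw [two_mul])))))))

theorem modeQubit_inl (u : Mode N k ⊕ Mode N k) :
    (modeQubit N k (Sum.inlₗ (toLex u))).1 = (ofLex (Sum.elim id id u)).1 := by
  rcases u with u | u <;> rfl

theorem modeQubit_inr (b : Fin d ×ₗ Site N) :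
    (modeQubit N k (Sum.inrₗ b)).1 = (ofLex b).2 := rfl

/-- The lexicographic order of the qubits. -/
@[reducible] def qubitOrder (q : ℕ) : LinearOrder (Site N × Fin q) :=
  withDecidableEq (LinearOrder.lift' (toLex : Site N × Fin q → Site N ×ₗ Fin q) toLex.injective)
    inferInstance

/-- The lexicographic order of the modes. -/
@[reducible] def modeOrder : LinearOrder (Mode N k) := withDecidableEq inferInstance inferInstance

theorem exists_lattice_encoding :
    ∃ J : Matrix (QConf N (2 * k + d)) (FConf N k × FConf N k) ℂ,
      letI := qubitOrder N (2 * k + d)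
      letI := modeOrder N k
      IsEncoding (fun j : Mode N k => (ofLex j).1) (Prod.fst : Site N × Fin (2 * k + d) → Site N)
        neighbor J := by
  let _ := qubitOrder N (2 * k + d)
  let _ := modeOrder N k
  refine exists_isEncoding (B := Fin d ×ₗ Site N) (fun j : Mode N k => (ofLex j).1)
    (fun b => (ofLex b).2) (Prod.fst : Site N × Fin (2 * k + d) → Site N) neighbor ?_
    (modeQubit N k) (modeQubit_inl N k) (modeQubit_inr N k)
    -- The auxiliary mode of direction `i` at `n` is coupled to that of direction `i` at the shifted
    -- site. The shift must be a permutation, hence it is cyclic whatever the boundary conditions.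
    (ofLex.trans ((Equiv.prodShear (Equiv.refl _) siteShift).trans toLex)) ?_
  · intro p i j hij hp
    have h : ∀ x : Site N × Fin (2 * k + d), x.1 = i.1 →
        ((qubitOrder N (2 * k + d)).lt p x ↔ p.1 < i.1) := by
      intro x hx
      have : (qubitOrder N (2 * k + d)).lt p x ↔ toLex p < toLex x := Iff.rfl
      rw [this, Prod.Lex.toLex_lt_toLex, hx]
      exact ⟨fun h => h.resolve_right fun h' => hp h'.1, Or.inl⟩
    exact (h i rfl).trans (h j hij.symm).symm
  · rintro n m ⟨i, hi⟩
    exact ⟨toLex (i, n), rfl, hi⟩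

end LatticeEncoding

end CausalFermions

end

/-! ### The theorem. -/

theorem mainTheorem8 (d : ℕ) :
    ∃ (c : ℕ) (f : ℕ → ℕ), ∀ (k : ℕ) (N : Fin d → ℕ) (per : Fin d → Bool),
      ∃ J : Matrix (CausalFermions.QConf N (2 * k + c))
          (CausalFermions.FConf N k × CausalFermions.FConf N k) ℂ,
        Jᴴ * J = 1 ∧
        (∀ (n : CausalFermions.Site N) (r : ℕ)
            (X : CausalFermions.FockOp (CausalFermions.Mode N k)),
          X.IsHermitian →
          CausalFermions.FermionEvenLocalized (CausalFermions.siteBall per n r) X →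
          ∃ Y : CausalFermions.QubitOp N (2 * k + c),
            Y.IsHermitian ∧
            CausalFermions.QubitLocalized (CausalFermions.siteBall per n r) Y ∧
            Y * J = J * (X ⊗ₖ (1 : CausalFermions.FockOp (CausalFermions.Mode N k)))) ∧
        (∀ (L : ℕ) (U : CausalFermions.FockOp (CausalFermions.Mode N k)),
          CausalFermions.IsCausalFermionic per L U →
          ∃ (V : CausalFermions.QubitOp N (2 * k + c)) (z : ℂ) (φ : CausalFermions.FConf N k → ℂ),
            CausalFermions.IsCausalQubit per (f L) V ∧
            ‖z‖ = 1 ∧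
            V * J = J * (U ⊗ₖ (z • Uᴴ)) ∧
            ∑ u, ‖φ u‖ ^ 2 = 1 ∧
            V * CausalFermions.sector J φ = CausalFermions.sector J φ * U) := by
  -- One auxiliary qubit per direction, and a spread of `2 * L` for each colour of `siteColor L`.
  refine ⟨d, fun L => 2 * L * Fintype.card (Fin d → Fin (2 * (2 * L + 1))), fun k N per => ?_⟩
  obtain ⟨J, hJ⟩ := CausalFermions.exists_lattice_encoding N k
  let _ := CausalFermions.qubitOrder N (2 * k + d)
  have hann : ∀ j : CausalFermions.Mode N k,
      CausalFermions.ann j = @CausalFermions.ann _ _ (CausalFermions.modeOrder N k) j :=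
    fun j => (CausalFermions.ann_withDecidableEq _ _ j).symm
  have hladder : ∀ R : Set (CausalFermions.Site N), CausalFermions.ladderOps (k := k) R ⊆
      @CausalFermions.siteLadders _ _ (CausalFermions.modeOrder N k) _
        (fun j : CausalFermions.Mode N k => (ofLex j).1) R := by
    rintro R x ⟨n, hn, i, hx⟩
    refine ⟨toLex (n, i), hn, ?_⟩
    rw [hann] at hx
    exact hx
  -- Evenness is recorded entrywise, without matrix products, so that it survives the change of the
  -- order instance below.
  have hpar : ∀ U : CausalFermions.FockOp (CausalFermions.Mode N k),
      CausalFermions.LeavesAddedModeInvariant U →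
      ∀ s t, CausalFermions.parSign s * U s t = U s t * CausalFermions.parSign t := by
    intro U hU s t
    rw [← CausalFermions.par_mul_apply, ← CausalFermions.mul_par_apply, hU.par_mul]
  let _ := CausalFermions.modeOrder N k
  have hl : ∀ n r m, m ∈ CausalFermions.siteBall per n r → ∀ l ∈ CausalFermions.siteBall per n r,
      CausalFermions.IsEncoding.Linked (fun j : CausalFermions.Mode N k => (ofLex j).1)
        (Prod.fst : CausalFermions.Site N × Fin (2 * k + d) → CausalFermions.Site N) J
        (CausalFermions.siteBall per n r) m l := by
    intro n r m hm l hl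
    -- Paths need a mode at every intermediate site; with `k = 0` there are no ladder operators and
    -- the claim is vacuous.
    rcases Nat.eq_zero_or_pos k with rfl | hk
    · rintro (u | u) <;> exact (ofLex u).2.elim0
    · exact CausalFermions.IsEncoding.linked_siteBall per hJ
        (fun n => ⟨toLex (n, ⟨0, hk⟩), rfl⟩) n r m hm l hl
  refine ⟨J, hJ.isometry, fun n r X hX hloc => ?_, fun L U hU => ?_⟩
  · have hrep : CausalFermions.Represented Prod.fst J (CausalFermions.siteBall per n r)
        (X ⊗ₖ (1 : CausalFermions.FockOp (CausalFermions.Mode N k))) := by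
      refine CausalFermions.represented_of_mem_adjoin_pairs (hl n r) (Algebra.adjoin_mono ?_ hloc)
      rintro z ⟨x, hx, y, hy, rfl⟩
      exact ⟨x, hladder _ hx, y, hladder _ hy, rfl⟩
    obtain ⟨Y, h1, h2, h3⟩ := hrep.exists_isHermitian (by
      rw [Matrix.IsHermitian, Matrix.conjTranspose_kronecker, hX.eq, Matrix.conjTranspose_one])
    exact ⟨Y, h1, CausalFermions.qubitLocalized_iff.2 h2, h3⟩
  · have hUU : Uᴴ * U = 1 := Matrix.mem_unitaryGroup_iff'.1 hU.unitary
    have hUpar : CausalFermions.par _ * U = U * CausalFermions.par _ := by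
      ext s t
      rw [CausalFermions.par_mul_apply, CausalFermions.mul_par_apply]
      exact hpar U hU.added s t
    obtain ⟨V, v1, v2, v3⟩ := CausalFermions.exists_causal_evolution
      (sd := fun j : CausalFermions.Mode N k => (ofLex j).1) (sq := Prod.fst) (J := J)
      (CausalFermions.siteDist per) (CausalFermions.siteDist_self per)
      (CausalFermions.siteDist_comm per) (CausalFermions.siteDist_triangle per)
      (fun n m h => by
        have : m ∈ CausalFermions.siteBall per n 0 := h
        rw [CausalFermions.siteBall_zero] at this
        exact (Set.mem_singleton_iff.1 this).symm)
      hl (CausalFermions.siteColor L) L (CausalFermions.lt_siteDist_of_siteColor per L) hUU hUpar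
      (fun j => by
        have h := Algebra.adjoin_mono (hladder _) (hU.causal (ofLex j).1 (ofLex j).2)
        rw [hann] at h
        exact h)
    obtain ⟨z, φ, hz, hφ, hzφ⟩ := CausalFermions.exists_unit_eigenvector hUU
    have hzz : star z * z = 1 := by
      rw [Complex.star_def, ← Complex.normSq_eq_conj_mul_self, Complex.normSq_eq_norm_sq, hz]
      simp
    have hVJ : z • V * J = J * (U ⊗ₖ (z • Uᴴ)) := by
      rw [Matrix.smul_mul, v3, Matrix.kronecker_smul, Matrix.mul_smul]
    -- The phase is absorbed into `V`, so that the copy evolves by `z • Uᴴ`, which fixes `φ`;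
    -- conjugation by `V` is unchanged.
    refine ⟨z • V, z, φ, ⟨?_, fun n X hX => ?_⟩, hz, hVJ, hφ, ?_⟩
    · rw [Matrix.mem_unitaryGroup_iff', Matrix.star_eq_conjTranspose, Matrix.conjTranspose_smul,
        Matrix.smul_mul, Matrix.mul_smul, smul_smul, hzz, one_smul, v1]
    · have e : (z • V)ᴴ * X * (z • V) = Vᴴ * X * V := by
        rw [Matrix.conjTranspose_smul, Matrix.smul_mul, Matrix.smul_mul, Matrix.mul_smul, smul_smul,
          hzz, one_smul]
      rw [e]
      exact CausalFermions.qubitLocalized_iff.2 (v2 n X (CausalFermions.qubitLocalized_iff.1 hX))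
    · rw [CausalFermions.sector_eq, ← Matrix.mul_assoc, hVJ, Matrix.mul_assoc,
        CausalFermions.kronecker_mul_kronCol, hzφ, Matrix.mul_assoc]
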